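/- Let $F$ be a field of characteristic different from $2$. Let $(A,\sigma)$ be of one of the following two kinds. * Unitary: $A=M_n(K)$ with $n\ge 1$, where $K$ is a quadratic étale $F$-algebra (a separable quadratic field extension of $F$, or $F\times F$) with nontrivial $F$-automorphism $\bar{\ }$, and $\sigma$ is an $F$-linear involution of $A$ that is not the identity on the center $K$. Put $D=K$, $r=n$. * Symplectic: $A=M_m(H)$ with $m\ge 1$, where $H=(a,b)_F$ ($a,b\in F^\times$) is a quaternion algebra over $F$ (possibly split) with canonical involution $\bar{\ }$, and $\sigma$ is an $F$-linear involution of $A$ of symplectic type. Put $D=H$, $r=m$. Then $\sigma$ is adjoint to a nondegenerate hermitian form $h$ on the right $D$-module $D^r$ with respect to $\bar{\ }$, i.e. $h(x,My)=h(\sigma(M)x,y)$ for all $M\in A$. For every such $h$, the map $x\mapsto h(x,x)$ takes its values in $F$ and is a quadratic form over $F$ on $D^r$; such a form is called a trace form $q_\sigma$ of $\sigma$. It is well defined up to a scalar factor: if $q_\sigma$ is a trace form of $\sigma$, then the trace forms of $\sigma$ are exactly the forms $c\,q_\sigma$ with $c\in F^\times$. Every trace form $q_\sigma$ of $\sigma$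 satisfies: (a) $i_w(\sigma)=i_{w,2}(\sigma)=\lfloor \tfrac12 i_w(q_\sigma)\rfloor$. Here $i_w(q_\sigma)$ is the Witt index of $q_\sigma$; $i_w(\sigma)$ is the largest reduced dimension of a right ideal $I$ of $A$ with $\sigma(I)I=0$ if the center of $A$ is a field, and $\lfloor\tfrac12\deg A\rfloor$ otherwise; and $i_{w,2}(\sigma)$ is the maximal value of $i_w(\sigma\otimes\mathrm{id}_{F'})$ over all field extensions $F'/F$ of finite odd degree. (b) If $\sigma$ is unitary and $n$ is even, then the signed discriminant of $q_\sigma$ is trivial, $d_{q_\sigma}=1\in F^\times/F^{\times2}$, and the discriminant algebra of $\sigma$ is Brauer equivalent to the full Clifford algebra of $q_\sigma$: $[\mathcal D(\sigma)]=c(q_\sigma)\in\mathrm{Br}(F)$. (With $n=2m$, $\mathcal D(\sigma)$ is the $F$-algebra of elements of $\lambda^mA=\mathrm{End}_K(\bigwedge^m K^n)$ fixed by $\sigma^{\wedge m}\circ\gamma$, where $\sigma^{\wedge m}$ is adjoint to the hermitian form $h^{\wedge m}$ and $\gamma$ is adjoint to the pairing $\bigwedge^mK^n\times\bigwedge^mK^n\to\bigwedge^{n}K^n\simeq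 K$, $(x,y)\mapsto x\wedge y$.) (c) For every ordering $P$ of $F$, $\mathrm{sign}_P(\sigma)=\tfrac12|\mathrm{sign}_P(q_\sigma)|$. Here $\mathrm{sign}_P(\sigma)$ is the nonnegative integer whose square is the signature at $P$ of the trace form $T_\sigma(x,y)=\mathrm{Trd}_A(\sigma(x)y)$; in the unitary case $T_\sigma$ is a hermitian form over $K$, and its signature is half that of the quadratic form $x\mapsto T_\sigma(x,x)$ over $F$ (so that it is $0$ if $P$ extends to $K$ or $K=F\times F$). -/

import Mathlib

open scoped TensorProduct Matrix Quaternion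

universe u

noncomputable section

namespace LowIndex

/-! ### Algebras with involution -/

section Involutions

variable (F : Type u) [Field F] {A : Type u} [Ring A] [Algebra F A]

/-- An `F`-linear involution of the `F`-algebra `A`: an anti-automorphism of order at most `2`. -/
structure IsInvolution (σ : A →ₗ[F] A) : Prop where
  map_mul : ∀ x y, σ (x * y) = σ y * σ x
  invol : ∀ x, σ (σ x) = x

/-- Unitary involutions (of the second kind): those that are not the identity on the center. -/
def IsUnitary (σ : A →ₗ[F] A) : Prop :=
  IsInvolution F σ ∧ ∃ z ∈ Subalgebra.center F A, σ z ≠ z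

/-- Symplectic involutions of a central simple `F`-algebra: over some field extension `L` that
splits the algebra, `σ` becomes the adjoint involution of a nondegenerate alternating bilinear form
`b (v, w) = vᵀ g w`, that is `b (v, x w) = b (σ x v, w)`. -/
def IsSymplectic (σ : A →ₗ[F] A) : Prop :=
  IsInvolution F σ ∧
    ∃ (L : Type u) (_ : Field L) (_ : Algebra F L) (d : ℕ)
      (φ : (L ⊗[F] A) ≃ₐ[L] Matrix (Fin d) (Fin d) L) (g : Matrix (Fin d) (Fin d) L),
      g.det ≠ 0 ∧ gᵀ = -g ∧ (∀ i, g i i = 0) ∧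
        ∀ x : L ⊗[F] A, g * φ x = (φ (σ.baseChange L x))ᵀ * g

variable (A) in
/-- The degree of an algebra with involution `A` over `F`: the square root of its dimension over
its center (if the center is `F × F` and `A = E × Eᵒᵖ`, this is the degree of `E`). -/
def degree : ℕ :=
  Nat.sqrt (Module.finrank F A / Module.finrank F (Subalgebra.center F A))

/-- The reduced dimension of a right ideal: its dimension over the center, divided by the degree. -/
def rdim (I : Submodule F A) : ℕ :=
  Module.finrank F I / (Module.finrank F (Subalgebra.center F A) * degree F A)

/-- Totally isotropic right ideals: `σ(I) I = 0`. -/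
def IsTotallyIsotropicRightIdeal (σ : A →ₗ[F] A) (I : Submodule F A) : Prop :=
  (∀ x ∈ I, ∀ a : A, x * a ∈ I) ∧ ∀ x ∈ I, ∀ y ∈ I, σ x * y = 0

open Classical in
/-- The Witt index of an involution: the largest reduced dimension of a totally isotropic right
ideal; if the center is not a field, the integral part of half the degree. -/
def wittIndex (σ : A →ₗ[F] A) : ℕ :=
  if IsField (Subalgebra.center F A) then
    sSup {k | ∃ I : Submodule F A, IsTotallyIsotropicRightIdeal F σ I ∧ rdim F I = k}
  else degree F A / 2

/-- The Witt `2`-index: the maximal Witt index of `σ_L` on `L ⊗ A`, for `L / F` of odd degree. -/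
def wittTwoIndex (σ : A →ₗ[F] A) : ℕ :=
  sSup {k | ∃ (L : Type u) (_ : Field L) (_ : Algebra F L),
    FiniteDimensional F L ∧ Odd (Module.finrank F L) ∧ wittIndex L (σ.baseChange L) = k}

/-- `A` is a central simple algebra (of finite dimension) over `F` with Brauer class `β`. -/
def HasBrauerClass (A : Type u) [Ring A] [Algebra F A] (β : BrauerGroup.{u, u} F) : Prop :=
  ∃ C : CSA.{u, u} F, Nonempty (A ≃ₐ[F] C) ∧ Quotient.mk (Brauer.CSA_Setoid F) C = β

end Involutions

/-! ### Quadratic forms -/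

section QuadraticForms

variable {F : Type u} [Field F] {V : Type u} [AddCommGroup V] [Module F V]

/-- The Witt index of a (nondegenerate) quadratic form: the largest dimension of a totally
isotropic subspace. -/
def quadWittIndex (q : QuadraticForm F V) : ℕ :=
  sSup {k | ∃ W : Submodule F V, (∀ x ∈ W, q x = 0) ∧ Module.finrank F W = k}

/-- The signed discriminant of `q` is the square class of `d`: for `r = dim q` and for the Gram
matrix `G` of `q` in any basis, `(-1) ^ (r (r - 1) / 2) * det G` is `d` times a nonzero square. -/
def HasSignedDiscriminant (q : QuadraticForm F V) (d : Fˣ) : Prop :=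
  ∀ b : Module.Basis (Fin (Module.finrank F V)) F V, ∃ c : Fˣ,
    (-1 : F) ^ (Module.finrank F V * (Module.finrank F V - 1) / 2) *
      (Matrix.of fun i j => QuadraticMap.polar q (b i) (b j) / 2).det = d * c ^ 2

/-- The signature of a quadratic form at the given ordering of `F`. -/
def signature [LinearOrder F] (q : QuadraticForm F V) : ℤ :=
  (sigPos q : ℤ) - sigNeg q

end QuadraticForms

/-! ### Hermitian forms and their trace forms -/

/-- Hermitian forms on the right module `Dⁿ`, for a ring with involution `(D, star)`:
`h (x c, y d) = star c * h (x, y) * d` and `h (y, x) = star (h (x, y))`. -/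
structure HermitianForm (D : Type u) [Ring D] [StarRing D] (n : ℕ) where
  toFun : (Fin n → D) → (Fin n → D) → D
  add_right : ∀ x y z, toFun x (y + z) = toFun x y + toFun x z
  mul_right : ∀ x y d, toFun x (fun i => y i * d) = toFun x y * d
  star_apply : ∀ x y, star (toFun x y) = toFun y x

section TraceForms

variable (F : Type u) [Field F] {D : Type u} [Ring D] [StarRing D] [Algebra F D] {n : ℕ}

/-- `h` is nondegenerate and `σ` is the adjoint involution of `h`:
`h (x, M y) = h (σ(M) x, y)`. -/
def IsUnderlyingForm (σ : Matrix (Fin n) (Fin n) D →ₗ[F] Matrix (Fin n) (Fin n) D)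
    (h : HermitianForm D n) : Prop :=
  (∀ x, (∀ y, h.toFun x y = 0) → x = 0) ∧
    ∀ M x y, h.toFun x (M *ᵥ y) = h.toFun (σ M *ᵥ x) y

/-- `q` is the trace form of `h`: the quadratic form `q(x) = h (x, x)` over `F` on `Dⁿ`. -/
def IsTraceForm (h : HermitianForm D n) (q : QuadraticForm F (Fin n → D)) : Prop :=
  ∀ x, algebraMap F D (q x) = h.toFun x x

/-- `q` is a trace form `q_σ` of the involution `σ`, that is the trace form of a hermitian form
to which `σ` is adjoint. -/
def IsTraceFormOf (σ : Matrix (Fin n) (Fin n) D →ₗ[F] Matrix (Fin n) (Fin n) D)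
    (q : QuadraticForm F (Fin n → D)) : Prop :=
  ∃ h : HermitianForm D n, IsUnderlyingForm F σ h ∧ IsTraceForm F h q

end TraceForms

/-! ### Unitary involutions of split algebras -/

/-- `K` is a quadratic étale `F`-algebra (a separable quadratic field extension or `F × F`), and
`star` is its nontrivial `F`-automorphism. -/
class IsQuadraticEtale (F K : Type u) [Field F] [CommRing K] [StarRing K] [Algebra F K] :
    Prop where
  etale : Algebra.Etale F K
  finrank_eq_two : Module.finrank F K = 2
  star_algebraMap : ∀ c : F, star (algebraMap F K c) = algebraMap F K c
  exists_star_ne : ∃ z : K, star z ≠ z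

section Unitary

variable {F K : Type u} [Field F] [CommRing K] [StarRing K] [Algebra F K] {n : ℕ}

/-- The linear functional `h (x, ·)`. -/
def HermitianForm.toDual (h : HermitianForm K n) (x : Fin n → K) :
    Module.Dual K (Fin n → K) where
  toFun y := h.toFun x y
  map_add' := h.add_right x
  map_smul' d y := by
    have := h.mul_right x y d
    simpa [mul_comm, Pi.smul_def] using this

/-- `h^{∧m} (x₁ ∧ ⋯ ∧ xₘ, ω)`, where `h^{∧m}` is the hermitian form on `⋀ᵐ Kⁿ` given by
`h^{∧m} (x₁ ∧ ⋯ ∧ xₘ, y₁ ∧ ⋯ ∧ yₘ) = det (h (xᵢ, yⱼ))`. -/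
def HermitianForm.wedge (h : HermitianForm K n) {m : ℕ} (x : Fin m → Fin n → K) :
    ⋀[K]^m (Fin n → K) →ₗ[K] K :=
  exteriorPower.pairingDual K (Fin n → K) m
    (exteriorPower.ιMulti K m fun i => h.toDual (x i))

theorem HermitianForm.wedge_ιMulti (h : HermitianForm K n) {m : ℕ} (x y : Fin m → Fin n → K) :
    h.wedge x (exteriorPower.ιMulti K m y) =
      (Matrix.of fun i j => h.toFun (x i) (y j)).det := by
  rw [HermitianForm.wedge, exteriorPower.pairingDual_ιMulti_ιMulti, ← Matrix.det_transpose]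
  rfl

theorem HermitianForm.star_wedge_ιMulti (h : HermitianForm K n) {m : ℕ}
    (x y : Fin m → Fin n → K) :
    star (h.wedge y (exteriorPower.ιMulti K m x)) = h.wedge x (exteriorPower.ιMulti K m y) := by
  rw [wedge_ιMulti, wedge_ιMulti, ← Matrix.det_conjTranspose]
  congr 1
  ext i j
  exact h.star_apply _ _

/-- `g = γ(f)` for the canonical involution `γ` of `End (⋀ᵐ Kⁿ)`, `n = 2m`, which is adjoint to the
pairing `⋀ᵐ Kⁿ × ⋀ᵐ Kⁿ → ⋀ⁿ Kⁿ ≃ K`, `(x, y) ↦ x ∧ y`. -/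
def IsCanonicalAdjoint {m : ℕ} (f g : Module.End K (⋀[K]^m (Fin n → K))) : Prop :=
  ∀ x y : ⋀[K]^m (Fin n → K),
    ((g x : ExteriorAlgebra K (Fin n → K)) * (y : ExteriorAlgebra K (Fin n → K))) =
      (x : ExteriorAlgebra K (Fin n → K)) * (f y : ExteriorAlgebra K (Fin n → K))

/-- `g = σ^{∧m}(f)`, for `σ` adjoint to `h`: the involution `σ^{∧m}` of `End (⋀ᵐ Kⁿ)` is adjoint to
`h^{∧m}`, so that `h^{∧m} (g x, y) = h^{∧m} (x, f y)`. As `h^{∧m}` is hermitian and decomposable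
elements generate `⋀ᵐ Kⁿ`, it is enough to take `x` and `y` decomposable and to write the left hand
side as `star (h^{∧m} (y, g x))`. -/
def IsWedgeAdjoint (h : HermitianForm K n) {m : ℕ}
    (f g : Module.End K (⋀[K]^m (Fin n → K))) : Prop :=
  ∀ x y : Fin m → Fin n → K,
    star (h.wedge y (g (exteriorPower.ιMulti K m x))) =
      h.wedge x (f (exteriorPower.ιMulti K m y))

theorem IsWedgeAdjoint.mul {h : HermitianForm K n} {m : ℕ}
    {f₁ f₂ g₁ g₂ : Module.End K (⋀[K]^m (Fin n → K))}
    (w₁ : IsWedgeAdjoint h f₁ g₁) (w₂ : IsWedgeAdjoint h f₂ g₂) :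
    IsWedgeAdjoint h (f₁ * f₂) (g₂ * g₁) := by
  have key : ∀ ω : ⋀[K]^m (Fin n → K), ∃ φ : ⋀[K]^m (Fin n → K) →ₗ[K] K,
      (∀ x, φ (exteriorPower.ιMulti K m x) = star (h.wedge x ω)) ∧
        ∀ x, star (φ (g₁ (exteriorPower.ιMulti K m x))) = h.wedge x (f₁ ω) := by
    intro ω
    have hω : ω ∈ Submodule.span K (Set.range (exteriorPower.ιMulti K m (M := Fin n → K))) := by
      rw [exteriorPower.ιMulti_span]; trivial
    induction hω using Submodule.span_induction with
    | mem ω hω =>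
      obtain ⟨y, rfl⟩ := hω
      exact ⟨h.wedge y, fun x => (h.star_wedge_ιMulti y x).symm, fun x => w₁ x y⟩
    | zero => exact ⟨0, by simp, by simp⟩
    | add ω₁ ω₂ _ _ h₁ h₂ =>
      obtain ⟨φ₁, a₁, b₁⟩ := h₁
      obtain ⟨φ₂, a₂, b₂⟩ := h₂
      exact ⟨φ₁ + φ₂, by simp [a₁, a₂], by simp [b₁, b₂]⟩
    | smul c ω _ h₁ =>
      obtain ⟨φ₁, a₁, b₁⟩ := h₁
      exact ⟨star c • φ₁, by simp [a₁], by simp [b₁]⟩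
  intro x y
  obtain ⟨φ, a, b⟩ := key (f₂ (exteriorPower.ιMulti K m y))
  have hφ : φ = h.wedge y ∘ₗ g₂ := by
    apply exteriorPower.linearMap_ext
    ext1 z
    have := congrArg star (w₂ z y)
    rw [star_star] at this
    simp [a, this]
  have := b x
  rw [hφ] at this
  exact this

/-- The discriminant algebra `𝒟(σ)` of a unitary involution `σ` of `M_n(K)`, `n = 2m`: the
`F`-algebra of the `f` in `λᵐ M_n(K) = End (⋀ᵐ Kⁿ)` that are fixed by `σ^{∧m} ∘ γ`, that is with
`γ(f) = σ^{∧m}(f)`. (Here `σ^{∧m}` is computed with any hermitian form `h` to which `σ` is adjoint: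
such an `h` is unique up to a factor in `Fˣ`, which does not affect the condition.) -/
def discriminantAlgebra [IsQuadraticEtale F K]
    (σ : Matrix (Fin n) (Fin n) K →ₗ[F] Matrix (Fin n) (Fin n) K) (m : ℕ) :
    Subalgebra F (Module.End K (⋀[K]^m (Fin n → K))) where
  carrier := {f | ∀ h : HermitianForm K n, IsUnderlyingForm F σ h →
    ∃ g, IsCanonicalAdjoint f g ∧ IsWedgeAdjoint h f g}
  mul_mem' := by
    intro f₁ f₂ h₁ h₂ h hh
    obtain ⟨g₁, c₁, w₁⟩ := h₁ h hh
    obtain ⟨g₂, c₂, w₂⟩ := h₂ h hh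
    exact ⟨g₂ * g₁, fun x y => (c₂ (g₁ x) y).trans (c₁ x (f₂ y)), w₁.mul w₂⟩
  add_mem' := by
    intro f₁ f₂ h₁ h₂ h hh
    obtain ⟨g₁, c₁, w₁⟩ := h₁ h hh
    obtain ⟨g₂, c₂, w₂⟩ := h₂ h hh
    refine ⟨g₁ + g₂, fun x y => ?_, fun x y => ?_⟩
    · simp [add_mul, mul_add, c₁ x y, c₂ x y]
    · simp [w₁ x y, w₂ x y]
  algebraMap_mem' := by
    intro c h hh
    refine ⟨algebraMap F _ c, fun x y => ?_, fun x y => ?_⟩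
    · simp [Module.algebraMap_end_apply]
    · rw [Module.algebraMap_end_apply, Module.algebraMap_end_apply, ← algebraMap_smul K c,
        ← algebraMap_smul K c, map_smul, map_smul, smul_eq_mul, smul_eq_mul, star_mul',
        IsQuadraticEtale.star_algebraMap, h.star_wedge_ιMulti]

instance [IsQuadraticEtale F K]
    (σ : Matrix (Fin n) (Fin n) K →ₗ[F] Matrix (Fin n) (Fin n) K) (m : ℕ) :
    Ring (discriminantAlgebra σ m) :=
  Subalgebra.toRing (A := Module.End K (⋀[K]^m (Fin n → K))) (discriminantAlgebra σ m)

variable (F) in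
/-- The trace form `T_σ (x, x) = Trd (σ(x) x)` of a unitary involution `σ` of `M_n(K)`, as a
quadratic form over `F`. As `Trd (σ(x) x)` is fixed by `star`, it lies in `F` and is half its own
trace from `K` to `F`. -/
def unitaryTraceForm (σ : Matrix (Fin n) (Fin n) K →ₗ[F] Matrix (Fin n) (Fin n) K) :
    QuadraticForm F (Matrix (Fin n) (Fin n) K) :=
  (2⁻¹ : F) • LinearMap.BilinMap.toQuadraticMap (((LinearMap.mul F _).comp σ).compr₂
    ((Algebra.trace F K).comp (Matrix.traceLinearMap (Fin n) F K)))

/-- `s` is the signature of the unitary involution `σ` at the given ordering of `F`: it is the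
nonnegative integer whose square is the signature of the hermitian form
`T_σ (x, y) = Trd (σ(x) y)` over `K`, which is half the signature of the quadratic form
`x ↦ T_σ (x, x)` over `F`. -/
def IsUnitarySignature [LinearOrder F]
    (σ : Matrix (Fin n) (Fin n) K →ₗ[F] Matrix (Fin n) (Fin n) K) (s : ℕ) : Prop :=
  2 * (s : ℤ) ^ 2 = signature (unitaryTraceForm F σ)

end Unitary

/-! ### Symplectic involutions of algebras of index at most two -/

section Symplectic

variable {F : Type u} [Field F] {a b : F} {m : ℕ}

variable (F a b m) in
/-- The reduced trace of `M_m(H)`, for the quaternion algebra `H = (a, b)` over `F`: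
the sum of the reduced traces `2 re` of the diagonal entries. -/
def quaternionReducedTrace : Matrix (Fin m) (Fin m) ℍ[F,a,b] →ₗ[F] F where
  toFun x := ∑ i, 2 * (x i i).re
  map_add' x y := by simp [mul_add, Finset.sum_add_distrib]
  map_smul' c x := by simp [Finset.mul_sum, mul_left_comm]

/-- The trace form `x ↦ Trd (σ(x) x)` of an involution `σ` of `M_m(H)`. -/
def symplecticTraceForm
    (σ : Matrix (Fin m) (Fin m) ℍ[F,a,b] →ₗ[F] Matrix (Fin m) (Fin m) ℍ[F,a,b]) :
    QuadraticForm F (Matrix (Fin m) (Fin m) ℍ[F,a,b]) :=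
  LinearMap.BilinMap.toQuadraticMap (((LinearMap.mul F _).comp σ).compr₂
    (quaternionReducedTrace F a b m))

/-- `s` is the signature of the symplectic involution `σ` at the given ordering of `F`: it is the
nonnegative integer whose square is the signature of the trace form of `σ`. -/
def IsSymplecticSignature [LinearOrder F]
    (σ : Matrix (Fin m) (Fin m) ℍ[F,a,b] →ₗ[F] Matrix (Fin m) (Fin m) ℍ[F,a,b]) (s : ℕ) : Prop :=
  (s : ℤ) ^ 2 = signature (symplecticTraceForm σ)

end Symplectic

end LowIndex

end

/-!
Both kinds of involutions are treated uniformly: `D` is a finite-dimensional `F`-algebra with a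
standard involution `star`, which means that `x + star x` is a scalar and that the resulting trace
form is nondegenerate (`IsStandardInvolution`). Étale quadratic algebras and quaternion algebras are
of this kind, and so are their extensions of scalars. A hermitian form on `Dⁿ` is given by its Gram
matrix `G`, and `σ` is adjoint to it if and only if `σ(x) = G⁻¹ x* G`.

*Existence and uniqueness of the form.* The map `x ↦ σ(x*)` is an automorphism of `Mₙ(D)` that is
the identity on the center. It is inner by an explicit form of the Skolem–Noether theorem
(`exists_isUnit_mul_eq_mul`), which yields a matrix `G` with `G σ(x) = x* G`, unique up to a central
factor, and `G* = l G` with `l` central. In the unitary case, Hilbert's Theorem 90 provides a factor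
that makes `G` hermitian; in the symplectic case `l = ± 1`, and `l = -1` would give `σ` too many
symmetric elements.

*Witt indices.* Isotropic right ideals of `Mₙ(D)` correspond to totally isotropic `D`-submodules of
`Dⁿ`. A maximal one among these is also a maximal totally isotropic `F`-subspace for the trace form
`q`, since an isotropic vector of its orthogonal complement generates a totally isotropic submodule.
Halving dimensions gives `wittIndex_eq`. Springer's theorem shows that the Witt index of `q` does
not change under extensions of odd degree, and `σ ⊗ id` has the extension of `q` as its trace form
(`wittTwoIndex_eq`).

*Signatures.* In an orthogonal basis with `h (eᵢ, eᵢ) = aᵢ`, the trace form is the orthogonal sum of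
the forms `aᵢ N`, where `N` is the norm form of `D`, and `Trd (σ(x) x)` is the orthogonal sum of the
forms `2 (aᵢ / aⱼ) N`. So their signatures are `S · sign N` and `S² · sign N` with `S = ∑ sign aᵢ`
(`exists_signature_eq`).

*The Clifford algebra and the discriminant algebra.* Let `σ` be unitary, `n = 2 m` and
`d = (-1) ^ m ∏ aᵢ`. Both algebras are shown to be the centralizer of a `star`-semilinear map `J`
with `J² = d` on a free `K`-module, and such a centralizer is a matrix algebra over the quaternion
algebra `K ⊕ K z` with `z² = d` (`semilinearCentralizer_hasBrauerClass`). For the Clifford algebra,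
an irreducible representation over `K` and the map `J` are built by adding one variable at a time
(`IsCliffordRep.step`). For the discriminant algebra, the elements fixed by `σ^{∧m} ∘ γ` commute
with the map `J` for which `x ∧ J y` is `h^{∧m} (y, x)` times a volume form;
it maps `e_S` to a multiple of `e_T`, for `T` the complement of `S`, and its square is `d`.
-/

noncomputable section

namespace LowIndex

/-! ### Springer's theorem -/

section Springer

open Polynomial

theorem exists_irreducible_dvd_odd_natDegree {F : Type*} [Field F] :
    ∀ (d : ℕ) (g : F[X]), g.natDegree = d → Odd d →
      ∃ p, Irreducible p ∧ Odd p.natDegree ∧ p ∣ g := by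
  intro d
  induction d using Nat.strong_induction_on with
  | _ d ih =>
    intro g hg hd
    have hpos : 0 < g.natDegree := hg ▸ hd.pos
    obtain ⟨p, hp, hpg⟩ := Polynomial.exists_irreducible_of_natDegree_pos hpos
    by_cases ho : Odd p.natDegree
    · exact ⟨p, hp, ho, hpg⟩
    · obtain ⟨r, rfl⟩ := hpg
      have h0 : p * r ≠ 0 := by rintro h; simp [h] at hpos
      have hm := natDegree_mul (left_ne_zero_of_mul h0) (right_ne_zero_of_mul h0)
      have hp1 := hp.natDegree_pos
      have hr : Odd r.natDegree := by
        rw [Nat.not_odd_iff_even] at ho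
        rw [← hg, hm, Nat.odd_add'] at hd
        exact hd.2 ho
      obtain ⟨p', h1, h2, h3⟩ := ih r.natDegree (by omega) r rfl hr
      exact ⟨p', h1, h2, h3.mul_left p⟩

/-- The diagonal form with coefficients `w` has no nontrivial zero over the `F`-algebra `L`. -/
def IsAnisotropicDiagonal {ι : Type*} [Fintype ι] {F : Type*} [Field F] (w : ι → F)
    (L : Type*) [Field L] [Algebra F L] : Prop :=
  ∀ x : ι → L, ∑ i, algebraMap F L (w i) * x i ^ 2 = 0 → x = 0

variable {ι : Type*} [Fintype ι] {F : Type*} [Field F] {w : ι → F}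

theorem natDegree_sum_sq_of_isAnisotropicDiagonal (hw : IsAnisotropicDiagonal w F) {m : ℕ}
    {f : ι → F[X]} (hf : ∀ i, (f i).natDegree ≤ m) {i₀ : ι} (h0 : (f i₀).coeff m ≠ 0) :
    (∑ i, C (w i) * f i ^ 2).natDegree = 2 * m := by
  apply natDegree_eq_of_le_of_coeff_ne_zero
  · refine natDegree_sum_le_of_forall_le _ _ fun i _ => ?_
    refine (natDegree_C_mul_le _ _).trans ?_
    exact natDegree_pow_le_of_le 2 (hf i)
  · rw [finsetSum_coeff]
    intro h
    refine h0 (congrFun (hw (fun i => (f i).coeff m) ?_) i₀)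
    rw [← h]
    refine Finset.sum_congr rfl fun i _ => ?_
    rw [coeff_C_mul, ← coeff_pow_of_natDegree_le (hf i)]
    simp

/-- The polynomial form of Springer's theorem: if the values `f i` of low degree were not all zero,
the quotient of `∑ w i (f i)²` by `p` would have an irreducible factor of odd degree smaller than
that of `p`; by induction it divides all the `f i` and can be cancelled. -/
theorem eq_zero_of_irreducible_dvd_sum_sq (hw : IsAnisotropicDiagonal w F) :
    ∀ (d : ℕ) (p : F[X]), Irreducible p → p.natDegree = d → Odd d →
      ∀ (m : ℕ) (f : ι → F[X]), m < d → (∀ i, (f i).natDegree ≤ m) →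
        p ∣ ∑ i, C (w i) * f i ^ 2 → f = 0 := by
  intro d
  induction d using Nat.strong_induction_on with
  | _ d ihd =>
    intro p hp hpd hd m
    induction m using Nat.strong_induction_on with
    | _ m ihm =>
      intro f hmd hf hdvd
      by_contra hne
      by_cases hc : ∀ i, (f i).coeff m = 0
      · rcases Nat.eq_zero_or_pos m with rfl | hm
        · refine hne (funext fun i => ?_)
          rw [eq_C_of_natDegree_le_zero (hf i), hc i]; simp
        · refine hne (ihm (m - 1) (by omega) f (by omega) (fun i => ?_) hdvd)
          rw [natDegree_le_iff_coeff_eq_zero]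
          intro N hN
          rcases Nat.lt_or_ge m N with h | h
          · exact coeff_eq_zero_of_natDegree_lt ((hf i).trans_lt h)
          · rw [show N = m by omega]; exact hc i
      · push Not at hc
        obtain ⟨i₀, hi₀⟩ := hc
        have hdeg := natDegree_sum_sq_of_isAnisotropicDiagonal hw hf hi₀
        obtain ⟨g, hg⟩ := hdvd
        have hS : ∑ i, C (w i) * f i ^ 2 ≠ 0 := by
          intro h
          rw [h, natDegree_zero] at hdeg
          have hm : m = 0 := by omega
          subst hm
          refine hi₀ (congrFun (hw (fun i => (f i).coeff 0) ?_) i₀)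
          have := congrArg (fun q => coeff q 0) h
          rw [finsetSum_coeff] at this
          simpa [mul_coeff_zero, pow_two] using this
        rw [hg] at hS hdeg
        have hg0 := right_ne_zero_of_mul hS
        rw [natDegree_mul hp.ne_zero hg0, hpd] at hdeg
        -- the leading terms do not cancel, so `deg g = 2 m - deg p` is odd and less than `deg p`
        have hgo : Odd g.natDegree := by
          obtain ⟨k, hk⟩ := hd
          exact ⟨m - k - 1, by omega⟩
        obtain ⟨r, hr, hro, hrg⟩ := exists_irreducible_dvd_odd_natDegree _ g rfl hgo
        have hrd : r.natDegree < d := by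
          have := natDegree_le_of_dvd hrg hg0
          omega
        have hmod : ∀ i, r ∣ f i := by
          have key := ihd r.natDegree hrd r hr rfl hro (r.natDegree - 1)
            (fun i => f i % r) (by have := hro.pos; omega)
            (fun i => by
              have := natDegree_mod_lt (f i) (q := r) (by have := hro.pos; omega)
              show (f i % r).natDegree ≤ _
              omega) ?_
          · intro i
            exact EuclideanDomain.mod_eq_zero.1 (congrFun key i)
          · have h1 : r ∣ ∑ i, C (w i) * f i ^ 2 := hg ▸ hrg.mul_left p
            have h2 : r ∣ ∑ i, C (w i) * f i ^ 2 - ∑ i, C (w i) * (f i % r) ^ 2 := by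
              rw [← Finset.sum_sub_distrib]
              refine Finset.dvd_sum fun i _ => ?_
              rw [← mul_sub, sq_sub_sq]
              refine Dvd.dvd.mul_left (Dvd.dvd.mul_left ?_ _) _
              exact ⟨f i / r, by
                rw [sub_eq_iff_eq_add, add_comm, EuclideanDomain.mod_add_div]⟩
            exact (dvd_sub_right h1).1 h2
        choose e he using hmod
        have hr0 := hr.ne_zero
        have h3 : r ^ 2 * ∑ i, C (w i) * e i ^ 2 = p * g := by
          rw [← hg, Finset.mul_sum]
          refine Finset.sum_congr rfl fun i _ => ?_
          rw [he i]; ring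
        have hcop : IsCoprime p (r ^ 2) := by
          refine IsCoprime.pow_right ((hp.coprime_iff_not_dvd).2 fun h => ?_)
          have := natDegree_le_of_dvd h hr0
          omega
        have hdvd' : p ∣ ∑ i, C (w i) * e i ^ 2 :=
          hcop.dvd_of_dvd_mul_left (h3 ▸ dvd_mul_right p g)
        have hrm : r.natDegree ≤ m := by
          have : f i₀ ≠ 0 := by rintro h; simp [h] at hi₀
          exact (natDegree_le_of_dvd ⟨e i₀, he i₀⟩ this).trans (hf i₀)
        have he0 := ihm (m - r.natDegree) (by have := hro.pos; omega) e (by omega) (fun i => by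
          by_cases h : e i = 0
          · simp [h]
          · have h4 := hf i
            rw [he i, natDegree_mul hr0 h] at h4
            omega) hdvd'
        exact hi₀ (by rw [he i₀, he0]; simp)

theorem IsAnisotropicDiagonal.adjoin_simple {L : Type*} [Field L] [Algebra F L]
    (hw : IsAnisotropicDiagonal w F) (α : L) (hα : IsIntegral F α)
    (hodd : Odd (minpoly F α).natDegree) :
    IsAnisotropicDiagonal w (IntermediateField.adjoin F {α}) := by
  intro x hx
  let pb := IntermediateField.adjoin.powerBasis hα
  have hpb : minpoly F pb.gen = minpoly F α := by
    rw [IntermediateField.adjoin.powerBasis_gen, IntermediateField.minpoly_gen]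
  have hex : ∀ i, ∃ f : F[X], x i = aeval pb.gen f := fun i => pb.exists_eq_aeval' (x i)
  choose f hf using hex
  have hint : IsIntegral F pb.gen := pb.isIntegral_gen
  have hmon := minpoly.monic hint
  have hdeg : (minpoly F pb.gen).natDegree ≠ 0 := by rw [hpb]; exact hodd.pos.ne'
  have hred : ∀ i, x i = aeval pb.gen (f i %ₘ minpoly F pb.gen) := fun i => by
    rw [aeval_modByMonic_eq_self_of_root (minpoly.aeval _ _), hf]
  have h0 : (fun i => f i %ₘ minpoly F pb.gen) = 0 := by
    refine eq_zero_of_irreducible_dvd_sum_sq hw _ _ (minpoly.irreducible hint) rfl (hpb ▸ hodd)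
      ((minpoly F pb.gen).natDegree - 1) _ (by omega) (fun i => ?_) ?_
    · have := natDegree_modByMonic_lt (f i) hmon (fun h => hdeg (by rw [h, natDegree_one]))
      show (f i %ₘ minpoly F pb.gen).natDegree ≤ _
      omega
    · apply minpoly.dvd
      rw [map_sum, ← hx]
      refine Finset.sum_congr rfl fun i _ => ?_
      rw [hred i, map_mul, map_pow, aeval_C]
  funext i
  rw [hred i]
  have := congrFun h0 i
  simp only [Pi.zero_apply] at this
  rw [this, map_zero]; rfl

/-- **Springer's theorem**: anisotropic quadratic forms stay anisotropic over extensions of odd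
degree. -/
theorem IsAnisotropicDiagonal.of_odd_finrank : ∀ (d : ℕ) {F : Type u} [Field F] {w : ι → F}
    {L : Type u} [Field L] [Algebra F L] [FiniteDimensional F L],
    Module.finrank F L = d → Odd d → IsAnisotropicDiagonal w F → IsAnisotropicDiagonal w L := by
  intro d
  induction d using Nat.strong_induction_on with
  | _ d ih =>
    intro F _ w L _ _ _ hd hodd hw
    by_cases h : ∀ α : L, α ∈ Set.range (algebraMap F L)
    · intro x hx
      choose y hy using h
      have : (fun i => y (x i)) = 0 := hw _ (by
        apply (algebraMap F L).injective
        rw [map_zero, map_sum, ← hx]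
        refine Finset.sum_congr rfl fun i _ => ?_
        simp [hy])
      funext i
      rw [← hy (x i), show y (x i) = 0 from congrFun this i, map_zero]; rfl
    · push Not at h
      obtain ⟨α, hα⟩ := h
      have hint : IsIntegral F α := IsIntegral.of_finite F α
      let E := IntermediateField.adjoin F {α}
      have hE : Module.finrank F E = (minpoly F α).natDegree :=
        IntermediateField.adjoin.finrank hint
      have hmul := Module.finrank_mul_finrank F E L
      rw [hd] at hmul
      have ho := hmul ▸ hodd
      rw [Nat.odd_mul] at ho
      have hwE : IsAnisotropicDiagonal w E := hw.adjoin_simple α hint (hE ▸ ho.1)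
      have h1 : Module.finrank F E ≠ 1 := by
        intro h1
        rw [IntermediateField.finrank_eq_one_iff] at h1
        have : α ∈ (⊥ : IntermediateField F L) := h1 ▸ IntermediateField.mem_adjoin_simple_self F α
        exact hα (IntermediateField.mem_bot.1 this)
      have hlt : Module.finrank E L < d := by
        rw [← hmul]
        exact lt_mul_of_one_lt_left ho.2.pos (by have := ho.1.pos; omega)
      have := ih _ hlt (F := E) (w := fun i => algebraMap F E (w i)) (L := L) rfl ho.2 (by
        intro x hx
        exact hwE x (by simpa using hx))
      intro x hx
      exact this x (by
        rw [← hx]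
        refine Finset.sum_congr rfl fun i _ => ?_
        rw [← IsScalarTower.algebraMap_apply])

end Springer

/-! ### Witt indices of quadratic forms -/

section WittIndex

open Module QuadraticMap

variable {F : Type u} [Field F] {V : Type u} [AddCommGroup V] [Module F V]

/-- Let `P` be orthogonal to `W` and at least as large as the orthogonal complement of `W`. If all
isotropic vectors of `P` lie in `W`, then no totally isotropic subspace `U` is larger than `W`:
`U ⊓ P ≤ W`, and `U ⊔ P` is orthogonal to `U ⊓ P`. -/
theorem finrank_le_of_isotropic [FiniteDimensional F V] {q : QuadraticForm F V}
    (hq : (polarBilin q).Nondegenerate) {W P U : Submodule F V}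
    (hWP : ∀ w ∈ W, ∀ p ∈ P, polar q w p = 0)
    (hdim : finrank F V ≤ finrank F P + finrank F W) (hP : ∀ x ∈ P, q x = 0 → x ∈ W)
    (hU : ∀ x ∈ U, q x = 0) : finrank F U ≤ finrank F W := by
  have h1 : U ⊓ P ≤ W := fun x hx => hP x hx.2 (hU x hx.1)
  have h2 : U ⊔ P ≤ LinearMap.BilinForm.orthogonal (polarBilin q) (U ⊓ P) := by
    refine sup_le (fun x hx => ?_) (fun x hx => ?_)
    · rw [LinearMap.BilinForm.mem_orthogonal_iff]
      intro y hy
      change polar q y x = 0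
      rw [polar, hU _ hx, hU _ hy.1, hU _ (U.add_mem hy.1 hx), sub_zero, sub_zero]
    · rw [LinearMap.BilinForm.mem_orthogonal_iff]
      intro y hy
      exact hWP y (h1 hy) x hx
  have h3 := Submodule.finrank_mono h2
  rw [LinearMap.BilinForm.finrank_orthogonal hq] at h3
  have h4 := Submodule.finrank_sup_add_finrank_inf_eq U P
  have h5 := (U ⊓ P).finrank_le
  omega

theorem quadWittIndex_eq [FiniteDimensional F V] {q : QuadraticForm F V}
    (hq : (polarBilin q).Nondegenerate) {W P : Submodule F V} (hW : ∀ x ∈ W, q x = 0)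
    (hWP : ∀ w ∈ W, ∀ p ∈ P, polar q w p = 0)
    (hdim : finrank F V ≤ finrank F P + finrank F W) (hP : ∀ x ∈ P, q x = 0 → x ∈ W) :
    quadWittIndex q = finrank F W := by
  apply IsGreatest.csSup_eq
  refine ⟨⟨W, hW, rfl⟩, ?_⟩
  rintro k ⟨U, hU, rfl⟩
  exact finrank_le_of_isotropic hq hWP hdim hP hU

theorem polar_eq_zero_of_isotropic {q : QuadraticForm F V} {W : Submodule F V}
    (hW : ∀ x ∈ W, q x = 0) : ∀ x ∈ W, ∀ y ∈ W, polar q x y = 0 := fun x hx y hy => by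
  simp [polar, hW _ hx, hW _ hy, hW _ (W.add_mem hx hy)]

theorem quadWittIndex_eq_of_two_mul [FiniteDimensional F V] {q : QuadraticForm F V}
    (hq : (polarBilin q).Nondegenerate) {W : Submodule F V} (hW : ∀ x ∈ W, q x = 0)
    (hdim : finrank F V = 2 * finrank F W) :
    quadWittIndex q = finrank F W :=
  quadWittIndex_eq hq hW (polar_eq_zero_of_isotropic hW) (by omega) fun _ h _ => h

/-- The Witt index, defined as a supremum, is attained by a totally isotropic subspace. -/
theorem exists_finrank_eq_quadWittIndex [FiniteDimensional F V] (q : QuadraticForm F V) :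
    ∃ W : Submodule F V, (∀ x ∈ W, q x = 0) ∧ finrank F W = quadWittIndex q ∧
      ∀ U : Submodule F V, (∀ x ∈ U, q x = 0) → finrank F U ≤ finrank F W := by
  have hb : BddAbove {k | ∃ W : Submodule F V, (∀ x ∈ W, q x = 0) ∧ finrank F W = k} :=
    ⟨finrank F V, by rintro k ⟨W, -, rfl⟩; exact W.finrank_le⟩
  obtain ⟨W, hW, h⟩ := Nat.sSup_mem
    (s := {k | ∃ W : Submodule F V, (∀ x ∈ W, q x = 0) ∧ finrank F W = k})
    ⟨0, ⊥, by simp, by simp⟩ hb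
  refine ⟨W, hW, h, fun U hU => ?_⟩
  rw [h]
  exact le_csSup hb ⟨U, hU, rfl⟩

theorem linearIndependent_of_isBaseChange {L : Type u} [Field L] [Algebra F L] {V' : Type u}
    [AddCommGroup V'] [Module F V'] [Module L V'] [IsScalarTower F L V'] {i : V →ₗ[F] V'}
    (hi : IsBaseChange L i) {κ : Type*} {f : κ → V} (hf : LinearIndependent F f) :
    LinearIndependent L fun k => i (f k) := by
  have hr := hf.linearIndepOn_id
  let g : κ → hr.extend (Set.subset_univ _) := fun k => ⟨f k, hr.subset_extend _ ⟨k, rfl⟩⟩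
  have hg : Function.Injective g := fun x y hxy => hf.injective (congrArg Subtype.val hxy)
  have h := (IsBaseChange.basis (Basis.extend hr) hi).linearIndependent.comp g hg
  have he : (fun k => i (f k)) = IsBaseChange.basis (Basis.extend hr) hi ∘ g := by
    funext k
    rw [Function.comp_apply, IsBaseChange.basis_apply, Basis.extend_apply_self]
  rw [he]
  exact h

theorem finrank_span_map_of_isBaseChange [FiniteDimensional F V] {L : Type u} [Field L]
    [Algebra F L] {V' : Type u} [AddCommGroup V'] [Module F V'] [Module L V']
    [IsScalarTower F L V'] {i : V →ₗ[F] V'} (hi : IsBaseChange L i) (S : Submodule F V) :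
    finrank L (Submodule.span L (i '' S)) = finrank F S := by
  let b := finBasis F S
  have h := linearIndependent_of_isBaseChange hi
    (b.linearIndependent.map' S.subtype (Submodule.ker_subtype S))
  have h2 : Submodule.span L (i '' S) =
      Submodule.span L (Set.range fun k => i ((S.subtype ∘ b) k)) := by
    apply le_antisymm
    · rw [Submodule.span_le]
      rintro _ ⟨x, hx, rfl⟩
      have := congrArg (fun y => i (S.subtype y)) (b.sum_repr ⟨x, hx⟩)
      simp only [map_sum, map_smul, Submodule.subtype_apply] at this
      rw [← this]
      refine Submodule.sum_mem _ fun k _ => ?_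
      rw [← algebraMap_smul L]
      exact Submodule.smul_mem _ _ (Submodule.subset_span ⟨k, rfl⟩)
    · rw [Submodule.span_le]
      rintro _ ⟨k, rfl⟩
      exact Submodule.subset_span ⟨_, (b k).2, rfl⟩
  rw [h2, finrank_span_eq_card h, Fintype.card_fin]

theorem map_sum_of_polar_eq_zero {q : QuadraticForm F V} {κ : Type*} [Fintype κ] {v : κ → V}
    (hv : ∀ j l, j ≠ l → polar q (v j) (v l) = 0) (c : κ → F) :
    q (∑ j, c j • v j) = ∑ j, q (v j) * c j ^ 2 := by
  classical
  have h : ∀ s : Finset κ, q (∑ j ∈ s, c j • v j) = ∑ j ∈ s, q (v j) * c j ^ 2 := by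
    intro s
    induction s using Finset.induction_on with
    | empty => simp
    | insert a s ha ih =>
      rw [Finset.sum_insert ha, Finset.sum_insert ha, QuadraticMap.map_add q, ih,
        QuadraticMap.map_smul]
      have : polar q (c a • v a) (∑ j ∈ s, c j • v j) = 0 := by
        rw [← polarBilin_apply_apply, map_sum]
        refine Finset.sum_eq_zero fun j hj => ?_
        rw [polarBilin_apply_apply, polar_smul_left, polar_smul_right,
          hv a j (fun h => ha (h ▸ hj)), smul_zero, smul_zero]
      rw [this, add_zero, smul_eq_mul]
      ring
  exact h Finset.univ

theorem exists_basis_polar_eq_zero [FiniteDimensional F V] (h2 : (2 : F) ≠ 0)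
    (q : QuadraticForm F V) :
    ∃ (k : ℕ) (v : Basis (Fin k) F V), ∀ j l, j ≠ l → polar q (v j) (v l) = 0 := by
  have : Invertible (2 : F) := invertibleOfNonzero h2
  obtain ⟨v, hv⟩ := LinearMap.BilinForm.exists_orthogonal_basis
    (B := polarBilin q) ⟨fun x y => by simp [polar_comm]⟩
  exact ⟨_, v, fun j l hjl => hv hjl⟩

/-- Springer's theorem for Witt indices: they do not change under extensions of odd degree. -/
theorem quadWittIndex_eq_of_isBaseChange [FiniteDimensional F V] (h2 : (2 : F) ≠ 0)
    {L : Type u} [Field L] [Algebra F L] [FiniteDimensional F L] (hodd : Odd (finrank F L))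
    {V' : Type u} [AddCommGroup V'] [Module F V'] [Module L V'] [IsScalarTower F L V']
    [FiniteDimensional L V'] {i : V →ₗ[F] V'} (hi : IsBaseChange L i) {q : QuadraticForm F V}
    {q' : QuadraticForm L V'} (hq : (polarBilin q).Nondegenerate)
    (hq' : (polarBilin q').Nondegenerate)
    (hqi : ∀ v, q' (i v) = algebraMap F L (q v)) : quadWittIndex q' = quadWittIndex q := by
  obtain ⟨W, hW, hWq, hmax⟩ := exists_finrank_eq_quadWittIndex q
  set P := LinearMap.BilinForm.orthogonal (polarBilin q) W with hP
  have hWP : ∀ w ∈ W, ∀ p ∈ P, polar q w p = 0 := fun w hw p hp =>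
    (LinearMap.BilinForm.mem_orthogonal_iff.1 hp) w hw
  have hPdim : finrank F P = finrank F V - finrank F W :=
    LinearMap.BilinForm.finrank_orthogonal hq W
  have hWle : W ≤ P := fun x hx =>
    LinearMap.BilinForm.mem_orthogonal_iff.2 fun y hy => polar_eq_zero_of_isotropic hW y hy x hx
  -- isotropic vectors of `P` lie in `W`, by maximality
  have hPW : ∀ x ∈ P, q x = 0 → x ∈ W := by
    intro x hx hqx
    have h3 : finrank F ↥(W ⊔ F ∙ x) ≤ finrank F W := by
      refine hmax _ fun y hy => ?_
      obtain ⟨w, hw, z, hz, rfl⟩ := Submodule.mem_sup.1 hy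
      obtain ⟨c, rfl⟩ := Submodule.mem_span_singleton.1 hz
      have := hWP w hw (c • x) (P.smul_mem c hx)
      rw [polar, hW w hw, QuadraticMap.map_smul, hqx] at this
      simpa using this
    have h4 := Submodule.eq_of_le_of_finrank_le (le_sup_left : W ≤ W ⊔ F ∙ x) h3
    rw [h4]
    exact (le_sup_right : F ∙ x ≤ W ⊔ F ∙ x) (Submodule.mem_span_singleton_self x)
  obtain ⟨V₀, hV₀⟩ := Submodule.exists_isCompl W
  -- an orthogonal basis of the anisotropic complement `P ⊓ V₀`
  obtain ⟨k, v, hv⟩ := exists_basis_polar_eq_zero h2 (q.restrict (P ⊓ V₀))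
  have hv' : ∀ j l, j ≠ l → polar q (v j) (v l) = 0 := hv
  have haniso : IsAnisotropicDiagonal (fun j => q (v j)) F := by
    intro x hx
    have h3 : q (∑ j, x j • (v j : V)) = 0 := by
      rw [map_sum_of_polar_eq_zero hv', ← hx]
      rfl
    have h4 : (∑ j, x j • v j : ↥(P ⊓ V₀)) = 0 := by
      have h5 : ((∑ j, x j • v j : ↥(P ⊓ V₀)) : V) = ∑ j, x j • (v j : V) := by
        simp
      have h6 := (∑ j, x j • v j : ↥(P ⊓ V₀)).2
      exact Subtype.ext ((Submodule.disjoint_def.1 hV₀.disjoint) _ (hPW _ h6.1 (h5 ▸ h3)) h6.2)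
    funext j
    exact Fintype.linearIndependent_iff.1 v.linearIndependent x h4 j
  have hanisoL : IsAnisotropicDiagonal (fun j => q (v j)) L := haniso.of_odd_finrank _ rfl hodd
  have hpol : ∀ x y, polar q' (i x) (i y) = algebraMap F L (polar q x y) := fun x y => by
    simp only [polar, ← map_add, hqi, ← map_sub]
  have hspan : ∀ (S T : Submodule F V), (∀ s ∈ S, ∀ t ∈ T, polar q s t = 0) →
      ∀ s ∈ Submodule.span L (i '' S), ∀ t ∈ Submodule.span L (i '' T), polar q' s t = 0 := by
    intro S T hST s hs t ht
    induction hs using Submodule.span_induction with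
    | mem s hs =>
      obtain ⟨s, hs, rfl⟩ := hs
      induction ht using Submodule.span_induction with
      | mem t ht =>
        obtain ⟨t, ht, rfl⟩ := ht
        rw [hpol, hST s hs t ht, map_zero]
      | zero => simp
      | add x y _ _ hx hy => rw [polar_add_right, hx, hy, add_zero]
      | smul c x _ hx => rw [polar_smul_right, hx, smul_zero]
    | zero => simp
    | add x y _ _ hx hy => rw [polar_add_left, hx, hy, add_zero]
    | smul c x _ hx => rw [polar_smul_left, hx, smul_zero]
  have h2L : (2 : L) ≠ 0 := by
    rw [← map_ofNat (algebraMap F L) 2]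
    exact (map_ne_zero _).2 h2
  have hself : ∀ x, polar q' x x = 0 → q' x = 0 := fun x hx => by
    rw [polar_self] at hx
    simpa [h2L] using hx
  have hW' : ∀ x ∈ Submodule.span L (i '' W), q' x = 0 := fun x hx =>
    hself x (hspan W W (polar_eq_zero_of_isotropic hW) x hx x hx)
  rw [← hWq, ← finrank_span_map_of_isBaseChange hi W]
  refine quadWittIndex_eq hq' (P := Submodule.span L (i '' P)) hW' (hspan W P hWP) ?_ ?_
  · rw [finrank_span_map_of_isBaseChange hi, finrank_span_map_of_isBaseChange hi, hPdim]
    have : finrank L V' = finrank F V := by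
      rw [← hi.equiv.finrank_eq, finrank_baseChange]
    have := W.finrank_le
    omega
  · have hPsup : P ≤ W ⊔ (P ⊓ V₀) := by
      intro x hx
      obtain ⟨a, ha, b, hb, rfl⟩ :=
        Submodule.mem_sup.1 (hV₀.codisjoint.eq_top ▸ Submodule.mem_top (x := x))
      refine Submodule.add_mem_sup ha ⟨?_, hb⟩
      simpa using P.sub_mem hx (hWle ha)
    intro x hx hqx
    have hx' : x ∈ Submodule.span L (i '' W) ⊔ Submodule.span L (Set.range fun j => i (v j)) := by
      refine Submodule.span_le.2 ?_ hx
      rintro _ ⟨y, hy, rfl⟩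
      obtain ⟨a, ha, b, hb, rfl⟩ := Submodule.mem_sup.1 (hPsup hy)
      rw [map_add]
      refine Submodule.add_mem_sup (Submodule.subset_span ⟨a, ha, rfl⟩) ?_
      have := congrArg (fun y : ↥(P ⊓ V₀) => i (y : V)) (v.sum_repr ⟨b, hb⟩)
      simp only [Submodule.coe_sum, Submodule.coe_smul, map_sum, map_smul] at this
      rw [← this]
      refine Submodule.sum_mem _ fun j _ => ?_
      rw [← algebraMap_smul L]
      exact Submodule.smul_mem _ _ (Submodule.subset_span ⟨j, rfl⟩)
    obtain ⟨y, hy, z, hz, rfl⟩ := Submodule.mem_sup.1 hx'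
    obtain ⟨c, rfl⟩ := (Submodule.mem_span_range_iff_exists_fun L).1 hz
    have hzP : ∑ j, c j • i (v j) ∈ Submodule.span L (i '' P) :=
      Submodule.sum_mem _ fun j _ =>
        Submodule.smul_mem _ _ (Submodule.subset_span ⟨v j, (v j).2.1, rfl⟩)
    have h6 := hspan W P hWP y hy _ hzP
    rw [polar, hqx, hW' y hy, sub_zero, zero_sub, neg_eq_zero,
      map_sum_of_polar_eq_zero (fun j l hjl => by rw [hpol, hv' j l hjl, map_zero])] at h6
    have h7 : c = 0 := hanisoL c (by simpa only [hqi] using h6)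
    simpa [h7] using hy

end WittIndex

/-! ### Algebras with a standard involution -/

section StandardInvolution

open Module

/-- `star` is a standard involution of the finite-dimensional `F`-algebra `D`: the elements
`x + star x` are scalars, and the trace form `(x, y) ↦ x y + star (x y)` is nondegenerate.
Quadratic étale algebras and quaternion algebras are of this kind, and the notion is stable under
extension of scalars. -/
structure IsStandardInvolution (F D : Type u) [Field F] [Ring D] [StarRing D] [Algebra F D] :
    Prop where
  star_algebraMap : ∀ c : F, star (algebraMap F D c) = algebraMap F D c
  exists_add_star : ∀ x : D, ∃ c : F, x + star x = algebraMap F D c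
  nondegenerate : ∀ x : D, (∀ y, x * y + star (x * y) = 0) → x = 0
  finite : FiniteDimensional F D
  nontrivial : Nontrivial D

variable {F D : Type u} [Field F] [Ring D] [StarRing D] [Algebra F D]

namespace IsStandardInvolution

theorem algebraMap_injective (hD : IsStandardInvolution F D) :
    Function.Injective (algebraMap F D) :=
  have := hD.nontrivial
  (algebraMap F D).injective

theorem star_smul (hD : IsStandardInvolution F D) (c : F) (x : D) : star (c • x) = c • star x := by
  rw [Algebra.smul_def, star_mul, hD.star_algebraMap, Algebra.smul_def, Algebra.commutes]

theorem exists_of_star_eq (hD : IsStandardInvolution F D) (h2 : (2 : F) ≠ 0) {x : D}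
    (hx : star x = x) : ∃ c : F, x = algebraMap F D c := by
  obtain ⟨c, hc⟩ := hD.exists_add_star x
  refine ⟨2⁻¹ * c, ?_⟩
  rw [map_mul, ← hc, hx, ← Algebra.smul_def, ← two_smul F x, smul_smul, inv_mul_cancel₀ h2,
    one_smul]

theorem exists_star_mul_self (hD : IsStandardInvolution F D) (h2 : (2 : F) ≠ 0) (x : D) :
    ∃ c : F, star x * x = algebraMap F D c :=
  hD.exists_of_star_eq h2 (by rw [star_mul, star_star])

theorem mul_star_self (hD : IsStandardInvolution F D) (x : D) : x * star x = star x * x := by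
  obtain ⟨c, hc⟩ := hD.exists_add_star x
  have h : star x = algebraMap F D c - x := by rw [← hc]; abel
  rw [h, mul_sub, sub_mul, Algebra.commutes]

theorem isUnit_of_star_mul_self (hD : IsStandardInvolution F D) {x : D} {c : F} (hc : c ≠ 0)
    (hx : star x * x = algebraMap F D c) :
    IsUnit x := by
  refine ⟨⟨x, c⁻¹ • star x, ?_, ?_⟩, rfl⟩
  · rw [mul_smul_comm, hD.mul_star_self, hx, Algebra.smul_def, ← map_mul, inv_mul_cancel₀ hc,
      map_one]
  · rw [smul_mul_assoc, hx, Algebra.smul_def, ← map_mul, inv_mul_cancel₀ hc, map_one]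

end IsStandardInvolution

/-- The reduced trace `x ↦ x + star x` of an algebra with standard involution, as a linear map with
values in `F`. -/
def IsStandardInvolution.trace (hD : IsStandardInvolution F D) : D →ₗ[F] F where
  toFun x := (hD.exists_add_star x).choose
  map_add' x y := by
    apply hD.algebraMap_injective
    rw [map_add, ← (hD.exists_add_star x).choose_spec, ← (hD.exists_add_star y).choose_spec,
      ← (hD.exists_add_star (x + y)).choose_spec, star_add]
    abel
  map_smul' c x := by
    apply hD.algebraMap_injective
    rw [← (hD.exists_add_star (c • x)).choose_spec, RingHom.id_apply, smul_eq_mul, map_mul,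
      ← (hD.exists_add_star x).choose_spec, ← Algebra.smul_def, hD.star_smul, smul_add]

namespace IsStandardInvolution

variable (hD : IsStandardInvolution F D)

theorem algebraMap_trace (x : D) : algebraMap F D (hD.trace x) = x + star x :=
  (hD.exists_add_star x).choose_spec.symm

theorem trace_eq_iff {x : D} {c : F} : hD.trace x = c ↔ x + star x = algebraMap F D c := by
  rw [← hD.algebraMap_trace, hD.algebraMap_injective.eq_iff]

theorem trace_star (x : D) : hD.trace (star x) = hD.trace x := by
  apply hD.algebraMap_injective
  rw [algebraMap_trace, algebraMap_trace, star_star, add_comm]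

theorem star_eq (x : D) : star x = algebraMap F D (hD.trace x) - x := by
  rw [algebraMap_trace]; abel

/-- `star (x * y) = star y * star x` has the same trace as `x * y`; expand with
`star x = trace x - x`. -/
theorem trace_mul_comm (x y : D) : hD.trace (x * y) = hD.trace (y * x) := by
  have h : hD.trace (x * y) = hD.trace (star y * star x) := by
    rw [← star_mul, trace_star]
  rw [hD.star_eq x, hD.star_eq y] at h
  simp only [mul_sub, sub_mul, map_sub, ← map_mul (algebraMap F D),
    ← Algebra.commutes _ y, ← Algebra.smul_def, map_smul, smul_eq_mul] at h
  have h1 : hD.trace (algebraMap F D (hD.trace y * hD.trace x)) =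
      hD.trace y * hD.trace x + hD.trace y * hD.trace x := by
    rw [hD.trace_eq_iff, hD.star_algebraMap, map_add]
  rw [h1] at h
  linear_combination h

theorem trace_algebraMap (c : F) : hD.trace (algebraMap F D c) = 2 * c := by
  rw [hD.trace_eq_iff, hD.star_algebraMap, ← map_add, two_mul]

theorem eq_zero_of_trace {x : D} (h : ∀ y, hD.trace (x * y) = 0) : x = 0 :=
  hD.nondegenerate x fun y => by rw [← hD.algebraMap_trace, h, map_zero]

/-- The decomposition `D = F ⊕ D₀`, where `D₀` consists of the elements of trace zero. -/
theorem exists_trace_zero (hD : IsStandardInvolution F D) (h2 : (2 : F) ≠ 0) (x : D) :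
    ∃ (c : F) (y : D), x = algebraMap F D c + y ∧ star y = -y := by
  refine ⟨2⁻¹ * hD.trace x, x - algebraMap F D (2⁻¹ * hD.trace x), by abel, ?_⟩
  rw [star_sub, hD.star_algebraMap, hD.star_eq x, neg_sub, sub_eq_sub_iff_add_eq_add,
    sub_add_cancel, ← map_add, ← two_mul, mul_inv_cancel_left₀ h2]

/-- The subspace of elements of trace zero. -/
def traceZero : Submodule F D := LinearMap.ker hD.trace

theorem mem_traceZero {x : D} : x ∈ hD.traceZero ↔ star x = -x := by
  rw [traceZero, LinearMap.mem_ker, hD.trace_eq_iff, map_zero, add_comm, add_eq_zero_iff_eq_neg]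

theorem finrank_traceZero (h2 : (2 : F) ≠ 0) : finrank F hD.traceZero + 1 = finrank F D := by
  have := hD.finite
  have h := LinearMap.finrank_range_add_finrank_ker hD.trace
  have h1 : LinearMap.range hD.trace = ⊤ := by
    rw [LinearMap.range_eq_top]
    intro c
    exact ⟨algebraMap F D (2⁻¹ * c), by rw [trace_algebraMap, mul_inv_cancel_left₀ h2]⟩
  rw [h1, finrank_top, finrank_self] at h
  rw [traceZero, ← h, add_comm]

theorem mul_comm_of_finrank_eq_two (hD : IsStandardInvolution F D) (h2 : (2 : F) ≠ 0)
    (h : finrank F D = 2) (x y : D) : x * y = y * x := by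
  have h1 := hD.finrank_traceZero h2
  obtain ⟨v, hv, hv'⟩ := finrank_eq_one_iff'.1 (show finrank F hD.traceZero = 1 by omega)
  obtain ⟨a, x', rfl, hx⟩ := hD.exists_trace_zero h2 x
  obtain ⟨b, y', rfl, hy⟩ := hD.exists_trace_zero h2 y
  obtain ⟨s, hs⟩ := hv' ⟨x', hD.mem_traceZero.2 hx⟩
  obtain ⟨t, ht⟩ := hv' ⟨y', hD.mem_traceZero.2 hy⟩
  have hs' : s • (v : D) = x' := congrArg Subtype.val hs
  have ht' : t • (v : D) = y' := congrArg Subtype.val ht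
  rw [← hs', ← ht']
  simp only [mul_add, add_mul, Algebra.commutes, smul_mul_smul_comm, mul_comm t s, ← map_mul,
    mul_comm b a]
  simp only [← Algebra.commutes _ (v : D), smul_mul_assoc]
  abel

/-- A central element `z` of trace zero maps elements of trace zero to scalars; if it is not zero,
it is invertible and this map is injective. -/
theorem center_eq_bot (hD : IsStandardInvolution F D) (h2 : (2 : F) ≠ 0)
    (h : 2 < finrank F D) : Subalgebra.center F D = ⊥ := by
  have := hD.finite
  rw [eq_bot_iff]
  intro x hx
  obtain ⟨c, z, rfl, hz⟩ := hD.exists_trace_zero h2 x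
  have hzc : ∀ y, y * z = z * y := fun y => by
    have := (Subalgebra.mem_center_iff.1 hx) y
    rw [mul_add, add_mul, Algebra.commutes c y] at this
    simpa using this
  have key : ∀ y ∈ hD.traceZero, ∃ s : F, z * y = algebraMap F D s := fun y hy => by
    apply hD.exists_of_star_eq h2
    rw [star_mul, hz, hD.mem_traceZero.1 hy, neg_mul_neg, hzc]
  have hz0 : z = 0 := by
    by_contra hne
    have h3 : ∀ y ∈ hD.traceZero, z * y = 0 := by
      by_contra hcon
      push Not at hcon
      obtain ⟨y, hy, hzy⟩ := hcon
      obtain ⟨s, hs⟩ := key y hy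
      have hs0 : s ≠ 0 := by rintro rfl; exact hzy (by rw [hs, map_zero])
      -- left multiplication by `z` is injective, as `y * z = s`
      have hinj : ∀ w, z * w = 0 → w = 0 := fun w hw => by
        have : algebraMap F D s * w = 0 := by rw [← hs, ← hzc, mul_assoc, hw, mul_zero]
        rw [← Algebra.smul_def] at this
        exact (smul_eq_zero.1 this).resolve_left hs0
      let f : hD.traceZero →ₗ[F] D := (LinearMap.mulLeft F z).comp hD.traceZero.subtype
      have hf : Function.Injective f := by
        rw [← LinearMap.ker_eq_bot, LinearMap.ker_eq_bot']
        intro w hw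
        exact Subtype.ext (hinj w hw)
      have hr : LinearMap.range f ≤ LinearMap.range (Algebra.linearMap F D) := by
        rintro _ ⟨w, rfl⟩
        obtain ⟨t, ht⟩ := key w w.2
        exact ⟨t, ht.symm⟩
      have h4 := Submodule.finrank_mono hr
      rw [LinearMap.finrank_range_of_inj hf] at h4
      have h5 := LinearMap.finrank_range_le (Algebra.linearMap F D)
      rw [finrank_self] at h5
      have := hD.finrank_traceZero h2
      omega
    refine hne (hD.eq_zero_of_trace fun y => ?_)
    obtain ⟨t, y', rfl, hy'⟩ := hD.exists_trace_zero h2 y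
    have hz' : hD.trace z = 0 := hD.trace_eq_iff.2 (by rw [hz, map_zero, add_neg_cancel])
    rw [mul_add, h3 y' (hD.mem_traceZero.2 hy'), add_zero, ← Algebra.commutes, ← Algebra.smul_def,
      map_smul, hz', smul_zero]
  rw [hz0, add_zero]
  exact Subalgebra.algebraMap_mem _ c

end IsStandardInvolution

end StandardInvolution

/-! ### Hermitian forms over algebras with a standard involution -/

section Hermitian

open Module QuadraticMap

namespace HermitianForm

variable {D : Type u} [Ring D] [StarRing D] {n : ℕ} (h : HermitianForm D n)

theorem add_left (x y z : Fin n → D) : h.toFun (x + y) z = h.toFun x z + h.toFun y z := by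
  rw [← h.star_apply, h.add_right, star_add, h.star_apply, h.star_apply]

theorem mul_left (x y : Fin n → D) (d : D) :
    h.toFun (fun i => x i * d) y = star d * h.toFun x y := by
  rw [← h.star_apply, h.mul_right, star_mul, h.star_apply]

theorem zero_right (x : Fin n → D) : h.toFun x 0 = 0 := by
  have := h.mul_right x 0 0
  rw [mul_zero] at this
  rw [← this]
  congr 1
  funext i
  simp

theorem zero_left (x : Fin n → D) : h.toFun 0 x = 0 := by
  rw [← h.star_apply, h.zero_right, star_zero]

theorem sum_right {κ : Type*} (s : Finset κ) (x : Fin n → D) (y : κ → Fin n → D) :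
    h.toFun x (∑ k ∈ s, y k) = ∑ k ∈ s, h.toFun x (y k) := by
  classical
  induction s using Finset.induction_on with
  | empty => simp [h.zero_right]
  | insert a s ha ih => rw [Finset.sum_insert ha, Finset.sum_insert ha, h.add_right, ih]

theorem sum_left {κ : Type*} (s : Finset κ) (x : κ → Fin n → D) (y : Fin n → D) :
    h.toFun (∑ k ∈ s, x k) y = ∑ k ∈ s, h.toFun (x k) y := by
  rw [← h.star_apply, h.sum_right, star_sum]
  exact Finset.sum_congr rfl fun k _ => h.star_apply _ _

variable {F : Type u} [Field F] [Algebra F D]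

theorem smul_right (c : F) (x y : Fin n → D) : h.toFun x (c • y) = c • h.toFun x y := by
  have := h.mul_right x y (algebraMap F D c)
  rw [← Algebra.commutes, ← Algebra.smul_def] at this
  rw [← this]
  congr 1
  funext i
  rw [Pi.smul_apply, Algebra.smul_def, Algebra.commutes]

theorem smul_left (hD : IsStandardInvolution F D) (c : F) (x y : Fin n → D) :
    h.toFun (c • x) y = c • h.toFun x y := by
  rw [← h.star_apply, h.smul_right, hD.star_smul, h.star_apply]

/-- The symmetric bilinear form `(x, y) ↦ trace (h (x, y))`. -/
def traceBilin (hD : IsStandardInvolution F D) : LinearMap.BilinForm F (Fin n → D) :=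
  LinearMap.mk₂ F (fun x y => hD.trace (h.toFun x y))
    (fun x y z => by rw [h.add_left, map_add])
    (fun c x y => by rw [h.smul_left hD, map_smul])
    (fun x y z => by rw [h.add_right, map_add])
    (fun c x y => by rw [h.smul_right, map_smul])

/-- The trace form `x ↦ h (x, x)`, defined as `x ↦ trace (h (x, x)) / 2` to get values in `F`. -/
def traceForm (hD : IsStandardInvolution F D) : QuadraticForm F (Fin n → D) :=
  (2⁻¹ : F) • LinearMap.BilinMap.toQuadraticMap (h.traceBilin hD)

theorem isTraceForm_traceForm (hD : IsStandardInvolution F D) (h2 : (2 : F) ≠ 0) :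
    IsTraceForm F h (h.traceForm hD) := by
  intro x
  have : h.traceForm hD x = 2⁻¹ * hD.trace (h.toFun x x) := rfl
  rw [this, map_mul, hD.algebraMap_trace, h.star_apply, ← Algebra.smul_def, ← two_smul F,
    smul_smul, inv_mul_cancel₀ h2, one_smul]

end HermitianForm

variable {F D : Type u} [Field F] [Ring D] [StarRing D] [Algebra F D] {n : ℕ}
  {h : HermitianForm D n} {q : QuadraticForm F (Fin n → D)}

theorem IsTraceForm.unique (hD : IsStandardInvolution F D) {q' : QuadraticForm F (Fin n → D)}
    (hq : IsTraceForm F h q) (hq' : IsTraceForm F h q') : q = q' := by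
  ext x
  exact hD.algebraMap_injective ((hq x).trans (hq' x).symm)

theorem IsTraceForm.polar_eq (hD : IsStandardInvolution F D) (hq : IsTraceForm F h q)
    (x y : Fin n → D) : polar q x y = hD.trace (h.toFun x y) := by
  rw [eq_comm, hD.trace_eq_iff, polar, map_sub, map_sub, hq, hq, hq, h.add_left, h.add_right,
    h.add_right, h.star_apply]
  abel

/-- Orthogonality to a right `D`-submodule with respect to the trace form is orthogonality with
respect to the hermitian form. -/
theorem IsTraceForm.polar_eq_zero_iff (hD : IsStandardInvolution F D) (hq : IsTraceForm F h q)
    {x y : Fin n → D} :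
    (∀ d : D, polar q x (fun i => y i * d) = 0) ↔ h.toFun x y = 0 := by
  constructor
  · intro H
    refine hD.eq_zero_of_trace fun d => ?_
    rw [← h.mul_right, ← hq.polar_eq hD, H]
  · intro H d
    rw [hq.polar_eq hD, h.mul_right, H, zero_mul, map_zero]

theorem IsTraceForm.nondegenerate (hD : IsStandardInvolution F D) (hq : IsTraceForm F h q)
    (hh : ∀ x, (∀ y, h.toFun x y = 0) → x = 0) : (polarBilin q).Nondegenerate := by
  have := hD.finite
  have hr : (polarBilin q).IsRefl := fun x y hxy => by
    rw [polarBilin_apply_apply, polar_comm]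
    exact hxy
  rw [LinearMap.IsRefl.nondegenerate_iff_separatingLeft hr,
    LinearMap.separatingLeft_iff_ker_eq_bot, LinearMap.ker_eq_bot']
  intro x hx
  refine hh x fun y => (hq.polar_eq_zero_iff hD).1 fun d => ?_
  exact LinearMap.congr_fun hx _

end Hermitian

/-! ### Isotropic right ideals and isotropic submodules -/

section RightIdeals

open Module QuadraticMap

variable {F D : Type u} [Field F] [Ring D] [Algebra F D] {n : ℕ}

/-- The matrices whose columns lie in `W`. -/
def columnIdeal (W : Submodule F (Fin n → D)) : Submodule F (Matrix (Fin n) (Fin n) D) where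
  carrier := {x | ∀ j, (fun i => x i j) ∈ W}
  add_mem' hx hy j := W.add_mem (hx j) (hy j)
  zero_mem' _ := W.zero_mem
  smul_mem' c _ hx j := W.smul_mem c (hx j)

theorem mem_columnIdeal {W : Submodule F (Fin n → D)} {x : Matrix (Fin n) (Fin n) D} :
    x ∈ columnIdeal W ↔ ∀ j, (fun i => x i j) ∈ W := Iff.rfl

theorem finrank_columnIdeal (W : Submodule F (Fin n → D)) [FiniteDimensional F D] :
    finrank F (columnIdeal W) = n * finrank F W := by
  let e : columnIdeal W ≃ₗ[F] (Fin n → W) :=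
    { toFun := fun x j => ⟨fun i => x.1 i j, x.2 j⟩
      map_add' := fun _ _ => rfl
      map_smul' := fun _ _ => rfl
      invFun := fun y => ⟨Matrix.of fun i j => (y j).1 i, fun j => (y j).2⟩
      left_inv := fun _ => rfl
      right_inv := fun _ => rfl }
  rw [e.finrank_eq, finrank_pi_fintype]
  simp

theorem matrix_eq_zero_of_mulVec {x : Matrix (Fin n) (Fin n) D} (h : ∀ v, x *ᵥ v = 0) : x = 0 := by
  ext i j
  have := congrFun (h (Pi.single j 1)) i
  simpa using this

theorem finrank_center_matrix (hn : 0 < n) :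
    finrank F (Subalgebra.center F (Matrix (Fin n) (Fin n) D)) =
      finrank F (Subalgebra.center F D) := by
  have : Nonempty (Fin n) := ⟨⟨0, hn⟩⟩
  rw [Matrix.subalgebraCenter_eq_scalarAlgHom_map]
  exact (((Subalgebra.center F D).equivMapOfInjective (Matrix.scalarAlgHom (Fin n) F)
    (fun _ _ => Matrix.scalar_inj.1)).toLinearEquiv.finrank_eq).symm

variable [StarRing D]

/-- `W` is a right `D`-submodule of `Dⁿ` on which the hermitian form `h` vanishes. -/
def IsTotallyIsotropic (h : HermitianForm D n) (W : Submodule F (Fin n → D)) : Prop :=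
  (∀ w ∈ W, ∀ d : D, (fun i => w i * d) ∈ W) ∧ ∀ v ∈ W, ∀ w ∈ W, h.toFun v w = 0

theorem mulVec_mem_of_mem_columnIdeal {h : HermitianForm D n} {W : Submodule F (Fin n → D)}
    (hW : IsTotallyIsotropic h W) {x : Matrix (Fin n) (Fin n) D} (hx : x ∈ columnIdeal W)
    (v : Fin n → D) : x *ᵥ v ∈ W := by
  have : x *ᵥ v = ∑ j, fun i => x i j * v j := by
    funext i
    simp [Matrix.mulVec, dotProduct]
  rw [this]
  exact Submodule.sum_mem _ fun j _ => hW.1 _ (hx j) (v j)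

variable {σ : Matrix (Fin n) (Fin n) D →ₗ[F] Matrix (Fin n) (Fin n) D} {h : HermitianForm D n}

theorem IsTotallyIsotropic.columnIdeal (hσ : IsUnderlyingForm F σ h)
    {W : Submodule F (Fin n → D)} (hW : IsTotallyIsotropic h W) :
    IsTotallyIsotropicRightIdeal F σ (columnIdeal W) := by
  refine ⟨fun x hx a j => ?_, fun x hx y hy => ?_⟩
  · exact mulVec_mem_of_mem_columnIdeal hW hx fun k => a k j
  · refine matrix_eq_zero_of_mulVec fun v => hσ.1 _ fun w => ?_
    rw [← Matrix.mulVec_mulVec, ← hσ.2]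
    exact hW.2 _ (mulVec_mem_of_mem_columnIdeal hW hy v) _ (mulVec_mem_of_mem_columnIdeal hW hx w)

/-- Every right ideal of `Mₙ(D)` is determined by the `D`-submodule of `Dⁿ` of its first columns,
which is totally isotropic if the ideal is. -/
theorem IsTotallyIsotropicRightIdeal.exists_columnIdeal (hn : 0 < n) (hσ : IsUnderlyingForm F σ h)
    {I : Submodule F (Matrix (Fin n) (Fin n) D)} (hI : IsTotallyIsotropicRightIdeal F σ I) :
    ∃ W : Submodule F (Fin n → D), IsTotallyIsotropic h W ∧ I = LowIndex.columnIdeal W := by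
  let i₀ : Fin n := ⟨0, hn⟩
  let f : Matrix (Fin n) (Fin n) D →ₗ[F] (Fin n → D) :=
    { toFun := fun x i => x i i₀
      map_add' := fun _ _ => rfl
      map_smul' := fun _ _ => rfl }
  have hfa : ∀ x i, f x i = x i i₀ := fun _ _ => rfl
  refine ⟨I.map f, ⟨?_, ?_⟩, ?_⟩
  · rintro _ ⟨x, hx, rfl⟩ d
    refine ⟨x * Matrix.scalar (Fin n) d, hI.1 x hx _, ?_⟩
    funext i
    simp [hfa]
  · rintro _ ⟨x, hx, rfl⟩ _ ⟨y, hy, rfl⟩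
    have hf : ∀ z, f z = z *ᵥ Pi.single i₀ 1 := fun z => by
      funext i
      simp [hfa]
    rw [hf x, hf y, hσ.2, Matrix.mulVec_mulVec, hI.2 y hy x hx, Matrix.zero_mulVec, h.zero_left]
  · ext x
    rw [mem_columnIdeal]
    constructor
    · intro hx j
      refine ⟨x * Matrix.single j i₀ 1, hI.1 x hx _, ?_⟩
      funext i
      simp [hfa]
    · intro hx
      choose y hy hyx using hx
      have : x = ∑ j, y j * Matrix.single i₀ j 1 := by
        ext i k
        rw [Matrix.sum_apply, Finset.sum_eq_single k]
        · have := congrFun (hyx k) i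
          rw [hfa] at this
          simp [this]
        · intro b _ hb
          simp [hb.symm]
        · simp
      rw [this]
      exact Submodule.sum_mem _ fun j _ => hI.1 _ (hy j) _

/-! ### The Witt index of the trace form -/

/-- A maximal totally isotropic `D`-submodule `W` is a maximal totally isotropic `F`-subspace for
the trace form: an isotropic vector `x` orthogonal to `W` spans a totally isotropic `D`-submodule
together with `W`. -/
theorem exists_isTotallyIsotropic_finrank_eq (hD : IsStandardInvolution F D)
    {q : QuadraticForm F (Fin n → D)} (hq : IsTraceForm F h q)
    (hh : ∀ x, (∀ y, h.toFun x y = 0) → x = 0) :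
    ∃ W : Submodule F (Fin n → D), IsTotallyIsotropic h W ∧ quadWittIndex q = finrank F W := by
  have := hD.finite
  set S := {k | ∃ W : Submodule F (Fin n → D), IsTotallyIsotropic h W ∧ finrank F W = k} with hS
  have hb : BddAbove S := ⟨finrank F (Fin n → D), by rintro k ⟨W, -, rfl⟩; exact W.finrank_le⟩
  have h0 : S.Nonempty := by
    refine ⟨0, ⊥, ⟨fun w hw d => ?_, fun v hv w hw => ?_⟩, by simp⟩
    · rw [Submodule.mem_bot] at hw ⊢
      subst hw
      funext i
      simp
    · rw [Submodule.mem_bot] at hv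
      rw [hv, h.zero_left]
  obtain ⟨W, hW, hWS⟩ := Nat.sSup_mem h0 hb
  have hmax : ∀ U : Submodule F (Fin n → D), IsTotallyIsotropic h U →
      finrank F U ≤ finrank F W := fun U hU => hWS ▸ le_csSup hb ⟨U, hU, rfl⟩
  have hnd := hq.nondegenerate hD hh
  refine ⟨W, hW, quadWittIndex_eq hnd (P := LinearMap.BilinForm.orthogonal (polarBilin q) W)
    (fun x hx => ?_) (fun w hw p hp => (LinearMap.BilinForm.mem_orthogonal_iff.1 hp) w hw) ?_ ?_⟩
  · apply hD.algebraMap_injective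
    rw [hq, hW.2 x hx x hx, map_zero]
  · rw [LinearMap.BilinForm.finrank_orthogonal hnd]
    have := W.finrank_le
    omega
  · intro x hx hqx
    have hxx : h.toFun x x = 0 := by rw [← hq, hqx, map_zero]
    have hWx : ∀ w ∈ W, h.toFun w x = 0 := fun w hw => by
      have : h.toFun x w = 0 := (hq.polar_eq_zero_iff hD).1 fun d => by
        rw [polar_comm]
        exact (LinearMap.BilinForm.mem_orthogonal_iff.1 hx) _ (hW.1 w hw d)
      rw [← h.star_apply, this, star_zero]
    let r : D →ₗ[F] (Fin n → D) :=
      { toFun := fun d i => x i * d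
        map_add' := fun d e => by funext i; simp [mul_add]
        map_smul' := fun c d => by funext i; simp }
    have hiso : IsTotallyIsotropic h (W ⊔ LinearMap.range r) := by
      have hr : ∀ d, r d = fun i => x i * d := fun _ => rfl
      constructor
      · intro v hv d
        obtain ⟨w, hw, _, ⟨e, rfl⟩, rfl⟩ := Submodule.mem_sup.1 hv
        have : (fun i => (w + r e) i * d) = (fun i => w i * d) + r (e * d) := by
          funext i
          simp [hr, add_mul, mul_assoc]
        rw [this]
        exact Submodule.add_mem_sup (hW.1 w hw d) ⟨_, rfl⟩
      · intro v hv v' hv'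
        obtain ⟨w, hw, _, ⟨e, rfl⟩, rfl⟩ := Submodule.mem_sup.1 hv
        obtain ⟨w', hw', _, ⟨e', rfl⟩, rfl⟩ := Submodule.mem_sup.1 hv'
        have hxW : ∀ w ∈ W, h.toFun x w = 0 := fun w hw => by
          rw [← h.star_apply, hWx w hw, star_zero]
        rw [h.add_left, h.add_right, h.add_right, hW.2 w hw w' hw', hr, hr, h.mul_left, h.mul_right,
          h.mul_left, h.mul_right, hWx w hw, hxW w' hw', hxx]
        simp
    rw [Submodule.eq_of_le_of_finrank_le le_sup_left (hmax _ hiso)]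
    exact (le_sup_right : LinearMap.range r ≤ _) ⟨1, by funext i; simp [r]⟩

/-- In the unitary and in the symplectic case, the product of the degree of `Mₙ(D)` with the
dimension of its center is `2 n`. Hence the reduced dimension of the right ideal given by a
`D`-submodule `W` of `Dⁿ` is half the dimension of `W` over `F`. -/
theorem finrank_center_mul_degree (hD : IsStandardInvolution F D) (h2 : (2 : F) ≠ 0)
    (hd : finrank F D = 2 ∨ finrank F D = 4) (hn : 0 < n) :
    (finrank F (Subalgebra.center F (Matrix (Fin n) (Fin n) D)) *
      degree F (Matrix (Fin n) (Fin n) D) = 2 * n) ∧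
    (finrank F D = 2 → degree F (Matrix (Fin n) (Fin n) D) = n) := by
  have := hD.finite
  have := hD.nontrivial
  rw [degree, finrank_center_matrix hn, finrank_matrix, Fintype.card_fin]
  rcases hd with hd | hd
  · have hc : Subalgebra.center F D = ⊤ := by
      rw [eq_top_iff]
      intro x _
      exact Subalgebra.mem_center_iff.2 fun y => hD.mul_comm_of_finrank_eq_two h2 hd y x
    rw [hc, subalgebra_top_finrank_eq_submodule_top_finrank, finrank_top, hd,
      Nat.mul_div_cancel _ two_pos, Nat.sqrt_eq]
    exact ⟨rfl, fun _ => rfl⟩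
  · rw [hD.center_eq_bot h2 (by omega), Subalgebra.finrank_bot, hd, Nat.div_one, one_mul,
      show n * n * 4 = (2 * n) * (2 * n) by ring, Nat.sqrt_eq]
    exact ⟨rfl, fun h => by omega⟩

/-- If the center of `Mₙ(D)` is not a field, `D` has dimension two and contains zero divisors. -/
theorem exists_star_mul_self_eq_zero (hD : IsStandardInvolution F D) (h2 : (2 : F) ≠ 0)
    (hd : finrank F D = 2 ∨ finrank F D = 4) (hn : 0 < n)
    (hc : ¬ IsField (Subalgebra.center F (Matrix (Fin n) (Fin n) D))) :
    finrank F D = 2 ∧ ∃ z : D, z ≠ 0 ∧ star z * z = 0 := by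
  have := hD.nontrivial
  have : Nonempty (Fin n) := ⟨⟨0, hn⟩⟩
  by_contra hcon
  refine hc ⟨⟨0, 1, zero_ne_one⟩, fun x y => Subtype.ext ?_, fun {x} hx => ?_⟩
  · exact (Subalgebra.mem_center_iff.1 y.2) x
  · obtain ⟨x, hxc⟩ := x
    have hxc' := hxc
    rw [Matrix.subalgebraCenter_eq_scalarAlgHom_map] at hxc'
    obtain ⟨z, hz, rfl⟩ := hxc'
    have hz0 : z ≠ 0 := by
      rintro rfl
      exact hx (Subtype.ext (by simp))
    have key : ∃ w, w ∈ Subalgebra.center F D ∧ z * w = 1 := by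
      rcases hd with hd | hd
      · obtain ⟨c, hc⟩ := hD.exists_star_mul_self h2 z
        have hc0 : c ≠ 0 := by
          rintro rfl
          exact hcon ⟨hd, z, hz0, by rw [hc, map_zero]⟩
        obtain ⟨u, rfl⟩ := hD.isUnit_of_star_mul_self hc0 hc
        exact ⟨↑u⁻¹, Subalgebra.mem_center_iff.2 fun y =>
          hD.mul_comm_of_finrank_eq_two h2 hd y _, u.mul_inv⟩
      · have hz' : z ∈ Subalgebra.center F D := hz
        rw [hD.center_eq_bot h2 (by omega), Algebra.mem_bot] at hz'
        obtain ⟨c, rfl⟩ := hz'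
        have hc0 : c ≠ 0 := by
          rintro rfl
          exact hz0 (map_zero _)
        exact ⟨algebraMap F D c⁻¹, Subalgebra.algebraMap_mem _ _, by
          rw [← map_mul, mul_inv_cancel₀ hc0, map_one]⟩
    obtain ⟨w, hw, hzw⟩ := key
    refine ⟨⟨Matrix.scalarAlgHom (Fin n) F w, ?_⟩, Subtype.ext ?_⟩
    · rw [Matrix.subalgebraCenter_eq_scalarAlgHom_map]
      exact ⟨w, hw, rfl⟩
    · change Matrix.scalarAlgHom (Fin n) F z * Matrix.scalarAlgHom (Fin n) F w = 1
      rw [← map_mul, hzw, map_one]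

/-- If `D` is a split quadratic étale algebra, the trace form is hyperbolic: for a zero divisor `z`,
the vectors with coordinates in `D z` form a totally isotropic subspace of half the dimension. -/
theorem quadWittIndex_eq_of_star_mul_self_eq_zero (hD : IsStandardInvolution F D) (h2 : (2 : F) ≠ 0)
    (hd : finrank F D = 2) {z : D} (hz0 : z ≠ 0) (hz : star z * z = 0)
    {q : QuadraticForm F (Fin n → D)} (hq : IsTraceForm F h q)
    (hh : ∀ x, (∀ y, h.toFun x y = 0) → x = 0) : quadWittIndex q = n := by
  have := hD.finite
  have hcomm := hD.mul_comm_of_finrank_eq_two h2 hd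
  let S : Submodule F D := LinearMap.range (LinearMap.mulRight F z)
  have hS : finrank F S = 1 := by
    have h1 := LinearMap.finrank_range_add_finrank_ker (LinearMap.mulRight F z)
    have h3 : LinearMap.range (LinearMap.mulRight F z) ≠ ⊥ := fun h =>
      hz0 ((Submodule.mem_bot F).1 (h ▸ ⟨1, by simp⟩))
    have h4 : LinearMap.ker (LinearMap.mulRight F z) ≠ ⊥ := fun h =>
      hz0 (by
        have : star z ∈ LinearMap.ker (LinearMap.mulRight F z) := hz
        rw [h, Submodule.mem_bot] at this
        rw [← star_star z, this, star_zero])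
    have h5 := Submodule.one_le_finrank_iff.2 h3
    have h6 := Submodule.one_le_finrank_iff.2 h4
    change finrank F (LinearMap.range (LinearMap.mulRight F z)) = 1
    omega
  have hinj : Function.Injective (S.subtype.compLeft (Fin n)) := fun x y hxy => by
    funext i
    exact Subtype.ext (congrFun hxy i)
  have hfin : finrank F (LinearMap.range (S.subtype.compLeft (Fin n))) = n := by
    rw [LinearMap.finrank_range_of_inj hinj, finrank_pi_fintype]
    simp [hS]
  conv_rhs => rw [← hfin]
  refine quadWittIndex_eq_of_two_mul (hq.nondegenerate hD hh) ?_ ?_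
  · rintro _ ⟨x, rfl⟩
    have hx : ∀ i, ∃ d : D, d * z = (x i : D) := fun i => (x i).2
    choose d hd using hx
    have : S.subtype.compLeft (Fin n) x = fun i => d i * z := by
      funext i
      exact (hd i).symm
    apply hD.algebraMap_injective
    rw [hq, this, h.mul_right, h.mul_left, hcomm (star z), mul_assoc, hz, mul_zero, map_zero]
  · rw [hfin, finrank_pi_fintype]
    simp [hd, mul_comm]

/-- If the center is a field, the isotropic right ideals correspond to the totally isotropic
`D`-submodules of `Dⁿ`; otherwise the trace form is hyperbolic. -/
theorem wittIndex_eq (hD : IsStandardInvolution F D) (h2 : (2 : F) ≠ 0)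
    (hd : finrank F D = 2 ∨ finrank F D = 4) (hn : 0 < n) (hσ : IsUnderlyingForm F σ h)
    {q : QuadraticForm F (Fin n → D)} (hq : IsTraceForm F h q) :
    wittIndex F σ = quadWittIndex q / 2 := by
  have := hD.finite
  obtain ⟨hdeg, hdeg'⟩ := finrank_center_mul_degree hD h2 hd hn
  rw [wittIndex]
  split_ifs with hc
  · obtain ⟨W, hW, hqW⟩ := exists_isTotallyIsotropic_finrank_eq hD hq hσ.1
    have hrdim : ∀ U : Submodule F (Fin n → D), rdim F (columnIdeal U) = finrank F U / 2 := by
      intro U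
      rw [rdim, hdeg, finrank_columnIdeal, mul_comm 2 n, Nat.mul_div_mul_left _ _ hn]
    apply IsGreatest.csSup_eq
    refine ⟨⟨_, hW.columnIdeal hσ, by rw [hrdim, hqW]⟩, ?_⟩
    rintro k ⟨I, hI, rfl⟩
    obtain ⟨U, hU, rfl⟩ := hI.exists_columnIdeal hn hσ
    rw [hrdim]
    refine Nat.div_le_div_right (le_csSup
      ⟨finrank F (Fin n → D), by rintro k ⟨W, -, rfl⟩; exact W.finrank_le⟩ ⟨U, fun x hx => ?_, rfl⟩)
    apply hD.algebraMap_injective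
    rw [hq, hU.2 x hx x hx, map_zero]
  · obtain ⟨hd2, z, hz0, hz⟩ := exists_star_mul_self_eq_zero hD h2 hd hn hc
    rw [hdeg' hd2, quadWittIndex_eq_of_star_mul_self_eq_zero hD h2 hd2 hz0 hz hq hσ.1]

end RightIdeals

/-! ### Gram matrices -/

section Gram

open Module

variable {D : Type u} [Ring D] [StarRing D] {n : ℕ}

/-- The matrix `(h (eᵢ, eⱼ))` of a hermitian form in the standard basis. -/
def HermitianForm.gram (h : HermitianForm D n) : Matrix (Fin n) (Fin n) D :=
  Matrix.of fun i j => h.toFun (Pi.single i 1) (Pi.single j 1)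

/-- The hermitian form `(x, y) ↦ x* G y`. -/
def HermitianForm.ofMatrix (G : Matrix (Fin n) (Fin n) D) (hG : Gᴴ = G) : HermitianForm D n where
  toFun x y := star x ⬝ᵥ (G *ᵥ y)
  add_right x y z := by rw [Matrix.mulVec_add, dotProduct_add]
  mul_right x y d := by
    have : G *ᵥ (fun i => y i * d) = fun i => (G *ᵥ y) i * d := by
      funext i
      simp [Matrix.mulVec, dotProduct, Finset.sum_mul, mul_assoc]
    rw [this]
    simp [dotProduct, Finset.sum_mul, mul_assoc]
  star_apply x y := by
    rw [← Matrix.star_dotProduct_star, star_star, Matrix.star_mulVec, hG,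
      ← Matrix.dotProduct_mulVec]

namespace HermitianForm

variable (h : HermitianForm D n)

theorem conjTranspose_gram : h.gramᴴ = h.gram := by
  ext i j
  exact h.star_apply _ _

theorem toFun_eq (x y : Fin n → D) : h.toFun x y = star x ⬝ᵥ (h.gram *ᵥ y) := by
  have hx : ∀ x : Fin n → D,
      x = ∑ i, fun k => (Pi.single i (1 : D) : Fin n → D) k * x i := fun x => by
    funext k
    simp [Finset.sum_apply, Pi.single_apply]
  conv_lhs => rw [hx x, hx y]
  rw [h.sum_left, dotProduct]
  refine Finset.sum_congr rfl fun i _ => ?_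
  rw [h.sum_right, Matrix.mulVec, dotProduct, Finset.mul_sum]
  refine Finset.sum_congr rfl fun j _ => ?_
  rw [h.mul_left, h.mul_right]
  rfl

theorem gram_ofMatrix (G : Matrix (Fin n) (Fin n) D) (hG : Gᴴ = G) : (ofMatrix G hG).gram = G := by
  ext i j
  simp only [gram, ofMatrix, Matrix.of_apply, Matrix.mulVec_single_one]
  rw [← Pi.single_star, star_one, single_one_dotProduct]
  rfl

end HermitianForm

theorem matrix_eq_of_star_dotProduct {M N : Matrix (Fin n) (Fin n) D}
    (H : ∀ x y : Fin n → D, star x ⬝ᵥ (M *ᵥ y) = star x ⬝ᵥ (N *ᵥ y)) : M = N := by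
  ext i j
  have := H (Pi.single i 1) (Pi.single j 1)
  rw [← Pi.single_star, star_one, single_one_dotProduct, single_one_dotProduct,
    Matrix.mulVec_single_one, Matrix.mulVec_single_one] at this
  exact this

variable {F : Type u} [Field F] [Algebra F D]

theorem isUnit_of_mul_left_cancel {A : Type*} [Ring A] [Algebra F A] [FiniteDimensional F A] {g : A}
    (hg : ∀ x, x * g = 0 → x = 0) : IsUnit g := by
  have hinj : Function.Injective (LinearMap.mulRight F g) := by
    rw [← LinearMap.ker_eq_bot, LinearMap.ker_eq_bot']
    exact hg
  obtain ⟨x, hx⟩ := (LinearMap.injective_iff_surjective.1 hinj) 1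
  have hx' : x * g = 1 := hx
  refine ⟨⟨g, x, ?_, hx'⟩, rfl⟩
  apply hinj
  simp [mul_assoc, hx']

/-- In terms of the Gram matrix `G`, the involution adjoint to `h` is `x ↦ G⁻¹ x* G`. -/
theorem isUnderlyingForm_iff [FiniteDimensional F D]
    {σ : Matrix (Fin n) (Fin n) D →ₗ[F] Matrix (Fin n) (Fin n) D} {h : HermitianForm D n} :
    IsUnderlyingForm F σ h ↔ IsUnit h.gram ∧ ∀ M, h.gram * M = (σ M)ᴴ * h.gram := by
  rw [IsUnderlyingForm]
  apply and_congr
  · constructor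
    · intro H
      refine isUnit_of_mul_left_cancel (F := F) fun X hX => ?_
      ext i j
      have := H (star (X i)) fun y => by
        rw [h.toFun_eq, star_star, Matrix.dotProduct_mulVec]
        have h1 : X i ᵥ* h.gram = 0 := by
          funext k
          exact congrFun (congrFun hX i) k
        rw [h1, zero_dotProduct]
      have h2 := congrArg star (congrFun this j)
      simpa using h2
    · rintro ⟨u, hu⟩ x hx
      have h1 : star x ᵥ* h.gram = 0 := by
        funext k
        have := hx (Pi.single k 1)
        rw [h.toFun_eq, Matrix.dotProduct_mulVec, dotProduct_single_one] at this
        exact this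
      have h2 : (star x ᵥ* h.gram) ᵥ* (↑u⁻¹ : Matrix (Fin n) (Fin n) D) = 0 := by
        rw [h1, Matrix.zero_vecMul]
      rw [Matrix.vecMul_vecMul, ← hu, u.mul_inv, Matrix.vecMul_one] at h2
      exact star_eq_zero.1 h2
  · refine forall_congr' fun M => ?_
    have h1 : ∀ x y, h.toFun x (M *ᵥ y) = star x ⬝ᵥ ((h.gram * M) *ᵥ y) := fun x y => by
      rw [h.toFun_eq, Matrix.mulVec_mulVec]
    have h2 : ∀ x y, h.toFun (σ M *ᵥ x) y = star x ⬝ᵥ (((σ M)ᴴ * h.gram) *ᵥ y) := fun x y => by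
      rw [h.toFun_eq, Matrix.star_mulVec, ← Matrix.dotProduct_mulVec, Matrix.mulVec_mulVec]
    simp only [h1, h2]
    exact ⟨matrix_eq_of_star_dotProduct, fun H x y => by rw [H]⟩

end Gram

/-! ### Extension of scalars -/

section BaseChange

open Module QuadraticMap

variable {F : Type u} [Field F]

theorem finrank_center_congr {A B : Type u} [Ring A] [Algebra F A] [Ring B] [Algebra F B]
    (e : A ≃ₐ[F] B) : finrank F (Subalgebra.center F A) = finrank F (Subalgebra.center F B) := by
  have h : (Subalgebra.center F A).map e.toAlgHom = Subalgebra.center F B := by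
    ext x
    rw [Subalgebra.mem_map, Subalgebra.mem_center_iff]
    constructor
    · rintro ⟨y, hy, rfl⟩ b
      obtain ⟨a, rfl⟩ := e.surjective b
      have := (Subalgebra.mem_center_iff.1 hy) a
      exact (map_mul e a y).symm.trans ((congrArg e this).trans (map_mul e y a))
    · intro hx
      refine ⟨e.symm x, Subalgebra.mem_center_iff.2 fun a => ?_, e.apply_symm_apply x⟩
      apply e.injective
      rw [map_mul, map_mul, e.apply_symm_apply, hx]
  rw [← h]
  exact ((Subalgebra.center F A).equivMapOfInjective _ e.injective).toLinearEquiv.finrank_eq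

theorem degree_congr {A B : Type u} [Ring A] [Algebra F A] [Ring B] [Algebra F B]
    (e : A ≃ₐ[F] B) : degree F A = degree F B := by
  rw [degree, degree, finrank_center_congr e, e.toLinearEquiv.finrank_eq]

theorem isField_center_congr {A B : Type u} [Ring A] [Algebra F A] [Ring B] [Algebra F B]
    (e : A ≃ₐ[F] B) (h : IsField (Subalgebra.center F A)) : IsField (Subalgebra.center F B) :=
  MulEquiv.isField h (Subring.centerCongr e.toRingEquiv.symm).toMulEquiv

theorem isTotallyIsotropicRightIdeal_map {A B : Type u} [Ring A] [Algebra F A] [Ring B]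
    [Algebra F B] (e : A ≃ₐ[F] B) {σ : A →ₗ[F] A} {τ : B →ₗ[F] B} (h : ∀ x, τ (e x) = e (σ x))
    {I : Submodule F A} (hI : IsTotallyIsotropicRightIdeal F σ I) :
    IsTotallyIsotropicRightIdeal F τ (I.map e.toLinearMap) := by
  constructor
  · rintro _ ⟨x, hx, rfl⟩ b
    obtain ⟨a, rfl⟩ := e.surjective b
    exact ⟨x * a, hI.1 x hx a, map_mul e x a⟩
  · rintro _ ⟨x, hx, rfl⟩ _ ⟨y, hy, rfl⟩
    change τ (e x) * e y = 0
    rw [h, ← map_mul, hI.2 x hx y hy, map_zero]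

theorem wittIndex_congr {A B : Type u} [Ring A] [Algebra F A] [Ring B] [Algebra F B]
    (e : A ≃ₐ[F] B) {σ : A →ₗ[F] A} {τ : B →ₗ[F] B} (h : ∀ x, τ (e x) = e (σ x)) :
    wittIndex F σ = wittIndex F τ := by
  have hrd : ∀ I : Submodule F A, rdim F (I.map e.toLinearMap) = rdim F I := fun I => by
    rw [rdim, rdim, finrank_center_congr e, degree_congr e]
    congr 1
    exact (e.toLinearEquiv.submoduleMap I).finrank_eq.symm
  have hrd' : ∀ I : Submodule F B, rdim F (I.map e.symm.toLinearMap) = rdim F I := fun I => by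
    rw [rdim, rdim, finrank_center_congr e, degree_congr e]
    congr 1
    exact (e.symm.toLinearEquiv.submoduleMap I).finrank_eq.symm
  rw [wittIndex, wittIndex, degree_congr e]
  congr 1
  · exact propext ⟨isField_center_congr e, isField_center_congr e.symm⟩
  · congr 1
    ext k
    constructor
    · rintro ⟨I, hI, rfl⟩
      exact ⟨_, isTotallyIsotropicRightIdeal_map e h hI, hrd I⟩
    · rintro ⟨I, hI, rfl⟩
      refine ⟨_, isTotallyIsotropicRightIdeal_map e.symm (τ := σ) (fun x => ?_) hI, hrd' I⟩
      apply e.injective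
      rw [← h, e.apply_symm_apply, e.apply_symm_apply]

variable {D : Type u} [Ring D] [StarRing D] [Algebra F D]

/-- The standard involution as an `F`-linear map. -/
def IsStandardInvolution.starLinear (hD : IsStandardInvolution F D) : D →ₗ[F] D where
  toFun := star
  map_add' := star_add
  map_smul' := hD.star_smul

/-- The extension of the standard involution of `D` to `L ⊗ D`. -/
@[reducible]
def IsStandardInvolution.tensorStarRing (hD : IsStandardInvolution F D) (L : Type u) [Field L]
    [Algebra F L] : StarRing (L ⊗[F] D) where
  star := hD.starLinear.baseChange L
  star_involutive x := by
    induction x using TensorProduct.induction_on with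
    | zero => simp
    | tmul l d =>
      rw [LinearMap.baseChange_tmul, LinearMap.baseChange_tmul]
      exact congrArg (l ⊗ₜ[F] ·) (star_star d)
    | add x y hx hy => rw [map_add, map_add, hx, hy]
  star_mul x y := by
    change hD.starLinear.baseChange L (x * y) =
      hD.starLinear.baseChange L y * hD.starLinear.baseChange L x
    induction x using TensorProduct.induction_on with
    | zero => simp
    | tmul l d =>
      induction y using TensorProduct.induction_on with
      | zero => simp
      | tmul l' d' =>
        rw [Algebra.TensorProduct.tmul_mul_tmul, LinearMap.baseChange_tmul,
          LinearMap.baseChange_tmul, LinearMap.baseChange_tmul, Algebra.TensorProduct.tmul_mul_tmul,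
          mul_comm l l']
        exact congrArg (_ ⊗ₜ[F] ·) (star_mul d d')
      | add x y hx hy => rw [mul_add, map_add, map_add, hx, hy, add_mul]
    | add x y hx hy => rw [add_mul, map_add, map_add, hx, hy, mul_add]
  star_add x y := map_add (hD.starLinear.baseChange L) x y

theorem IsStandardInvolution.star_tmul (hD : IsStandardInvolution F D) {L : Type u} [Field L]
    [Algebra F L] (l : L) (d : D) :
    (hD.tensorStarRing L).star (l ⊗ₜ d) = l ⊗ₜ star d :=
  LinearMap.baseChange_tmul _ _ _

/-- Standard involutions are stable under extension of scalars. For the trace form this follows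
by expanding in the basis dual to a basis of `D`. -/
theorem IsStandardInvolution.baseChange (hD : IsStandardInvolution F D) (L : Type u) [Field L]
    [Algebra F L] :
    @IsStandardInvolution L (L ⊗[F] D) _ _ (hD.tensorStarRing L) _ := by
  let := hD.tensorStarRing L
  have := hD.finite
  have := hD.nontrivial
  have hstar : ∀ (l : L) (d : D), star (l ⊗ₜ[F] d) = l ⊗ₜ star d := hD.star_tmul
  refine ⟨fun c => ?_, fun x => ?_, fun x hx => ?_, inferInstance, inferInstance⟩
  · rw [Algebra.TensorProduct.algebraMap_apply, hstar, star_one]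
  · induction x using TensorProduct.induction_on with
    | zero => exact ⟨0, by simp⟩
    | tmul l d =>
      refine ⟨l * algebraMap F L (hD.trace d), ?_⟩
      rw [hstar, ← TensorProduct.tmul_add, ← hD.algebraMap_trace,
        Algebra.TensorProduct.algebraMap_apply, Algebra.algebraMap_eq_smul_one,
        TensorProduct.tmul_smul, TensorProduct.smul_tmul', Algebra.smul_def, mul_comm]
      rfl
    | add x y hx hy =>
      obtain ⟨a, ha⟩ := hx
      obtain ⟨b, hb⟩ := hy
      refine ⟨a + b, ?_⟩
      rw [star_add, map_add, ← ha, ← hb]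
      abel
  · let B : LinearMap.BilinForm F D := (LinearMap.mul F D).compr₂ hD.trace
    have hB : B.Nondegenerate := by
      have hr : B.IsRefl := fun x y hxy => by
        change hD.trace (y * x) = 0
        rw [hD.trace_mul_comm]
        exact hxy
      exact (LinearMap.IsRefl.nondegenerate_iff_separatingLeft hr).2 fun x hx =>
        hD.eq_zero_of_trace hx
    let b := finBasis F D
    let b' := LinearMap.BilinForm.dualBasis B hB b
    let bL := Algebra.TensorProduct.basis L b'
    -- the `j`-th coordinate of `x` in the dual basis is its trace against `b j`
    have key : ∀ j, bL.repr x j = 0 := fun j => by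
      have h1 := hx (1 ⊗ₜ b j)
      have h3 : ∀ y z : D, (1 : L) ⊗ₜ[F] y * (1 ⊗ₜ z) + star ((1 : L) ⊗ₜ[F] y * (1 ⊗ₜ z)) =
          algebraMap L (L ⊗[F] D) (algebraMap F L (hD.trace (y * z))) := fun y z => by
        rw [Algebra.TensorProduct.tmul_mul_tmul, mul_one, hstar, ← TensorProduct.tmul_add,
          ← hD.algebraMap_trace, ← IsScalarTower.algebraMap_apply,
          Algebra.algebraMap_eq_smul_one, TensorProduct.tmul_smul, Algebra.algebraMap_eq_smul_one]
        rfl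
      have hsm : ∀ (c : L) (z : L ⊗[F] D), star (c • z) = c • star z := fun c z =>
        map_smul (hD.starLinear.baseChange L) c z
      rw [← bL.sum_repr x, Finset.sum_mul, star_sum, ← Finset.sum_add_distrib] at h1
      have h4 : ∀ k, bL.repr x k • bL k * 1 ⊗ₜ b j + star (bL.repr x k • bL k * 1 ⊗ₜ b j) =
          algebraMap L (L ⊗[F] D) (if j = k then bL.repr x k else 0) := fun k => by
        rw [smul_mul_assoc, hsm, ← smul_add, Algebra.TensorProduct.basis_apply, h3]
        have : hD.trace (b' k * b j) = if j = k then 1 else 0 :=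
          LinearMap.BilinForm.apply_dualBasis_left hB b k j
        rw [this]
        split_ifs <;> simp [Algebra.smul_def]
      rw [Finset.sum_congr rfl fun k _ => h4 k, ← map_sum] at h1
      have h5 := (algebraMap L (L ⊗[F] D)).injective (h1.trans (map_zero _).symm)
      simpa using h5
    exact bL.ext_elem_iff.2 fun j => by rw [key, map_zero]; rfl

end BaseChange

/-! ### Witt indices after extensions of odd degree -/

section WittTwoIndex

open Module QuadraticMap

variable {F : Type u} [Field F] {D : Type u} [Ring D] [Algebra F D] {n : ℕ}

/-- The natural map `L ⊗ Mₙ(D) → Mₙ(L ⊗ D)`. -/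
def tensorMatrixHom (F D : Type u) [Field F] [Ring D] [Algebra F D] (n : ℕ) (L : Type u) [Field L]
    [Algebra F L] :
    L ⊗[F] Matrix (Fin n) (Fin n) D →ₐ[L] Matrix (Fin n) (Fin n) (L ⊗[F] D) :=
  Algebra.TensorProduct.lift (Algebra.ofId L _)
    (Algebra.TensorProduct.includeRight : D →ₐ[F] L ⊗[F] D).mapMatrix
    fun l _ => by rw [Algebra.ofId_apply]; exact Algebra.commute_algebraMap_left l _

theorem tensorMatrixHom_tmul (L : Type u) [Field L] [Algebra F L] (l : L)
    (x : Matrix (Fin n) (Fin n) D) :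
    tensorMatrixHom F D n L (l ⊗ₜ x) =
      l • x.map (Algebra.TensorProduct.includeRight : D →ₐ[F] L ⊗[F] D) := by
  rw [tensorMatrixHom, Algebra.TensorProduct.lift_tmul, Algebra.ofId_apply, ← Algebra.smul_def]
  rfl

theorem tensorMatrixHom_bijective [FiniteDimensional F D] (L : Type u) [Field L] [Algebra F L] :
    Function.Bijective (tensorMatrixHom F D n L) := by
  have hs : Function.Surjective (tensorMatrixHom F D n L).toLinearMap := by
    rw [← LinearMap.range_eq_top, eq_top_iff]
    intro x _
    rw [Matrix.matrix_eq_sum_single x]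
    refine Submodule.sum_mem _ fun i _ => Submodule.sum_mem _ fun j _ => ?_
    induction x i j using TensorProduct.induction_on with
    | zero => rw [Matrix.single_zero]; exact Submodule.zero_mem _
    | tmul l d =>
      refine ⟨l ⊗ₜ Matrix.single i j d, (tensorMatrixHom_tmul L l (Matrix.single i j d)).trans ?_⟩
      ext a b
      by_cases hab : i = a ∧ j = b
      · obtain ⟨rfl, rfl⟩ := hab
        simp [TensorProduct.smul_tmul']
      · simp [Matrix.single, hab]
    | add y z hy hz => rw [Matrix.single_add]; exact Submodule.add_mem _ hy hz
  refine ⟨(LinearMap.injective_iff_surjective_of_finrank_eq_finrank ?_).2 hs, hs⟩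
  rw [finrank_baseChange, finrank_matrix, finrank_matrix, finrank_baseChange]

variable [StarRing D] {h : HermitianForm D n} {q : QuadraticForm F (Fin n → D)}
  {σ : Matrix (Fin n) (Fin n) D →ₗ[F] Matrix (Fin n) (Fin n) D}

/-- After extension of scalars, the involution is adjoint to the hermitian form over `L ⊗ D` with
the same Gram matrix, and its trace form is the extension of `q`. -/
theorem wittIndex_baseChange (hD : IsStandardInvolution F D) (h2 : (2 : F) ≠ 0)
    (hd : finrank F D = 2 ∨ finrank F D = 4) (hn : 0 < n) (hσ : IsUnderlyingForm F σ h)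
    (hq : IsTraceForm F h q) (L : Type u) [Field L] [Algebra F L] [FiniteDimensional F L]
    (hodd : Odd (finrank F L)) : wittIndex L (σ.baseChange L) = quadWittIndex q / 2 := by
  have := hD.finite
  have := hD.nontrivial
  let := hD.tensorStarRing L
  have hDL := hD.baseChange L
  have hstar : ∀ (l : L) (d : D), star (l ⊗ₜ[F] d) = l ⊗ₜ star d := hD.star_tmul
  let ι : D →ₐ[F] L ⊗[F] D := Algebra.TensorProduct.includeRight
  have hιs : ∀ d, ι (star d) = star (ι d) := fun d => (hstar 1 d).symm
  have hmapstar : ∀ X : Matrix (Fin n) (Fin n) D, (X.map ι)ᴴ = Xᴴ.map ι := fun X => by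
    ext i j
    exact (hιs _).symm
  let hL := HermitianForm.ofMatrix (h.gram.map ι) (by rw [hmapstar, h.conjTranspose_gram])
  have hLg : hL.gram = h.gram.map ι := HermitianForm.gram_ofMatrix _ _
  let e : L ⊗[F] Matrix (Fin n) (Fin n) D ≃ₐ[L] Matrix (Fin n) (Fin n) (L ⊗[F] D) :=
    AlgEquiv.ofBijective (tensorMatrixHom F D n L) (tensorMatrixHom_bijective L)
  let τ : Matrix (Fin n) (Fin n) (L ⊗[F] D) →ₗ[L] Matrix (Fin n) (Fin n) (L ⊗[F] D) :=
    e.toLinearMap ∘ₗ σ.baseChange L ∘ₗ e.symm.toLinearMap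
  have hτ : ∀ x, τ (e x) = e (σ.baseChange L x) := fun x => by
    change e (σ.baseChange L (e.symm (e x))) = _
    rw [e.symm_apply_apply]
  have he : ∀ l x, e (l ⊗ₜ x) = l • x.map ι := tensorMatrixHom_tmul L
  obtain ⟨hu, hM⟩ := isUnderlyingForm_iff.1 hσ
  have hsm : ∀ (c : L) (X : Matrix (Fin n) (Fin n) (L ⊗[F] D)), (c • X)ᴴ = c • Xᴴ := fun c X => by
    ext i j
    exact hDL.star_smul _ _
  have hτL : IsUnderlyingForm L τ hL := by
    rw [isUnderlyingForm_iff, hLg]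
    refine ⟨hu.map ι.mapMatrix, fun M => ?_⟩
    obtain ⟨t, rfl⟩ := e.surjective M
    rw [hτ]
    induction t using TensorProduct.induction_on with
    | zero => simp
    | tmul l x =>
      rw [LinearMap.baseChange_tmul, he, he, hsm, hmapstar, mul_smul_comm, smul_mul_assoc,
        ← Matrix.map_mul, ← Matrix.map_mul, hM]
    | add x y hx hy => rw [map_add, map_add, map_add, mul_add, hx, hy, Matrix.conjTranspose_add,
        add_mul]
  have h2L : (2 : L) ≠ 0 := by
    rw [← map_ofNat (algebraMap F L) 2]
    exact (map_ne_zero _).2 h2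
  have hqL := hL.isTraceForm_traceForm hDL h2L
  rw [wittIndex_congr e hτ, wittIndex_eq hDL h2L (by rwa [finrank_baseChange]) hn hτL hqL]
  congr 1
  refine quadWittIndex_eq_of_isBaseChange h2 hodd
    (IsBaseChange.finitePow (Fin n) (TensorProduct.isBaseChange F D L))
    (hq.nondegenerate hD hσ.1) (hqL.nondegenerate hDL hτL.1) fun v => ?_
  apply hDL.algebraMap_injective
  rw [hqL, ← IsScalarTower.algebraMap_apply, ← ι.commutes, hq, hL.toFun_eq, h.toFun_eq, hLg]
  refine Eq.trans ?_ (RingHom.map_dotProduct ι.toRingHom _ _).symm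
  congr 1
  · funext i
    exact (RingHom.map_mulVec ι.toRingHom h.gram v i).symm

theorem wittTwoIndex_eq (hD : IsStandardInvolution F D) (h2 : (2 : F) ≠ 0)
    (hd : finrank F D = 2 ∨ finrank F D = 4) (hn : 0 < n) (hσ : IsUnderlyingForm F σ h)
    (hq : IsTraceForm F h q) : wittTwoIndex F σ = quadWittIndex q / 2 := by
  apply IsGreatest.csSup_eq
  refine ⟨⟨F, inferInstance, inferInstance, inferInstance, by rw [finrank_self]; exact odd_one,
    wittIndex_baseChange hD h2 hd hn hσ hq F (by rw [finrank_self]; exact odd_one)⟩, ?_⟩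
  rintro k ⟨L, _, _, _, hodd, rfl⟩
  exact (wittIndex_baseChange hD h2 hd hn hσ hq L hodd).le

end WittTwoIndex

/-! ### Diagonalization of hermitian forms -/

section Diagonalization

open Module QuadraticMap

variable {F : Type u} [Field F] {D : Type u} [Ring D] [StarRing D] [Algebra F D] {n : ℕ}

/-- A nondegenerate hermitian form has an orthogonal family of `k ≤ n` vectors with nonzero values
in `F`: the form cannot vanish on the orthogonal complement of a shorter family. -/
theorem exists_orthogonal_family (hD : IsStandardInvolution F D) (h2 : (2 : F) ≠ 0)
    {h : HermitianForm D n} (hh : ∀ x, (∀ y, h.toFun x y = 0) → x = 0) :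
    ∀ k ≤ n, ∃ (x : Fin k → Fin n → D) (a : Fin k → F), (∀ i, a i ≠ 0) ∧
      ∀ i j, h.toFun (x i) (x j) = if i = j then algebraMap F D (a i) else 0 := by
  have := hD.finite
  have := hD.nontrivial
  intro k
  induction k with
  | zero => exact fun _ => ⟨finZeroElim, finZeroElim, finZeroElim, finZeroElim⟩
  | succ k ih =>
    intro hk
    obtain ⟨x, a, ha, hx⟩ := ih (by omega)
    let f : (Fin n → D) →ₗ[F] (Fin k → D) :=
      { toFun := fun y i => h.toFun (x i) y
        map_add' := fun y z => by funext i; exact h.add_right _ _ _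
        map_smul' := fun c y => by funext i; exact h.smul_right _ _ _ }
    have hf : ∀ y, f y = 0 ↔ ∀ i, h.toFun (x i) y = 0 := fun y => funext_iff
    -- otherwise the form vanishes on the complement `ker f`, so that its elements are orthogonal to
    -- everything, while `ker f ≠ 0` because `k < n`
    have key : ∃ y, f y = 0 ∧ h.toFun y y ≠ 0 := by
      by_contra hcon
      push Not at hcon
      have hmul : ∀ y, f y = 0 → ∀ d : D, f (fun i => y i * d) = 0 := fun y hy d => by
        rw [hf] at hy ⊢
        intro i
        rw [h.mul_right, hy, zero_mul]
      have hq := h.isTraceForm_traceForm hD h2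
      have hzero : ∀ y z, f y = 0 → f z = 0 → h.toFun y z = 0 := fun y z hy hz => by
        rw [← hq.polar_eq_zero_iff hD]
        intro d
        have hval : ∀ w, f w = 0 → h.traceForm hD w = 0 := fun w hw => by
          apply hD.algebraMap_injective
          rw [hq, hcon w hw, map_zero]
        rw [polar, hval _ hy, hval _ (hmul z hz d), hval, sub_zero, sub_zero]
        rw [map_add, hy, hmul z hz d, add_zero]
      have hker : LinearMap.ker f ≠ ⊥ := by
        intro hbot
        have hinj := LinearMap.ker_eq_bot.1 hbot
        have h1 := LinearMap.finrank_le_finrank_of_injective hinj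
        rw [finrank_pi_fintype, finrank_pi_fintype] at h1
        simp only [Finset.sum_const, Finset.card_univ, Fintype.card_fin, smul_eq_mul] at h1
        have h3 := Nat.le_of_mul_le_mul_right h1 (finrank_pos (R := F) (M := D))
        omega
      obtain ⟨y, hy, hy0⟩ := Submodule.exists_mem_ne_zero_of_ne_bot hker
      refine hy0 (hh y fun z => ?_)
      -- `z` differs from its projection to the complement by a combination of the `x i`
      let z' : Fin n → D := z - ∑ i, fun l => x i l * ((a i)⁻¹ • h.toFun (x i) z)
      have hz' : f z' = 0 := by
        rw [hf]
        intro j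
        have hneg : ∀ u v : Fin n → D, h.toFun (x j) (u - v) = h.toFun (x j) u - h.toFun (x j) v :=
          fun u v => by
            rw [eq_sub_iff_add_eq, ← h.add_right, sub_add_cancel]
        rw [hneg, h.sum_right, Finset.sum_eq_single j]
        · rw [h.mul_right, hx, if_pos rfl, ← Algebra.smul_def, smul_smul, mul_inv_cancel₀ (ha j),
            one_smul, sub_self]
        · intro i _ hij
          rw [h.mul_right, hx, if_neg hij.symm, zero_mul]
        · simp
      have hz : z = z' + ∑ i, fun l => x i l * ((a i)⁻¹ • h.toFun (x i) z) := by
        simp [z']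
      rw [hz, h.add_right, hzero y z' hy hz', zero_add, h.sum_right]
      refine Finset.sum_eq_zero fun i _ => ?_
      rw [h.mul_right, ← h.star_apply, ((hf y).1 hy) i, star_zero, zero_mul]
    obtain ⟨y, hy, hyy⟩ := key
    obtain ⟨c, hc⟩ := hD.exists_of_star_eq h2 (h.star_apply y y)
    rw [hf] at hy
    refine ⟨Fin.snoc x y, Fin.snoc a c, fun i => ?_, fun i j => ?_⟩
    · refine Fin.lastCases ?_ (fun i => ?_) i
      · rw [Fin.snoc_last]
        rintro rfl
        exact hyy (by rw [hc, map_zero])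
      · rw [Fin.snoc_castSucc]
        exact ha i
    · refine Fin.lastCases ?_ (fun i => ?_) i <;> refine Fin.lastCases ?_ (fun j => ?_) j
      · simp [hc]
      · rw [Fin.snoc_last, Fin.snoc_castSucc, ← h.star_apply, hy, star_zero,
          if_neg (Fin.castSucc_lt_last j).ne']
      · rw [Fin.snoc_last, Fin.snoc_castSucc, hy, if_neg (Fin.castSucc_lt_last i).ne]
      · simp [hx]

theorem isUnit_of_mul_eq_one {A : Type*} [Ring A] [Algebra F A] [FiniteDimensional F A] {x y : A}
    (h : x * y = 1) : IsUnit y := by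
  have hx : IsUnit x := isUnit_of_mul_left_cancel (F := F) fun z hz => by
    rw [← mul_one z, ← h, ← mul_assoc, hz, zero_mul]
  obtain ⟨u, rfl⟩ := hx
  have : y = ↑u⁻¹ := by rw [← u.inv_mul_cancel_left y, h, mul_one]
  rw [this]
  exact u⁻¹.isUnit

/-- A nondegenerate hermitian form has an orthogonal basis. -/
theorem exists_gram_eq_diagonal (hD : IsStandardInvolution F D) (h2 : (2 : F) ≠ 0)
    {h : HermitianForm D n} (hh : ∀ x, (∀ y, h.toFun x y = 0) → x = 0) :
    ∃ (P : Matrix (Fin n) (Fin n) D) (a : Fin n → F), IsUnit P ∧ (∀ i, a i ≠ 0) ∧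
      Pᴴ * h.gram * P = Matrix.diagonal fun i => algebraMap F D (a i) := by
  have := hD.finite
  obtain ⟨x, a, ha, hx⟩ := exists_orthogonal_family hD h2 hh n le_rfl
  have hP : (Matrix.of fun i j => x j i)ᴴ * h.gram * (Matrix.of fun i j => x j i) =
      Matrix.diagonal fun i => algebraMap F D (a i) := by
    ext i j
    rw [mul_assoc, Matrix.mul_apply_eq_vecMul, Matrix.diagonal_apply, ← hx, h.toFun_eq,
      Matrix.dotProduct_mulVec, ← Matrix.vecMul_vecMul]
    rfl
  refine ⟨_, a, ?_, ha, hP⟩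
  refine isUnit_of_mul_eq_one (F := F)
    (x := (Matrix.diagonal fun i => algebraMap F D (a i)⁻¹) *
      (Matrix.of fun i j => x j i)ᴴ * h.gram) ?_
  rw [mul_assoc, mul_assoc, ← mul_assoc _ h.gram, hP, Matrix.diagonal_mul_diagonal]
  rw [← Matrix.diagonal_one]
  congr 1
  funext i
  rw [← map_mul, inv_mul_cancel₀ (ha i), map_one]

end Diagonalization

/-! ### Signatures -/

section Signature

open Module QuadraticMap

variable {F : Type u} [Field F]

theorem signature_eq_sum_sign [LinearOrder F] [IsStrictOrderedRing F] {V : Type u} [AddCommGroup V]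
    [Module F V] [FiniteDimensional F V] {ι : Type*} [Fintype ι] {q : QuadraticForm F V} {w : ι → F}
    (hq : Equivalent q (weightedSumSquares F w)) :
    signature q = ∑ i, (SignType.sign (w i) : ℤ) := by
  classical
  rw [signature, QuadraticForm.sigPos_of_equiv_weightedSumSquares hq,
    QuadraticForm.sigNeg_of_equiv_weightedSumSquares hq, Set.ncard_eq_toFinset_card',
    Set.ncard_eq_toFinset_card', Set.toFinset_ofPred, Set.toFinset_ofPred, Finset.card_filter,
    Finset.card_filter]
  push_cast
  rw [← Finset.sum_sub_distrib]
  refine Finset.sum_congr rfl fun i _ => ?_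
  rcases lt_trichotomy (w i) 0 with h | h | h
  · simp [h, h.not_gt, sign_neg]
  · simp [h]
  · simp [h, h.not_gt, sign_pos]

variable {D : Type u} [Ring D] [Algebra F D] {n : ℕ} {κ : Type} [Fintype κ]

/-- An invertible matrix as an `F`-linear automorphism of `Dⁿ`. -/
def mulVecEquiv (F : Type u) [Field F] {D : Type u} [Ring D] [Algebra F D] {n : ℕ}
    (P : (Matrix (Fin n) (Fin n) D)ˣ) : (Fin n → D) ≃ₗ[F] (Fin n → D) where
  toFun x := P.1 *ᵥ x
  map_add' := Matrix.mulVec_add P.1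
  map_smul' c x := Matrix.mulVec_smul P.1 c x
  invFun x := P⁻¹.1 *ᵥ x
  left_inv x := (Matrix.mulVec_mulVec _ _ _).trans (by rw [P.inv_mul, Matrix.one_mulVec])
  right_inv x := (Matrix.mulVec_mulVec _ _ _).trans (by rw [P.mul_inv, Matrix.one_mulVec])

/-- Conjugation by an invertible matrix as an `F`-linear automorphism of `Mₙ(D)`. -/
def conjEquiv (F : Type u) [Field F] {D : Type u} [Ring D] [Algebra F D] {n : ℕ}
    (P : (Matrix (Fin n) (Fin n) D)ˣ) :
    Matrix (Fin n) (Fin n) D ≃ₗ[F] Matrix (Fin n) (Fin n) D where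
  toFun x := P.1 * x * P⁻¹.1
  map_add' x y := by rw [mul_add, add_mul]
  map_smul' c x := by rw [mul_smul_comm, smul_mul_assoc, RingHom.id_apply]
  invFun x := P⁻¹.1 * x * P.1
  left_inv x := by simp [mul_assoc]
  right_inv x := by simp [mul_assoc]

/-- A function with values in `D` is given by its coordinates in a basis of `D`. -/
def coordEquiv (ι : Type) (b : Basis κ F D) : (ι × κ → F) ≃ₗ[F] (ι → D) :=
  (LinearEquiv.curry F F ι κ).trans (LinearEquiv.piCongrRight fun _ => b.equivFun.symm)

theorem coordEquiv_apply {ι : Type} (b : Basis κ F D) (x : ι × κ → F) (i : ι) :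
    coordEquiv ι b x i = ∑ k, x (i, k) • b k := by
  simp [coordEquiv, Basis.equivFun_symm_apply]

variable [StarRing D]

/-- In the basis `b` of `D`, the norm form `x ↦ star x * x` is diagonal with coefficients `c`. -/
def IsNormBasis (b : Basis κ F D) (c : κ → F) : Prop :=
  ∀ x : κ → F, star (∑ k, x k • b k) * (∑ k, x k • b k) = algebraMap F D (∑ k, c k * x k ^ 2)

theorem IsTraceForm.apply_mulVec {h : HermitianForm D n} {q : QuadraticForm F (Fin n → D)}
    (hq : IsTraceForm F h q) {P : Matrix (Fin n) (Fin n) D} {a : Fin n → F}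
    (hP : Pᴴ * h.gram * P = Matrix.diagonal fun i => algebraMap F D (a i)) (x : Fin n → D) :
    algebraMap F D (q (P *ᵥ x)) = ∑ i, a i • (star (x i) * x i) := by
  rw [hq, h.toFun_eq, Matrix.star_mulVec, ← Matrix.dotProduct_mulVec, Matrix.mulVec_mulVec,
    Matrix.mulVec_mulVec, hP]
  rw [dotProduct]
  refine Finset.sum_congr rfl fun i _ => ?_
  rw [Matrix.mulVec_diagonal, Algebra.smul_def, ← mul_assoc, ← Algebra.commutes, mul_assoc]
  rfl

/-- In an orthogonal basis, the trace form is diagonal with coefficients `a i * c k`. -/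
theorem IsTraceForm.equivalent_weightedSumSquares (hD : IsStandardInvolution F D)
    {h : HermitianForm D n} {q : QuadraticForm F (Fin n → D)} (hq : IsTraceForm F h q)
    {P : Matrix (Fin n) (Fin n) D} (hPu : IsUnit P) {a : Fin n → F}
    (hP : Pᴴ * h.gram * P = Matrix.diagonal fun i => algebraMap F D (a i))
    {b : Basis κ F D} {c : κ → F} (hb : IsNormBasis b c) :
    Equivalent q (weightedSumSquares F fun i : Fin n × κ => a i.1 * c i.2) := by
  obtain ⟨u, rfl⟩ := hPu
  refine Equivalent.symm ⟨⟨(coordEquiv (Fin n) b).trans (mulVecEquiv F u), fun x => ?_⟩⟩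
  apply hD.algebraMap_injective
  change algebraMap F D (q (u.1 *ᵥ coordEquiv (Fin n) b x)) = _
  rw [hq.apply_mulVec hP, weightedSumSquares_apply, Fintype.sum_prod_type, map_sum]
  refine Finset.sum_congr rfl fun i _ => ?_
  rw [coordEquiv_apply, hb, Algebra.smul_def, ← map_mul, Finset.mul_sum]
  congr 1
  refine Finset.sum_congr rfl fun k _ => ?_
  rw [smul_eq_mul]
  ring

theorem IsUnderlyingForm.gram_mul [FiniteDimensional F D] {h : HermitianForm D n}
    {σ : Matrix (Fin n) (Fin n) D →ₗ[F] Matrix (Fin n) (Fin n) D} (hσ : IsUnderlyingForm F σ h)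
    (M : Matrix (Fin n) (Fin n) D) : h.gram * σ M = Mᴴ * h.gram := by
  have := congrArg Matrix.conjTranspose ((isUnderlyingForm_iff.1 hσ).2 M)
  rw [Matrix.conjTranspose_mul, Matrix.conjTranspose_mul, Matrix.conjTranspose_conjTranspose,
    h.conjTranspose_gram] at this
  exact this.symm

theorem trace_matrix_mul_comm (hD : IsStandardInvolution F D) (x y : Matrix (Fin n) (Fin n) D) :
    hD.trace (Matrix.trace (x * y)) = hD.trace (Matrix.trace (y * x)) := by
  simp only [Matrix.trace, Matrix.diag_apply, Matrix.mul_apply, map_sum]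
  rw [Finset.sum_comm]
  exact Finset.sum_congr rfl fun i _ => Finset.sum_congr rfl fun j _ => hD.trace_mul_comm _ _

/-- In an orthogonal basis, `x ↦ Trd (σ(x) x)` is diagonal with coefficients
`2 * (a i / a j) * c k`. -/
theorem equivalent_weightedSumSquares_of_adjoint (hD : IsStandardInvolution F D)
    {h : HermitianForm D n} {σ : Matrix (Fin n) (Fin n) D →ₗ[F] Matrix (Fin n) (Fin n) D}
    (hσ : IsUnderlyingForm F σ h) {P : Matrix (Fin n) (Fin n) D} (hPu : IsUnit P) {a : Fin n → F}
    (ha : ∀ i, a i ≠ 0)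
    (hP : Pᴴ * h.gram * P = Matrix.diagonal fun i => algebraMap F D (a i))
    {b : Basis κ F D} {c : κ → F} (hb : IsNormBasis b c) {s : F}
    {T : QuadraticForm F (Matrix (Fin n) (Fin n) D)}
    (hT : ∀ x, T x = s * hD.trace (Matrix.trace (σ x * x))) :
    Equivalent T (weightedSumSquares F
      fun i : (Fin n × Fin n) × κ => 2 * s * (a i.1.1 * (a i.1.2)⁻¹ * c i.2)) := by
  have := hD.finite
  obtain ⟨u, rfl⟩ := hPu
  let e₀ : (Fin n × Fin n → D) ≃ₗ[F] Matrix (Fin n) (Fin n) D :=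
    LinearEquiv.curry F D (Fin n) (Fin n)
  refine Equivalent.symm ⟨⟨(coordEquiv (Fin n × Fin n) b).trans (e₀.trans (conjEquiv F u)),
    fun x => ?_⟩⟩
  set Y : Matrix (Fin n) (Fin n) D := e₀ (coordEquiv (Fin n × Fin n) b x) with hY
  have hYij : ∀ i j, Y i j = ∑ k, x ((i, j), k) • b k := fun i j => coordEquiv_apply b x (i, j)
  -- in the orthogonal basis, `σ` is `Y ↦ A⁻¹ Y* A` for the diagonal matrix `A`
  have key : u⁻¹.1 * σ (u.1 * Y * u⁻¹.1) * u.1 =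
      (Matrix.diagonal fun i => algebraMap F D (a i)⁻¹) *
        (Yᴴ * Matrix.diagonal fun i => algebraMap F D (a i)) := by
    have h1 : h.gram * σ (u.1 * Y * u⁻¹.1) = (u.1 * Y * u⁻¹.1)ᴴ * h.gram := hσ.gram_mul _
    have h3 : (Matrix.diagonal fun i => algebraMap F D (a i)) *
        (u⁻¹.1 * σ (u.1 * Y * u⁻¹.1) * u.1) =
          Yᴴ * Matrix.diagonal fun i => algebraMap F D (a i) := by
      rw [← hP]
      calc _ = u.1ᴴ * (h.gram * σ (u.1 * Y * u⁻¹.1)) * u.1 := by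
            simp only [mul_assoc, u.mul_inv_cancel_left]
        _ = Yᴴ * (u.1ᴴ * h.gram * u.1) := by
            rw [h1]
            simp only [Matrix.conjTranspose_mul, mul_assoc]
            rw [← mul_assoc u.1ᴴ (u⁻¹.1)ᴴ, ← Matrix.conjTranspose_mul, u.inv_mul,
              Matrix.conjTranspose_one, one_mul]
    rw [← h3, ← mul_assoc, Matrix.diagonal_mul_diagonal]
    have : (fun i => algebraMap F D (a i)⁻¹ * algebraMap F D (a i)) = fun _ => 1 := by
      funext i
      rw [← map_mul, inv_mul_cancel₀ (ha i), map_one]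
    rw [this, Matrix.diagonal_one, one_mul]
  change T (u.1 * Y * u⁻¹.1) = _
  rw [hT]
  have h4 : σ (u.1 * Y * u⁻¹.1) * (u.1 * Y * u⁻¹.1) =
      (σ (u.1 * Y * u⁻¹.1) * u.1 * Y) * u⁻¹.1 := by simp only [mul_assoc]
  rw [h4, trace_matrix_mul_comm, ← mul_assoc, ← mul_assoc, key]
  have h5 : Matrix.trace ((Matrix.diagonal fun i => algebraMap F D (a i)⁻¹) *
      (Yᴴ * Matrix.diagonal fun i => algebraMap F D (a i)) * Y) =
      algebraMap F D (∑ j, ∑ i, (a i * (a j)⁻¹) * ∑ k, c k * x ((i, j), k) ^ 2) := by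
    rw [Matrix.trace, map_sum]
    refine Finset.sum_congr rfl fun j _ => ?_
    rw [Matrix.diag_apply, Matrix.mul_apply, map_sum]
    refine Finset.sum_congr rfl fun i _ => ?_
    rw [Matrix.diagonal_mul, Matrix.mul_diagonal, Matrix.conjTranspose_apply, map_mul, ← hb,
      ← hYij, ← Algebra.commutes (a i) (star (Y i j)), ← mul_assoc, ← map_mul, mul_comm (a j)⁻¹,
      mul_assoc]
  rw [h5, hD.trace_algebraMap, weightedSumSquares_apply, Fintype.sum_prod_type,
    Fintype.sum_prod_type, Finset.sum_comm, ← mul_assoc, Finset.mul_sum]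
  refine Finset.sum_congr rfl fun i _ => ?_
  rw [Finset.mul_sum]
  refine Finset.sum_congr rfl fun j _ => ?_
  rw [Finset.mul_sum, Finset.mul_sum]
  refine Finset.sum_congr rfl fun k _ => ?_
  rw [smul_eq_mul]
  ring

/-- If `S` is the sum of the signs of the diagonal entries `a i`, the signature of the trace form
of `h` is `S` times that of the norm form of `D`, and the signature of the trace form of `σ` is `S²`
times that of the norm form, because `∑ sign (a i / a j) = S²`. -/
theorem exists_signature_eq [LinearOrder F] [IsStrictOrderedRing F] (hD : IsStandardInvolution F D)
    {h : HermitianForm D n} {σ : Matrix (Fin n) (Fin n) D →ₗ[F] Matrix (Fin n) (Fin n) D}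
    (hσ : IsUnderlyingForm F σ h) {q : QuadraticForm F (Fin n → D)} (hq : IsTraceForm F h q)
    {b : Basis κ F D} {c : κ → F} (hb : IsNormBasis b c) :
    ∃ S : ℤ, signature q = S * ∑ k, (SignType.sign (c k) : ℤ) ∧
      ∀ s : F, 0 < s → ∀ T : QuadraticForm F (Matrix (Fin n) (Fin n) D),
        (∀ x, T x = s * hD.trace (Matrix.trace (σ x * x))) →
          signature T = S ^ 2 * ∑ k, (SignType.sign (c k) : ℤ) := by
  have := hD.finite
  obtain ⟨P, a, hPu, ha, hP⟩ := exists_gram_eq_diagonal hD two_ne_zero hσ.1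
  refine ⟨∑ i, (SignType.sign (a i) : ℤ), ?_, fun s hs T hT => ?_⟩
  · rw [signature_eq_sum_sign (hq.equivalent_weightedSumSquares hD hPu hP hb),
      Fintype.sum_prod_type, Finset.sum_mul]
    refine Finset.sum_congr rfl fun i _ => ?_
    rw [Finset.mul_sum]
    refine Finset.sum_congr rfl fun k _ => ?_
    rw [sign_mul, SignType.coe_mul]
  · rw [signature_eq_sum_sign (equivalent_weightedSumSquares_of_adjoint hD hσ hPu ha hP hb hT),
      Fintype.sum_prod_type, Fintype.sum_prod_type, pow_two, mul_assoc, Finset.sum_mul]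
    refine Finset.sum_congr rfl fun i _ => ?_
    rw [Finset.sum_mul, Finset.mul_sum]
    refine Finset.sum_congr rfl fun j _ => ?_
    rw [Finset.mul_sum, Finset.mul_sum]
    refine Finset.sum_congr rfl fun k _ => ?_
    have hinv : SignType.sign (a j)⁻¹ = SignType.sign (a j) := by
      rcases lt_or_gt_of_ne (ha j) with h | h
      · rw [sign_neg h, sign_neg (inv_lt_zero.2 h)]
      · rw [sign_pos h, sign_pos (inv_pos.2 h)]
    rw [sign_mul, sign_mul, sign_mul, sign_mul, sign_pos hs, sign_pos two_pos, one_mul, one_mul,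
      hinv, SignType.coe_mul, SignType.coe_mul, mul_assoc]

end Signature

/-! ### Quadratic étale algebras -/

section QuadraticEtale

open Module

variable {F K : Type u} [Field F] [CommRing K] [StarRing K] [Algebra F K] [IsQuadraticEtale F K]

theorem IsQuadraticEtale.isReduced (F K : Type u) [Field F] [CommRing K] [StarRing K]
    [Algebra F K] [IsQuadraticEtale F K] : IsReduced K :=
  have : Algebra.Etale F K := IsQuadraticEtale.etale
  Algebra.FormallyUnramified.isReduced_of_field F K

variable (F K) in
/-- The elements fixed by `star` form a proper subspace of `K`, hence are scalars. An element in the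
radical of the trace form has square zero. -/
theorem IsQuadraticEtale.isStandardInvolution (h2 : (2 : F) ≠ 0) : IsStandardInvolution F K := by
  have hfr : finrank F K = 2 := IsQuadraticEtale.finrank_eq_two
  have hfin : FiniteDimensional F K := FiniteDimensional.of_finrank_pos (by omega)
  have hnt : Nontrivial K := Module.nontrivial_of_finrank_pos (R := F) (by omega)
  have hred := IsQuadraticEtale.isReduced F K
  have hsm : ∀ (c : F) (x : K), star (c • x) = c • star x := fun c x => by
    rw [Algebra.smul_def, star_mul', IsQuadraticEtale.star_algebraMap, ← Algebra.smul_def]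
  let S : Submodule F K :=
    { carrier := {x | star x = x}
      add_mem' := fun {x y} (hx : star x = x) (hy : star y = y) => by
        change star (x + y) = x + y
        rw [star_add, hx, hy]
      zero_mem' := star_zero K
      smul_mem' := fun c x (hx : star x = x) => by
        change star (c • x) = c • x
        rw [hsm, hx] }
  have hS : finrank F S ≤ 1 := by
    by_contra hcon
    obtain ⟨z, hz⟩ := IsQuadraticEtale.exists_star_ne F (K := K)
    have : S = ⊤ := Submodule.eq_top_of_finrank_eq (by have := S.finrank_le; omega)
    exact hz (show z ∈ S from this ▸ Submodule.mem_top)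
  have h1S : (1 : K) ∈ S := star_one K
  have hfix : ∀ x : K, star x = x → ∃ c : F, x = algebraMap F K c := fun x hx => by
    have hspan : F ∙ (1 : K) = S := Submodule.eq_of_le_of_finrank_le
      ((Submodule.span_singleton_le_iff_mem _ _).2 h1S)
      (by rw [finrank_span_singleton one_ne_zero]; exact hS)
    have : x ∈ F ∙ (1 : K) := by rw [hspan]; exact hx
    obtain ⟨c, hc⟩ := Submodule.mem_span_singleton.1 this
    exact ⟨c, by rw [← hc, Algebra.smul_def, mul_one]⟩
  refine ⟨IsQuadraticEtale.star_algebraMap, fun x => hfix _ ?_, fun x hx => ?_, hfin, hnt⟩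
  · rw [star_add, star_star, add_comm]
  · have h1 := hx 1
    have h3 := hx x
    rw [mul_one] at h1
    rw [star_mul', ← neg_eq_of_add_eq_zero_right h1, neg_mul_neg, ← two_mul,
      ← map_ofNat (algebraMap F K) 2, ← Algebra.smul_def, smul_eq_zero] at h3
    exact IsNilpotent.eq_zero ⟨2, by rw [pow_two]; exact h3.resolve_left h2⟩

/-- A quadratic étale algebra has a basis `1, j` with `star j = -j` and `j² = δ ≠ 0`. -/
theorem IsQuadraticEtale.exists_basis (F K : Type u) [Field F] [CommRing K] [StarRing K]
    [Algebra F K] [IsQuadraticEtale F K] (h2 : (2 : F) ≠ 0) :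
    ∃ (b : Basis (Fin 2) F K) (δ : F), δ ≠ 0 ∧ b 0 = 1 ∧ star (b 1) = -b 1 ∧
      b 1 * b 1 = algebraMap F K δ := by
  have hK := IsQuadraticEtale.isStandardInvolution F K h2
  have := hK.nontrivial
  have := IsQuadraticEtale.isReduced F K
  have hfr : finrank F K = 2 := IsQuadraticEtale.finrank_eq_two
  have h1 := hK.finrank_traceZero h2
  obtain ⟨⟨j, hj⟩, hj0, -⟩ := finrank_eq_one_iff'.1 (show finrank F hK.traceZero = 1 by omega)
  have hj0' : j ≠ 0 := fun h => hj0 (Subtype.ext h)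
  rw [hK.mem_traceZero] at hj
  obtain ⟨δ, hδ⟩ := hK.exists_of_star_eq h2 (x := j * j) (by rw [star_mul', hj, neg_mul_neg])
  have hli : LinearIndependent F ![(1 : K), j] := by
    rw [LinearIndependent.pair_iff]
    intro s t hst
    have hst' := congrArg star hst
    rw [star_add, hK.star_smul, hK.star_smul, star_one, hj, star_zero] at hst'
    have hs : (2 * s) • (1 : K) = 0 := by
      rw [two_mul, add_smul]
      calc _ = (s • (1 : K) + t • j) + (s • 1 + t • -j) := by rw [smul_neg]; abel
        _ = 0 := by rw [hst, hst', add_zero]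
    rw [smul_eq_zero] at hs
    have hs0 : s = 0 := by
      have := hs.resolve_right one_ne_zero
      exact (mul_eq_zero.1 this).resolve_left h2
    rw [hs0, zero_smul, zero_add, smul_eq_zero] at hst
    exact ⟨hs0, hst.resolve_right hj0'⟩
  refine ⟨basisOfLinearIndependentOfCardEqFinrank hli (by simp [hfr]), δ, ?_, ?_, ?_, ?_⟩
  · rintro rfl
    exact hj0' (IsNilpotent.eq_zero ⟨2, by rw [pow_two, hδ, map_zero]⟩)
  · simp
  · simpa using hj
  · simpa using hδ

theorem IsQuadraticEtale.trace_eq (h2 : (2 : F) ≠ 0) (x : K) :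
    Algebra.trace F K x = (IsQuadraticEtale.isStandardInvolution F K h2).trace x := by
  have hK := IsQuadraticEtale.isStandardInvolution F K h2
  have hfr : finrank F K = 2 := IsQuadraticEtale.finrank_eq_two
  have hfin := hK.finite
  let e : K ≃ₐ[F] K := AlgEquiv.ofRingEquiv (f := starRingAut) hK.star_algebraMap
  have he : Algebra.trace F K (star x) = Algebra.trace F K x :=
    Algebra.trace_eq_of_algEquiv e x
  rw [eq_comm, hK.star_eq, map_sub, Algebra.trace_algebraMap, hfr] at he
  have h3 : (2 : F) * Algebra.trace F K x = 2 * hK.trace x := by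
    rw [two_mul]
    nth_rw 1 [he]
    simp
  exact mul_left_cancel₀ h2 h3

end QuadraticEtale

/-! ### Quaternion algebras -/

section Quaternion

open Module

variable {F : Type u} [Field F] {a b : F}

theorem quaternion_isStandardInvolution (h2 : (2 : F) ≠ 0) (ha : a ≠ 0) (hb : b ≠ 0) :
    IsStandardInvolution F ℍ[F,a,b] := by
  refine ⟨fun c => ?_, fun x => ⟨2 * x.re, ?_⟩, fun x hx => ?_, inferInstance, inferInstance⟩
  · ext <;> simp [QuaternionAlgebra.algebraMap_eq]
  · ext <;> simp [QuaternionAlgebra.algebraMap_eq, two_mul]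
  · have key : ∀ y, (x * y).re = 0 := fun y => by
      have := congrArg QuaternionAlgebra.re (hx y)
      simp only [QuaternionAlgebra.re_add, QuaternionAlgebra.re_star,
        QuaternionAlgebra.re_zero] at this
      rw [zero_mul, add_zero, ← two_mul] at this
      exact (mul_eq_zero.1 this).resolve_left h2
    have h0 := key 1
    have h1 := key ⟨0, 1, 0, 0⟩
    have h3 := key ⟨0, 0, 1, 0⟩
    have h4 := key ⟨0, 0, 0, 1⟩
    simp [ha, hb] at h0 h1 h3 h4
    ext <;> simp [*]

theorem quaternion_trace (hD : IsStandardInvolution F ℍ[F,a,b]) (x : ℍ[F,a,b]) :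
    hD.trace x = 2 * x.re := by
  rw [hD.trace_eq_iff]
  ext <;> simp [QuaternionAlgebra.algebraMap_eq, two_mul]

theorem quaternion_isNormBasis :
    IsNormBasis (QuaternionAlgebra.basisOneIJK a 0 b) ![1, -a, -b, a * b] := by
  intro x
  have : ∑ k, x k • QuaternionAlgebra.basisOneIJK a 0 b k = ⟨x 0, x 1, x 2, x 3⟩ := by
    rw [← Basis.equivFun_symm_apply, QuaternionAlgebra.basisOneIJK, Basis.equivFun_ofEquivFun]
    rfl
  rw [this]
  ext <;> simp [QuaternionAlgebra.algebraMap_eq, Fin.sum_univ_four] <;> ring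

end Quaternion

/-! ### Automorphisms of matrix algebras -/

section SkolemNoether

open Module

variable {F D : Type u} [Field F] [Ring D] [Algebra F D] {n : ℕ}

theorem isUnit_of_mul_right_cancel {A : Type*} [Ring A] [Algebra F A] [FiniteDimensional F A]
    {g : A} (hg : ∀ x, g * x = 0 → x = 0) : IsUnit g := by
  have hinj : Function.Injective (LinearMap.mulLeft F g) := by
    rw [← LinearMap.ker_eq_bot, LinearMap.ker_eq_bot']
    exact hg
  obtain ⟨x, hx⟩ := (LinearMap.injective_iff_surjective.1 hinj) 1
  have hx' : g * x = 1 := hx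
  refine ⟨⟨g, x, hx', ?_⟩, rfl⟩
  apply hinj
  simp [← mul_assoc, hx']

/-- An endomorphism `φ` of `Mₙ(D)` is inner if `Dⁿ` contains a vector `v` that behaves under `φ`
like the first vector of the standard basis: the matrix with columns `φ(Eᵢ₁) v` conjugates `x` into
`φ(x)`. -/
theorem exists_isUnit_mul_eq_mul [FiniteDimensional F D]
    (φ : Matrix (Fin n) (Fin n) D →+* Matrix (Fin n) (Fin n) D) (i₀ : Fin n) {v : Fin n → D}
    (hv : φ (Matrix.single i₀ i₀ 1) *ᵥ v = v)
    (hd : ∀ d : D, φ (Matrix.scalar (Fin n) d) *ᵥ v = fun i => v i * d)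
    (hv0 : ∀ d : D, (∀ i, v i * d = 0) → d = 0) :
    ∃ P : Matrix (Fin n) (Fin n) D, IsUnit P ∧ ∀ x, φ x * P = P * x := by
  let P : Matrix (Fin n) (Fin n) D := Matrix.of fun k i => (φ (Matrix.single i i₀ 1) *ᵥ v) k
  have hmulcol : ∀ (M N : Matrix (Fin n) (Fin n) D) (k : Fin n),
      (fun l => (M * N) l k) = M *ᵥ fun l => N l k := fun M N k => rfl
  have hscal : ∀ (M : Matrix (Fin n) (Fin n) D) (d : D),
      (M *ᵥ fun i => v i * d) = fun i => (M *ᵥ v) i * d := fun M d => by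
    funext i
    simp [Matrix.mulVec, dotProduct, Finset.sum_mul, mul_assoc]
  have hP : ∀ x, φ x * P = P * x := fun x => by
    ext k i
    have h1 : x * Matrix.single i i₀ 1 =
        ∑ l, Matrix.single l i₀ 1 * Matrix.scalar (Fin n) (x l i) := by
      ext a b
      rw [Matrix.sum_apply, Finset.sum_eq_single a]
      · by_cases hb : i₀ = b
        · subst hb
          simp
        · simp [hb, Ne.symm hb]
      · intro c _ hc
        simp [hc]
      · simp
    have h2 := congrArg (fun y => (φ y *ᵥ v) k) h1
    simp only [map_sum, map_mul, Matrix.sum_mulVec, Finset.sum_apply] at h2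
    have h3 : (φ x * P) k i = ((φ x * φ (Matrix.single i i₀ 1)) *ᵥ v) k := by
      rw [← Matrix.mulVec_mulVec]
      rfl
    rw [h3, h2, Matrix.mul_apply]
    refine Finset.sum_congr rfl fun l _ => ?_
    rw [← Matrix.mulVec_mulVec, hd, hscal]
    rfl
  refine ⟨P, isUnit_of_mul_right_cancel (F := F) fun X hX => ?_, hP⟩
  ext i j
  refine hv0 _ fun k => ?_
  have h1 : P * (Matrix.single i₀ i 1 * X) = 0 := by
    rw [← mul_assoc, ← hP, mul_assoc, hX, mul_zero]
  have h2 := congrFun (congrFun h1 k) j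
  rw [Matrix.mul_apply, Finset.sum_eq_single i₀] at h2
  · have h3 : P k i₀ = v k := congrFun hv k
    rw [h3] at h2
    simpa using h2
  · intro l _ hl
    simp [hl]
  · simp

end SkolemNoether

/-! ### Existence of an underlying hermitian form -/

section Existence

open Module

variable {F : Type u} [Field F]

section General

variable {D : Type u} [Ring D] [StarRing D] [Algebra F D] {n : ℕ}
  {σ : Matrix (Fin n) (Fin n) D →ₗ[F] Matrix (Fin n) (Fin n) D}

/-- The automorphism `x ↦ σ(x*)`, for an involution `σ`. -/
def starAut (hσ : IsInvolution F σ) : Matrix (Fin n) (Fin n) D →+* Matrix (Fin n) (Fin n) D where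
  toFun x := σ xᴴ
  map_mul' x y := by rw [Matrix.conjTranspose_mul, hσ.map_mul]
  map_one' := by
    rw [Matrix.conjTranspose_one]
    have h := hσ.map_mul 1 (σ 1)
    rw [one_mul, hσ.invol, one_mul] at h
    exact h.symm
  map_zero' := by rw [Matrix.conjTranspose_zero, map_zero]
  map_add' x y := by rw [Matrix.conjTranspose_add, map_add]

theorem starAut_injective (hσ : IsInvolution F σ) : Function.Injective (starAut hσ) := by
  intro x y hxy
  have := congrArg σ (show σ xᴴ = σ yᴴ from hxy)
  rw [hσ.invol, hσ.invol] at this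
  exact Matrix.conjTranspose_injective this

/-- If the automorphism `x ↦ σ(x*)` is conjugation by `P`, then `σ(x) = G⁻¹ x* G` for `G = P⁻¹`. -/
theorem exists_isUnit_mul_sigma (hσ : IsInvolution F σ) {P : Matrix (Fin n) (Fin n) D}
    (hPu : IsUnit P) (hP : ∀ x, starAut hσ x * P = P * x) :
    ∃ G : Matrix (Fin n) (Fin n) D, IsUnit G ∧ ∀ x, G * σ x = xᴴ * G := by
  obtain ⟨u, rfl⟩ := hPu
  refine ⟨u⁻¹.1, u⁻¹.isUnit, fun x => ?_⟩
  have h := hP xᴴ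
  have h' : σ x * u.1 = u.1 * xᴴ := by
    rw [← h]
    exact congrArg (fun y => σ y * u.1) (Matrix.conjTranspose_conjTranspose x).symm
  calc u⁻¹.1 * σ x = u⁻¹.1 * (σ x * u.1) * u⁻¹.1 := by simp [mul_assoc]
    _ = xᴴ * u⁻¹.1 := by rw [h', u.inv_mul_cancel_left]

theorem sigma_conjTranspose_mul (hσ : IsInvolution F σ) {G : Matrix (Fin n) (Fin n) D}
    (hG : ∀ x, G * σ x = xᴴ * G) (x : Matrix (Fin n) (Fin n) D) : G * x = (σ x)ᴴ * G := by
  rw [← hG, hσ.invol]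

/-- A matrix `G` with `G σ(x) = x* G` is hermitian up to a central factor. -/
theorem exists_conjTranspose_eq (hn : 0 < n) (hσ : IsInvolution F σ)
    {G : Matrix (Fin n) (Fin n) D} (hGu : IsUnit G) (hG : ∀ x, G * σ x = xᴴ * G) :
    ∃ l ∈ Subalgebra.center F D, Gᴴ = G * Matrix.scalar (Fin n) l := by
  have : Nonempty (Fin n) := ⟨⟨0, hn⟩⟩
  obtain ⟨u, rfl⟩ := hGu
  have hc : u⁻¹.1 * u.1ᴴ ∈ Subalgebra.center F (Matrix (Fin n) (Fin n) D) := by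
    rw [Subalgebra.mem_center_iff]
    intro x
    have h1 := congrArg Matrix.conjTranspose (hG x)
    rw [Matrix.conjTranspose_mul, Matrix.conjTranspose_mul,
      Matrix.conjTranspose_conjTranspose] at h1
    have h2 : (σ x)ᴴ = u.1 * x * u⁻¹.1 := by
      rw [sigma_conjTranspose_mul hσ hG, mul_assoc, u.mul_inv, mul_one]
    rw [h2] at h1
    calc x * (u⁻¹.1 * u.1ᴴ) = u⁻¹.1 * (u.1 * x * u⁻¹.1 * u.1ᴴ) := by simp [mul_assoc]
      _ = u⁻¹.1 * u.1ᴴ * x := by rw [h1, mul_assoc]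
  rw [Matrix.subalgebraCenter_eq_scalarAlgHom_map] at hc
  obtain ⟨l, hl, hl'⟩ := hc
  refine ⟨l, hl, ?_⟩
  have hl'' : Matrix.scalar (Fin n) l = u⁻¹.1 * u.1ᴴ := hl'
  rw [hl'', u.mul_inv_cancel_left]

theorem isUnderlyingForm_ofMatrix [FiniteDimensional F D] (hσ : IsInvolution F σ)
    {G : Matrix (Fin n) (Fin n) D} (hGu : IsUnit G) (hGh : Gᴴ = G) (hG : ∀ x, G * σ x = xᴴ * G) :
    IsUnderlyingForm F σ (HermitianForm.ofMatrix G hGh) := by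
  rw [isUnderlyingForm_iff, HermitianForm.gram_ofMatrix]
  exact ⟨hGu, sigma_conjTranspose_mul hσ hG⟩

/-- The hermitian forms to which a given involution is adjoint differ by scalar factors. -/
theorem IsUnderlyingForm.exists_gram_eq_smul (hD : IsStandardInvolution F D) (h2 : (2 : F) ≠ 0)
    (hn : 0 < n) {h h' : HermitianForm D n} (hh : IsUnderlyingForm F σ h)
    (hh' : IsUnderlyingForm F σ h') : ∃ c : F, c ≠ 0 ∧ h'.gram = c • h.gram := by
  have := hD.finite
  have := hD.nontrivial
  have : Nonempty (Fin n) := ⟨⟨0, hn⟩⟩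
  obtain ⟨⟨u, hu⟩, hM⟩ := isUnderlyingForm_iff.1 hh
  obtain ⟨⟨u', hu'⟩, hM'⟩ := isUnderlyingForm_iff.1 hh'
  have hc : u⁻¹.1 * u'.1 ∈ Subalgebra.center F (Matrix (Fin n) (Fin n) D) := by
    rw [Subalgebra.mem_center_iff]
    intro x
    have h1 := hh.gram_mul (σ := σ) x
    have h3 := hM x
    have h4 := hM' x
    rw [← hu] at h3
    rw [← hu'] at h4
    calc x * (u⁻¹.1 * u'.1) = u⁻¹.1 * (u.1 * x) * u⁻¹.1 * u'.1 := by simp [mul_assoc]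
      _ = u⁻¹.1 * ((σ x)ᴴ * u'.1) := by rw [h3]; simp [mul_assoc]
      _ = _ := by rw [← h4, mul_assoc]
  rw [Matrix.subalgebraCenter_eq_scalarAlgHom_map] at hc
  obtain ⟨l, hl, hl'⟩ := hc
  have hl'' : Matrix.scalar (Fin n) l = u⁻¹.1 * u'.1 := hl'
  have hcomm : ∀ y, y * l = l * y := Subalgebra.mem_center_iff.1 hl
  have hcs : ∀ X : Matrix (Fin n) (Fin n) D,
      Matrix.scalar (Fin n) l * X = X * Matrix.scalar (Fin n) l :=
    fun X => by
      ext i j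
      simp [hcomm]
  have hg : h'.gram = h.gram * Matrix.scalar (Fin n) l := by
    rw [hl'', ← hu, ← hu', u.mul_inv_cancel_left]
  have hstar : star l = l := by
    have h1 := h'.conjTranspose_gram
    rw [hg, Matrix.conjTranspose_mul, h.conjTranspose_gram, ← hcs, ← hu] at h1
    have h3 : (Matrix.scalar (Fin n) l)ᴴ = Matrix.scalar (Fin n) l := (Units.mul_left_inj u).1 h1
    have h4 : (Matrix.scalar (Fin n) l)ᴴ = Matrix.scalar (Fin n) (star l) := by
      simp [Matrix.diagonal_conjTranspose]
    rw [h4] at h3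
    exact Matrix.scalar_inj.1 h3
  obtain ⟨c, rfl⟩ := hD.exists_of_star_eq h2 hstar
  refine ⟨c, ?_, ?_⟩
  · rintro rfl
    rw [map_zero, map_zero, mul_zero, ← hu'] at hg
    exact u'.ne_zero hg
  · rw [hg]
    ext i j
    simp [Algebra.smul_def, Algebra.commutes]

theorem IsUnderlyingForm.smul (hD : IsStandardInvolution F D) {h h' : HermitianForm D n}
    (hh : IsUnderlyingForm F σ h) {c : F} (hc : c ≠ 0) (hg : h'.gram = c • h.gram) :
    IsUnderlyingForm F σ h' := by
  have := hD.finite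
  obtain ⟨hu, hM⟩ := isUnderlyingForm_iff.1 hh
  rw [isUnderlyingForm_iff, hg]
  refine ⟨?_, fun M => by rw [smul_mul_assoc, mul_smul_comm, hM]⟩
  rw [← Units.smul_mk0 hc]
  exact hu.smul _

theorem conjTranspose_smul_of_isStandardInvolution (hD : IsStandardInvolution F D) (c : F)
    (G : Matrix (Fin n) (Fin n) D) : (c • G)ᴴ = c • Gᴴ := by
  ext i j
  exact hD.star_smul _ _

/-- The trace forms of `σ` are the scalar multiples of any one of them. -/
theorem isTraceFormOf_iff (hD : IsStandardInvolution F D) (h2 : (2 : F) ≠ 0) (hn : 0 < n)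
    {q : QuadraticForm F (Fin n → D)} (hq : IsTraceFormOf F σ q)
    (q' : QuadraticForm F (Fin n → D)) :
    IsTraceFormOf F σ q' ↔ ∃ c : F, c ≠ 0 ∧ q' = c • q := by
  obtain ⟨h, hh, hq⟩ := hq
  constructor
  · rintro ⟨h', hh', hq'⟩
    obtain ⟨c, hc, hg⟩ := hh.exists_gram_eq_smul hD h2 hn hh'
    refine ⟨c, hc, ?_⟩
    ext x
    apply hD.algebraMap_injective
    rw [hq', smul_apply, smul_eq_mul, map_mul, hq, h'.toFun_eq, h.toFun_eq, hg,
      Matrix.smul_mulVec, dotProduct_smul, Algebra.smul_def]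
  · rintro ⟨c, hc, rfl⟩
    have hherm : (c • h.gram)ᴴ = c • h.gram := by
      rw [conjTranspose_smul_of_isStandardInvolution hD, h.conjTranspose_gram]
    refine ⟨HermitianForm.ofMatrix _ hherm,
      hh.smul hD hc (HermitianForm.gram_ofMatrix _ _), fun x => ?_⟩
    rw [smul_apply, smul_eq_mul, map_mul, hq, h.toFun_eq, HermitianForm.toFun_eq,
      HermitianForm.gram_ofMatrix, Matrix.smul_mulVec, dotProduct_smul, Algebra.smul_def]

end General

section UnitaryCase

variable {K : Type u} [CommRing K] [StarRing K] [Algebra F K] [IsQuadraticEtale F K] {n : ℕ}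
  {σ : Matrix (Fin n) (Fin n) K →ₗ[F] Matrix (Fin n) (Fin n) K}

/-- A unitary involution restricts to `star` on the center: if `j² ∈ F` for `j ∉ F`, an automorphism
of `K` over `F` other than the identity has to map `j` to `-j`. -/
theorem IsUnitary.map_smul_one (h2 : (2 : F) ≠ 0) (hn : 0 < n) (hσ : IsUnitary F σ) (c : K) :
    σ (c • 1) = star c • 1 := by
  have : Nonempty (Fin n) := ⟨⟨0, hn⟩⟩
  have hK := IsQuadraticEtale.isStandardInvolution F K h2
  have := hK.nontrivial
  have := IsQuadraticEtale.isReduced F K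
  obtain ⟨b, δ, hδ, hb0, hb1, hb2⟩ := IsQuadraticEtale.exists_basis F K h2
  obtain ⟨hinv, z, hz, hzσ⟩ := hσ
  have hcen : ∀ x : Matrix (Fin n) (Fin n) K,
      x ∈ Subalgebra.center F (Matrix (Fin n) (Fin n) K) ↔ ∃ c : K, x = c • 1 := by
    intro x
    rw [Matrix.subalgebraCenter_eq_scalarAlgHom_map]
    constructor
    · rintro ⟨c, -, rfl⟩
      exact ⟨c, (Matrix.smul_one_eq_diagonal c).symm⟩
    · rintro ⟨c, rfl⟩
      exact ⟨c, Subalgebra.mem_center_iff.2 fun y => mul_comm y c,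
        (Matrix.smul_one_eq_diagonal c).symm⟩
  have hinj : ∀ c d : K, c • (1 : Matrix (Fin n) (Fin n) K) = d • 1 → c = d := fun c d h => by
    have := congrFun (congrFun h ⟨0, hn⟩) ⟨0, hn⟩
    simpa [Matrix.smul_apply] using this
  have hone : σ 1 = 1 := by
    have h := hinv.map_mul 1 (σ 1)
    rw [one_mul, hinv.invol, one_mul] at h
    exact h.symm
  have hcenσ : ∀ x ∈ Subalgebra.center F (Matrix (Fin n) (Fin n) K),
      σ x ∈ Subalgebra.center F (Matrix (Fin n) (Fin n) K) := fun x hx => by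
    rw [Subalgebra.mem_center_iff] at hx ⊢
    intro y
    rw [← hinv.invol y, ← hinv.map_mul, ← hinv.map_mul, hx]
  have hF : ∀ c : F, σ (algebraMap F K c • 1) = algebraMap F K c • 1 := fun c => by
    rw [algebraMap_smul, map_smul, hone]
  obtain ⟨w, hw⟩ := (hcen _).1 (hcenσ (b 1 • 1) ((hcen _).2 ⟨_, rfl⟩))
  have hrep : ∀ c : K, ∃ s t : F, c = algebraMap F K s + t • b 1 := fun c =>
    ⟨b.repr c 0, b.repr c 1, by
      have := b.sum_repr c
      rw [Fin.sum_univ_two, hb0, ← Algebra.algebraMap_eq_smul_one] at this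
      exact this.symm⟩
  -- `w² = j²`, and `w = s + t j`
  have hw2 : w * w = algebraMap F K δ := by
    apply hinj
    rw [← hF δ, ← hb2, mul_smul, mul_smul]
    have h1 : (b 1 • b 1 • (1 : Matrix (Fin n) (Fin n) K)) = (b 1 • 1) * (b 1 • 1) := by simp
    have h3 : (w • w • (1 : Matrix (Fin n) (Fin n) K)) = (w • 1) * (w • 1) := by simp
    rw [h1, h3, hinv.map_mul, hw]
  have hj0 : b 1 ≠ 0 := b.ne_zero 1
  have hwj : w ≠ b 1 := by
    rintro rfl
    obtain ⟨c, rfl⟩ := (hcen z).1 hz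
    obtain ⟨s, t, rfl⟩ := hrep c
    refine hzσ ?_
    rw [add_smul, map_add, hF, smul_assoc, map_smul, hw]
  have hwneg : w = -b 1 := by
    obtain ⟨s, t, rfl⟩ := hrep w
    have h1 : (s * s + t * t * δ - δ) • (1 : K) + (2 * s * t) • b 1 = 0 := by
      have h3 : (algebraMap F K s + t • b 1) * (algebraMap F K s + t • b 1) =
          (s * s + t * t * δ) • (1 : K) + (2 * s * t) • b 1 := by
        simp only [Algebra.smul_def, map_add, map_mul, ← hb2, map_ofNat]
        ring
      rw [h3, Algebra.algebraMap_eq_smul_one] at hw2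
      rw [sub_smul, sub_add_eq_add_sub, hw2, sub_self]
    have hlin := Fintype.linearIndependent_iff.1 b.linearIndependent
      ![s * s + t * t * δ - δ, 2 * s * t] (by simpa [Fin.sum_univ_two, hb0] using h1)
    have h4 : s * s + t * t * δ - δ = 0 := hlin 0
    have h5 : 2 * s * t = 0 := hlin 1
    -- `t ≠ 0`, as otherwise `σ` maps both `s` and `j` to `s`
    have ht : t ≠ 0 := by
      rintro rfl
      rw [zero_smul, add_zero] at hw
      have h6 := congrArg σ hw
      rw [hinv.invol, hF] at h6
      have h7 := hinj _ _ h6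
      have h8 := hb1
      rw [h7, hK.star_algebraMap, ← h7, eq_neg_iff_add_eq_zero, ← two_smul F, smul_eq_zero] at h8
      exact hj0 (h8.resolve_left h2)
    have hs : s = 0 := by simpa [h2, ht] using h5
    subst hs
    have h9 : (t - 1) * (t + 1) = 0 := by
      have : ((t - 1) * (t + 1)) * δ = 0 := by linear_combination h4
      exact (mul_eq_zero.1 this).resolve_right hδ
    rcases mul_eq_zero.1 h9 with h | h
    · refine absurd ?_ hwj
      rw [sub_eq_zero.1 h]
      simp
    · rw [eq_neg_of_add_eq_zero_left h]
      simp
  obtain ⟨s, t, rfl⟩ := hrep c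
  rw [star_add, hK.star_algebraMap, hK.star_smul, hb1, ← hwneg, add_smul, map_add, hF, add_smul,
    smul_assoc, map_smul, hw, smul_assoc]

/-- An idempotent matrix that is not annihilated by a nonzero scalar fixes a vector with the same
property. If `K` is a field, any nonzero fixed vector does; if `K = F × F`, fixed vectors of the two
components are combined. -/
theorem exists_mulVec_eq_self (h2 : (2 : F) ≠ 0) {p : Matrix (Fin n) (Fin n) K}
    (hp : p * p = p) (hp0 : ∀ c : K, c • p = 0 → c = 0) :
    ∃ v : Fin n → K, p *ᵥ v = v ∧ ∀ d : K, (∀ i, v i * d = 0) → d = 0 := by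
  have hK := IsQuadraticEtale.isStandardInvolution F K h2
  have := hK.nontrivial
  have := IsQuadraticEtale.isReduced F K
  -- for every `c ≠ 0` there is a vector in the image of `p` not annihilated by `c`
  have hex : ∀ c : K, c ≠ 0 → ∃ u : Fin n → K, p *ᵥ u = u ∧ c • u ≠ 0 := by
    intro c hc
    by_contra hcon
    push Not at hcon
    refine hc (hp0 c (matrix_eq_zero_of_mulVec fun u => ?_))
    rw [Matrix.smul_mulVec]
    exact hcon _ (by rw [Matrix.mulVec_mulVec, hp])
  obtain ⟨u₀, hu₀, hu₀'⟩ := hex 1 one_ne_zero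
  rw [one_smul] at hu₀'
  by_cases hz : ∃ z : K, z ≠ 0 ∧ z • u₀ = 0
  · obtain ⟨z, hz0, hz⟩ := hz
    -- a scalar that annihilates a nonzero vector has norm zero
    have hunit : ∀ (w : K) (u : Fin n → K), u ≠ 0 → w • u = 0 → w * star w = 0 := by
      intro w u hu hw
      obtain ⟨c, hc⟩ := hK.exists_star_mul_self h2 w
      by_contra hcon
      have hc0 : c ≠ 0 := by
        rintro rfl
        exact hcon (by rw [mul_comm, hc, map_zero])
      obtain ⟨x, rfl⟩ := hK.isUnit_of_star_mul_self hc0 hc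
      have h := congrArg (x⁻¹.1 • ·) hw
      simp only [smul_smul, x.inv_mul, one_smul, smul_zero] at h
      exact hu h
    have hzz := hunit z u₀ hu₀' hz
    obtain ⟨t, ht⟩ := hK.exists_add_star z
    have hzt : z * z = t • z := by
      rw [Algebra.smul_def, ← ht, add_mul, mul_comm (star z), hzz, add_zero]
    have ht0 : t ≠ 0 := by
      rintro rfl
      rw [zero_smul] at hzt
      exact hz0 (IsNilpotent.eq_zero ⟨2, by rw [pow_two, hzt]⟩)
    -- the idempotent `e` with `e u₀ = 0`
    obtain ⟨e, he, hes, heu, he0⟩ : ∃ e : K, e * e = e ∧ star e = 1 - e ∧ e • u₀ = 0 ∧ e ≠ 0 := by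
      refine ⟨t⁻¹ • z, ?_, ?_, ?_, ?_⟩
      · rw [smul_mul_smul_comm, hzt, smul_smul, mul_assoc, inv_mul_cancel₀ ht0, mul_one]
      · rw [hK.star_smul, eq_sub_iff_add_eq, ← smul_add, add_comm, ht, Algebra.smul_def, ← map_mul,
          inv_mul_cancel₀ ht0, map_one]
      · rw [smul_assoc, hz, smul_zero]
      · rw [Ne, smul_eq_zero]
        exact fun h => h.elim (inv_ne_zero ht0) hz0
    -- a scalar that annihilates a nonzero vector of the component `e Kⁿ` annihilates `e`
    have hann : ∀ (e : K) (x : Fin n → K), e * e = e → star e = 1 - e → x ≠ 0 → e • x = x →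
        ∀ d : K, d • x = 0 → d * e = 0 := by
      intro e x he hes hx hex d hd
      have h1 : (d * e + (1 - e)) • x = 0 := by
        rw [add_smul, sub_smul, mul_smul, hex, hd, one_smul, sub_self, add_zero]
      have h3 := congrArg (· * e) (hunit _ x hx h1)
      simp only [star_add, star_sub, star_mul', star_one, hes, zero_mul] at h3
      linear_combination h3 - ((d * e + 1 - e) * (1 - star d) + d - 1) * he
    obtain ⟨u₁, hu₁, hu₁'⟩ := hex e he0
    refine ⟨u₀ + e • u₁, ?_, fun d hd => ?_⟩
    · rw [Matrix.mulVec_add, Matrix.mulVec_smul, hu₀, hu₁]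
    · have hd' : d • (u₀ + e • u₁) = 0 := by
        funext i
        rw [Pi.smul_apply, smul_eq_mul, mul_comm]
        exact hd i
      have h1 : d • u₀ = 0 := by
        have h3 := congrArg ((1 - e) • ·) hd'
        simp only [smul_zero] at h3
        rw [smul_comm, smul_add, smul_smul, sub_mul, one_mul, he, sub_self, zero_smul, add_zero,
          sub_smul, one_smul, heu, sub_zero] at h3
        exact h3
      have h4 : d • (e • u₁) = 0 := by
        rwa [smul_add, h1, zero_add] at hd'
      have h5 := hann e (e • u₁) he hes hu₁' (by rw [smul_smul, he]) d h4
      have h6 := hann (1 - e) u₀ (by linear_combination he) (by rw [star_sub, star_one, hes])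
        hu₀' (by rw [sub_smul, one_smul, heu, sub_zero]) d h1
      linear_combination h5 + h6
  · push Not at hz
    refine ⟨u₀, hu₀, fun d hd => ?_⟩
    by_contra hcon
    refine hz d hcon ?_
    funext i
    rw [Pi.smul_apply, smul_eq_mul, mul_comm]
    exact hd i

/-- Every unitary involution is adjoint to a hermitian form. The factor that makes `G` hermitian
exists by Hilbert's Theorem 90: one of `1 + l` and `j (1 - l)` is invertible if `l * star l = 1`. -/
theorem IsUnitary.exists_underlyingForm (h2 : (2 : F) ≠ 0) (hn : 0 < n) (hσ : IsUnitary F σ) :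
    ∃ h : HermitianForm K n, IsUnderlyingForm F σ h := by
  have : Nonempty (Fin n) := ⟨⟨0, hn⟩⟩
  have hK := IsQuadraticEtale.isStandardInvolution F K h2
  have := hK.finite
  have := hK.nontrivial
  let i₀ : Fin n := ⟨0, hn⟩
  let φ := starAut hσ.1
  have hφ : ∀ x, φ x = σ xᴴ := fun _ => rfl
  have hsm : ∀ (c : K) x, φ (c • x) = c • φ x := fun c x => by
    rw [hφ, hφ, Matrix.conjTranspose_smul, ← smul_one_mul, hσ.1.map_mul, hσ.map_smul_one h2 hn,
      star_star, mul_smul_comm, mul_one]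
  obtain ⟨v, hv, hv0⟩ := exists_mulVec_eq_self h2 (p := φ (Matrix.single i₀ i₀ 1))
    (by rw [← map_mul]; simp) (fun c hc => by
      rw [← hsm] at hc
      have h1 := starAut_injective hσ.1 (hc.trans (map_zero φ).symm)
      have := congrFun (congrFun h1 i₀) i₀
      simpa using this)
  obtain ⟨P, hPu, hP⟩ := exists_isUnit_mul_eq_mul (F := F) φ i₀ hv (fun d => by
    have : Matrix.scalar (Fin n) d = d • 1 := (Matrix.smul_one_eq_diagonal d).symm
    rw [this, hsm, map_one, Matrix.smul_mulVec, Matrix.one_mulVec]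
    funext i
    exact mul_comm _ _) hv0
  obtain ⟨G, hGu, hG⟩ := exists_isUnit_mul_sigma hσ.1 hPu hP
  obtain ⟨l, -, hl⟩ := exists_conjTranspose_eq hn hσ.1 hGu hG
  have hl' : Gᴴ = l • G := by
    rw [hl]
    ext i j
    simp [mul_comm]
  have hll : l * star l = 1 := by
    have h1 := congrArg Matrix.conjTranspose hl'
    rw [Matrix.conjTranspose_conjTranspose, Matrix.conjTranspose_smul, hl', smul_smul] at h1
    obtain ⟨u, rfl⟩ := hGu
    have h3 := congrArg (· * u⁻¹.1) h1
    simp only [smul_mul_assoc, u.mul_inv] at h3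
    have := congrFun (congrFun h3 i₀) i₀
    simp only [Matrix.one_apply_eq, Matrix.smul_apply, smul_eq_mul, mul_one] at this
    rw [mul_comm, ← this]
  -- since `l (star l) = 1`, the norms of `1 + l` and `j (1 - l)` are `2 + t` and `-δ (2 - t)`,
  -- where `t` is the trace of `l`; they do not both vanish
  have key : ∃ m : K, IsUnit m ∧ star m * l = m := by
    obtain ⟨b, δ, hδ, -, hb1, hb2⟩ := IsQuadraticEtale.exists_basis F K h2
    obtain ⟨t, ht⟩ := hK.exists_add_star l
    by_cases h : (2 : F) + t = 0
    · refine ⟨b 1 * (1 - l), ?_, ?_⟩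
      · refine hK.isUnit_of_star_mul_self (c := -δ * (2 - t)) ?_ ?_
        · refine mul_ne_zero (neg_ne_zero.2 hδ) fun h' => ?_
          have : (2 : F) * 2 = 0 := by linear_combination h + h'
          exact h2 (by simpa using this)
        · rw [star_mul', star_sub, star_one, hb1, map_mul, map_neg, map_sub, ← ht, ← hb2, map_ofNat]
          linear_combination (-b 1 * b 1) * hll
      · rw [star_mul', star_sub, star_one, hb1]
        linear_combination (b 1) * hll
    · refine ⟨1 + l, hK.isUnit_of_star_mul_self h ?_, ?_⟩
      · rw [star_add, star_one, map_add, ← ht, map_ofNat]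
        linear_combination hll
      · rw [star_add, star_one]
        linear_combination hll
  obtain ⟨m, ⟨m, rfl⟩, hm⟩ := key
  refine ⟨_, isUnderlyingForm_ofMatrix (G := m.1 • G) hσ.1 ?_ ?_ fun x => ?_⟩
  · exact hGu.smul m
  · rw [Matrix.conjTranspose_smul, hl', smul_smul, hm]
  · rw [smul_mul_assoc, hG, mul_smul_comm]

end UnitaryCase

end Existence

/-! ### Symplectic involutions -/

section SymplecticExistence

open Module MulOpposite

variable {F : Type u} [Field F]

theorem finrank_lt_finrank_of_injective {V W : Type*} [AddCommGroup V] [Module F V]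
    [AddCommGroup W] [Module F W] [FiniteDimensional F W] {f : V →ₗ[F] W}
    (hf : Function.Injective f) {S : Submodule F V} {T : Submodule F W} (hST : ∀ x ∈ S, f x ∈ T)
    {w : W} (hw : w ∈ T) (hwS : ∀ x ∈ S, f x ≠ w) : finrank F S < finrank F T := by
  rw [(Submodule.equivMapOfInjective f hf S).finrank_eq]
  refine Submodule.finrank_lt_finrank_of_lt
    (lt_of_le_of_ne (Submodule.map_le_iff_le_comap.2 hST) ?_)
  intro h
  rw [← h] at hw
  obtain ⟨x, hx, hxw⟩ := hw
  exact hwS x hx hxw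

/-- The linear map that changes the sign of the lower triangular part of a matrix, and multiplies
the diagonal by `t`. It exchanges symmetric and skew-symmetric matrices up to the diagonal. -/
def lowerTwist {D : Type*} [Ring D] [Algebra F D] (n : ℕ) (t : D) :
    Matrix (Fin n) (Fin n) D →ₗ[F] Matrix (Fin n) (Fin n) D where
  toFun x := Matrix.of fun i j => if i < j then x i j else if j < i then -x i j else x i j * t
  map_add' x y := by
    ext i j
    simp only [Matrix.of_apply, Matrix.add_apply]
    split_ifs
    · rfl
    · rw [neg_add]
    · rw [add_mul]
  map_smul' c x := by
    ext i j
    simp only [Matrix.of_apply, Matrix.smul_apply, RingHom.id_apply]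
    split_ifs
    · rfl
    · rw [smul_neg]
    · rw [smul_mul_assoc]

theorem lowerTwist_apply {D : Type*} [Ring D] [Algebra F D] {n : ℕ} (t : D)
    (x : Matrix (Fin n) (Fin n) D) (i j : Fin n) : lowerTwist (F := F) n t x i j =
      if i < j then x i j else if j < i then -x i j else x i j * t := rfl

theorem lowerTwist_injective {D : Type*} [Ring D] [Algebra F D] {n : ℕ} {t : D}
    (ht : ∀ x, x * t = 0 → x = 0) : Function.Injective (lowerTwist (F := F) n t) := by
  rw [← LinearMap.ker_eq_bot, LinearMap.ker_eq_bot']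
  intro x hx
  ext i j
  have h := congrFun (congrFun hx i) j
  rw [lowerTwist_apply] at h
  split_ifs at h
  · exact h
  · exact neg_eq_zero.1 h
  · exact ht _ h

theorem finrank_ker_sub_add_finrank_ker_add {V : Type*} [AddCommGroup V] [Module F V]
    [FiniteDimensional F V] (h2 : (2 : F) ≠ 0) {σ : V →ₗ[F] V} (hσ : ∀ x, σ (σ x) = x) :
    finrank F (LinearMap.ker (σ - LinearMap.id)) + finrank F (LinearMap.ker (σ + LinearMap.id)) =
      finrank F V := by
  have hdisj : LinearMap.ker (σ - LinearMap.id) ⊓ LinearMap.ker (σ + LinearMap.id) = ⊥ := by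
    rw [eq_bot_iff]
    rintro x ⟨h1, h3⟩
    have h1 : σ x - x = 0 := h1
    have h3 : σ x + x = 0 := h3
    have : (2 : F) • x = 0 := by
      rw [two_smul, show x + x = (σ x + x) - (σ x - x) by abel, h3, h1, sub_zero]
    exact (smul_eq_zero.1 this).resolve_left h2
  have htop : LinearMap.ker (σ - LinearMap.id) ⊔ LinearMap.ker (σ + LinearMap.id) = ⊤ := by
    rw [eq_top_iff]
    intro x _
    have : x = (2⁻¹ : F) • (x + σ x) + (2⁻¹ : F) • (x - σ x) := by
      rw [← smul_add, add_add_sub_cancel, ← two_smul F, smul_smul, inv_mul_cancel₀ h2, one_smul]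
    rw [this]
    refine Submodule.add_mem_sup ?_ ?_
    · simp [hσ, add_comm]
    · simp [hσ]
  have := Submodule.finrank_sup_add_finrank_inf_eq (LinearMap.ker (σ - LinearMap.id))
    (LinearMap.ker (σ + LinearMap.id))
  rw [hdisj, htop, finrank_bot, finrank_top, add_zero] at this
  exact this.symm

/-- A symplectic involution has fewer symmetric elements than skew-symmetric ones: after an
extension of scalars, they correspond to the skew-symmetric and to the symmetric matrices. -/
theorem IsSymplectic.finrank_lt {A : Type u} [Ring A] [Algebra F A] [FiniteDimensional F A]
    [Nontrivial A] (h2 : (2 : F) ≠ 0) {σ : A →ₗ[F] A} (hσ : IsSymplectic F σ) :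
    finrank F (LinearMap.ker (σ - LinearMap.id)) <
      finrank F (LinearMap.ker (σ + LinearMap.id)) := by
  obtain ⟨hinv, L, _, _, d, φ, g, hdet, hgT, hgd, hg⟩ := hσ
  have h2L : (2 : L) ≠ 0 := by
    rw [← map_ofNat (algebraMap F L) 2]
    simpa using h2
  set τ := σ.baseChange L with hτ
  have hττ : ∀ x, τ (τ x) = x := by
    intro x
    have : τ ∘ₗ τ = LinearMap.id := by
      rw [hτ, ← LinearMap.baseChange_comp, ← LinearMap.baseChange_id]
      congr 1
      ext x
      exact hinv.invol x
    exact LinearMap.congr_fun this x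
  have hle : ∀ (S : Submodule F A) (T : Submodule L (L ⊗[F] A)),
      (∀ x ∈ S, (1 : L) ⊗ₜ[F] x ∈ T) → finrank F S ≤ finrank L T := by
    intro S T hST
    rw [← finrank_span_map_of_isBaseChange (TensorProduct.isBaseChange F A L) S]
    refine Submodule.finrank_mono (Submodule.span_le.2 ?_)
    rintro _ ⟨x, hx, rfl⟩
    exact hST x hx
  have h1 := hle (LinearMap.ker (σ - LinearMap.id)) (LinearMap.ker (τ - LinearMap.id))
    fun x hx => by
      have hx : σ x - x = 0 := hx
      simp [hτ, sub_eq_zero.1 hx]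
  have h3 := hle (LinearMap.ker (σ + LinearMap.id)) (LinearMap.ker (τ + LinearMap.id))
    fun x hx => by
      have hx : σ x + x = 0 := hx
      simp [hτ, eq_neg_of_add_eq_zero_left hx, TensorProduct.tmul_neg]
  have h4 := finrank_ker_sub_add_finrank_ker_add h2 hinv.invol
  have h5 := finrank_ker_sub_add_finrank_ker_add h2L hττ
  rw [Module.finrank_baseChange, ← h4] at h5
  suffices h : finrank L (LinearMap.ker (τ - LinearMap.id)) <
      finrank L (LinearMap.ker (τ + LinearMap.id)) by omega
  -- `x ↦ g φ(x)` turns `τ` into `y ↦ -yᵀ`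
  have hgu : IsUnit g := (Matrix.isUnit_iff_isUnit_det g).2 (isUnit_iff_ne_zero.2 hdet)
  have hgτ : ∀ x, g * φ (τ x) = -(g * φ x)ᵀ := fun x => by
    rw [Matrix.transpose_mul, hgT, mul_neg, neg_neg]
    have := congrArg Matrix.transpose (hg x)
    rw [Matrix.transpose_mul, Matrix.transpose_mul, Matrix.transpose_transpose, hgT, mul_neg,
      neg_mul, neg_inj] at this
    exact this.symm
  obtain ⟨g, rfl⟩ := hgu
  let ψ : L ⊗[F] A →ₗ[L] Matrix (Fin d) (Fin d) L := LinearMap.mulLeft L g.1 ∘ₗ φ.toLinearMap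
  let ψ' : Matrix (Fin d) (Fin d) L →ₗ[L] L ⊗[F] A :=
    φ.symm.toLinearMap ∘ₗ LinearMap.mulLeft L g⁻¹.1
  have hψ : ∀ x, ψ x = g.1 * φ x := fun x => rfl
  have hψψ' : ∀ y, ψ (ψ' y) = y := fun y => by
    change g.1 * φ (φ.symm (g⁻¹.1 * y)) = y
    rw [φ.apply_symm_apply, g.mul_inv_cancel_left]
  have hψ'ψ : ∀ x, ψ' (ψ x) = x := fun x => by
    change φ.symm (g⁻¹.1 * (g.1 * φ x)) = x
    rw [g.inv_mul_cancel_left, φ.symm_apply_apply]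
  have hψinj : Function.Injective ψ := Function.LeftInverse.injective (g := ψ') hψ'ψ
  have hψ'inj : Function.Injective ψ' := Function.LeftInverse.injective (g := ψ) hψψ'
  have hτψ : ∀ y, τ (ψ' y) = ψ' (-yᵀ) := fun y => by
    rw [← hψ'ψ (τ (ψ' y)), hψ, hgτ, ← hψ, hψψ']
  have hd : Nonempty (Fin d) := by
    by_contra hd
    rw [not_nonempty_iff] at hd
    have h6 : (1 : L ⊗[F] A) = 0 := φ.injective (Subsingleton.elim _ _)
    exact one_ne_zero h6
  refine finrank_lt_finrank_of_injective (f := ψ' ∘ₗ lowerTwist d (1 : L) ∘ₗ ψ)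
    (w := ψ' 1) ?_ ?_ ?_ ?_
  · exact hψ'inj.comp ((lowerTwist_injective (F := L) (t := (1 : L)) (by simp)).comp hψinj)
  · intro x hx
    have hx : τ x - x = 0 := hx
    have hx' : ψ x = -(ψ x)ᵀ := by
      rw [hψ, ← hgτ, sub_eq_zero.1 hx]
    suffices h : lowerTwist (F := L) d 1 (ψ x) = (lowerTwist (F := L) d 1 (ψ x))ᵀ by
      change τ (ψ' (lowerTwist (F := L) d 1 (ψ x))) + ψ' (lowerTwist (F := L) d 1 (ψ x)) = 0
      rw [hτψ, ← h, ← map_add, neg_add_cancel, map_zero]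
    ext i j
    have h6 : ∀ i j, ψ x i j = -ψ x j i := fun i j => congrFun (congrFun hx' i) j
    rw [Matrix.transpose_apply, lowerTwist_apply, lowerTwist_apply]
    rcases lt_trichotomy i j with h | rfl | h
    · simp [h, h.not_gt, h6 i j]
    · rfl
    · simp [h, h.not_gt, h6 i j]
  · change τ (ψ' 1) + ψ' 1 = 0
    rw [hτψ, ← map_add, Matrix.transpose_one, neg_add_cancel, map_zero]
  · intro x hx heq
    have hx : τ x - x = 0 := hx
    have hx' : ψ x = -(ψ x)ᵀ := by
      rw [hψ, ← hgτ, sub_eq_zero.1 hx]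
    have h6 := congrFun (congrFun (hψ'inj heq) hd.some) hd.some
    have h7 : ψ x hd.some hd.some = -ψ x hd.some hd.some := congrFun (congrFun hx' _) _
    rw [LinearMap.comp_apply, lowerTwist_apply] at h6
    simp only [lt_irrefl, if_false, mul_one, Matrix.one_apply_eq] at h6
    rw [h6, eq_neg_iff_add_eq_zero, one_add_one_eq_two] at h7
    exact h2L h7

section Casimir

variable {a b : F}

/-- The basis dual to `1, i, j, k` for the reduced trace. -/
def dualBasis (a b : F) : Fin 4 → ℍ[F,a,b] :=
  ![⟨2⁻¹, 0, 0, 0⟩, ⟨0, (2 * a)⁻¹, 0, 0⟩, ⟨0, 0, (2 * b)⁻¹, 0⟩, ⟨0, 0, 0, -(2 * a * b)⁻¹⟩]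

/-- The standard basis `1, i, j, k`. -/
def stdBasis (a b : F) : Fin 4 → ℍ[F,a,b] :=
  ![⟨1, 0, 0, 0⟩, ⟨0, 1, 0, 0⟩, ⟨0, 0, 1, 0⟩, ⟨0, 0, 0, 1⟩]

theorem sum_re_mul_dualBasis (h2 : (2 : F) ≠ 0) (ha : a ≠ 0) (hb : b ≠ 0) (x : ℍ[F,a,b]) :
    ∑ l, (2 * (x * dualBasis a b l).re) • stdBasis a b l = x := by
  simp only [Fin.sum_univ_four, dualBasis, stdBasis]
  ext <;> simp <;> field_simp

theorem sum_re_stdBasis_mul (h2 : (2 : F) ≠ 0) (ha : a ≠ 0) (hb : b ≠ 0) (x : ℍ[F,a,b]) :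
    ∑ l, (2 * (stdBasis a b l * x).re) • dualBasis a b l = x := by
  simp only [Fin.sum_univ_four, dualBasis, stdBasis]
  ext <;> simp <;> field_simp

theorem sum_stdBasis_mul_dualBasis (h2 : (2 : F) ≠ 0) (ha : a ≠ 0) (hb : b ≠ 0) (x : ℍ[F,a,b]) :
    ∑ l, stdBasis a b l * x * dualBasis a b l = algebraMap F _ (2 * x.re) := by
  rw [QuaternionAlgebra.algebraMap_eq]
  simp only [Fin.sum_univ_four, dualBasis, stdBasis]
  ext <;> simp <;> field_simp <;> ring

/-- If the quaternion algebra acts from the left and from the right on a module, some nonzero vector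
intertwines the two actions, because `∑ eₖ ⊗ eₖ'` is a Casimir element. -/
theorem exists_intertwiner (h2 : (2 : F) ≠ 0) (ha : a ≠ 0) (hb : b ≠ 0) {n : ℕ}
    (f : ℍ[F,a,b] →ₐ[F] Matrix (Fin n) (Fin n) ℍ[F,a,b]) {p : Matrix (Fin n) (Fin n) ℍ[F,a,b]}
    (hp : ∀ d, p * f d = f d * p) (hpp : p * p = p) (hp0 : p ≠ 0) :
    ∃ v : Fin n → ℍ[F,a,b], p *ᵥ v = v ∧ (∀ d, f d *ᵥ v = op d • v) ∧
      ∀ d : ℍ[F,a,b], op d • v = 0 → d = 0 := by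
  obtain ⟨w, hw⟩ : ∃ w, p *ᵥ w ≠ 0 := by
    by_contra hcon
    push Not at hcon
    exact hp0 (matrix_eq_zero_of_mulVec hcon)
  set u := p *ᵥ w with hu
  have hpu : p *ᵥ u = u := by rw [hu, Matrix.mulVec_mulVec, hpp]
  -- the average over a pair of dual bases intertwines the two actions
  let avg : (Fin n → ℍ[F,a,b]) → (Fin n → ℍ[F,a,b]) := fun u =>
    ∑ k, f (stdBasis a b k) *ᵥ (op (dualBasis a b k) • u)
  have hsmul : ∀ (c : F) (x : ℍ[F,a,b]) (u : Fin n → ℍ[F,a,b]), op (c • x) • u = c • (op x • u) :=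
    fun c x u => by rw [op_smul, smul_assoc]
  have havg : ∀ d u, f d *ᵥ avg u = op d • avg u := by
    intro d u
    simp only [avg, Matrix.mulVec_sum, Finset.smul_sum, Matrix.mulVec_mulVec, ← map_mul]
    have h1 : ∀ k, f (d * stdBasis a b k) *ᵥ (op (dualBasis a b k) • u) =
        ∑ l, (2 * (d * stdBasis a b k * dualBasis a b l).re) •
          (f (stdBasis a b l) *ᵥ (op (dualBasis a b k) • u)) := fun k => by
      conv_lhs => rw [← sum_re_mul_dualBasis h2 ha hb (d * stdBasis a b k)]
      simp only [map_sum, map_smul, Matrix.sum_mulVec, Matrix.smul_mulVec]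
    have h3 : ∀ l, op d • (f (stdBasis a b l) *ᵥ (op (dualBasis a b l) • u)) =
        ∑ k, (2 * (d * stdBasis a b k * dualBasis a b l).re) •
          (f (stdBasis a b l) *ᵥ (op (dualBasis a b k) • u)) := fun l => by
      rw [← Matrix.mulVec_smul, smul_smul, ← op_mul]
      conv_lhs => rw [← sum_re_stdBasis_mul h2 ha hb (dualBasis a b l * d)]
      have h4 : ∀ k, (d * stdBasis a b k * dualBasis a b l).re =
          (stdBasis a b k * (dualBasis a b l * d)).re := fun k => by
        simp only [mul_assoc, QuaternionAlgebra.re_mul, QuaternionAlgebra.imI_mul,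
          QuaternionAlgebra.imJ_mul, QuaternionAlgebra.imK_mul]
        ring
      simp only [Finset.op_sum, Finset.sum_smul, Matrix.mulVec_sum, hsmul, Matrix.mulVec_smul, h4]
    simp only [h1, h3]
    exact Finset.sum_comm
  -- it does not vanish on all multiples of `u`, as `u` can be recovered from these values
  have hsum : ∑ l, op (dualBasis a b l) • avg (op (stdBasis a b l) • u) = u := by
    simp only [avg, Finset.smul_sum]
    rw [Finset.sum_comm]
    have h1 : ∀ k, ∑ l, op (dualBasis a b l) • (f (stdBasis a b k) *ᵥ
        (op (dualBasis a b k) • op (stdBasis a b l) • u)) =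
        (2 * (dualBasis a b k).re) • (f (stdBasis a b k) *ᵥ u) := fun k => by
      simp only [← Matrix.mulVec_smul, ← Matrix.mulVec_sum, smul_smul, ← op_mul, ← Finset.sum_smul,
        ← Finset.op_sum]
      rw [sum_stdBasis_mul_dualBasis h2 ha hb, Algebra.algebraMap_eq_smul_one, hsmul, op_one,
        one_smul]
    simp only [h1]
    rw [Finset.sum_eq_single 0]
    · have : stdBasis a b 0 = 1 := rfl
      rw [this, map_one, Matrix.one_mulVec]
      simp [dualBasis, h2]
    · intro k _ hk
      fin_cases k <;> simp_all [dualBasis]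
    · simp
  obtain ⟨l, hl⟩ : ∃ l, avg (op (stdBasis a b l) • u) ≠ 0 := by
    by_contra hcon
    push Not at hcon
    refine hw ?_
    rw [← hsum]
    simp [hcon]
  refine ⟨avg (op (stdBasis a b l) • u), ?_, fun d => havg d _, ?_⟩
  · simp only [avg, Matrix.mulVec_sum]
    refine Finset.sum_congr rfl fun k _ => ?_
    rw [Matrix.mulVec_mulVec, hp, ← Matrix.mulVec_mulVec, Matrix.mulVec_smul p,
      Matrix.mulVec_smul p, hpu]
  · intro d hd
    set v := avg (op (stdBasis a b l) • u)
    -- the annihilator of `v` is a two-sided ideal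
    have h1 : ∀ c, op (c * d) • v = 0 := fun c => by
      rw [op_mul, mul_smul, ← havg, ← Matrix.mulVec_smul, hd, Matrix.mulVec_zero]
    have h3 : ∀ e : ℍ[F,a,b], op e • v = 0 → (∀ c, op (c * e) • v = 0) → 2 * e.re = 0 := by
      intro e he hce
      have h4 := sum_stdBasis_mul_dualBasis h2 ha hb e
      have h5 : op (∑ l, stdBasis a b l * e * dualBasis a b l) • v = 0 := by
        rw [Finset.op_sum, Finset.sum_smul]
        refine Finset.sum_eq_zero fun k _ => ?_
        rw [op_mul, mul_smul, hce, smul_zero]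
      rw [h4, Algebra.algebraMap_eq_smul_one, hsmul, op_one, one_smul] at h5
      exact (smul_eq_zero.1 h5).resolve_right hl
    rw [← sum_re_mul_dualBasis h2 ha hb d]
    refine Finset.sum_eq_zero fun k _ => ?_
    rw [h3 (d * dualBasis a b k), zero_smul]
    · rw [op_mul, mul_smul, hd, smul_zero]
    · intro c
      rw [← mul_assoc, op_mul, mul_smul, h1, smul_zero]

end Casimir

/-- Every symplectic involution of `Mₘ(H)` is adjoint to a hermitian form. A matrix `G` with
`G σ(x) = x* G` is hermitian or skew-hermitian. If it is skew-hermitian, multiplication by `G` turns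
skew-symmetric elements into hermitian matrices, and `lowerTwist` embeds these into the
skew-hermitian matrices, contradicting `IsSymplectic.finrank_lt`. -/
theorem IsSymplectic.exists_underlyingForm {a b : F} (h2 : (2 : F) ≠ 0) (ha : a ≠ 0) (hb : b ≠ 0)
    {n : ℕ} (hn : 0 < n) {σ : Matrix (Fin n) (Fin n) ℍ[F,a,b] →ₗ[F] Matrix (Fin n) (Fin n) ℍ[F,a,b]}
    (hσ : IsSymplectic F σ) : ∃ h : HermitianForm ℍ[F,a,b] n, IsUnderlyingForm F σ h := by
  have : Nonempty (Fin n) := ⟨⟨0, hn⟩⟩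
  have hD := quaternion_isStandardInvolution h2 ha hb
  have := hD.finite
  have := hD.nontrivial
  let i₀ : Fin n := ⟨0, hn⟩
  let φ := starAut hσ.1
  have hφ : ∀ x, φ x = σ xᴴ := fun _ => rfl
  have hφc : ∀ (c : F) x, φ (c • x) = c • φ x := fun c x => by
    rw [hφ, hφ, conjTranspose_smul_of_isStandardInvolution hD, map_smul]
  let f : ℍ[F,a,b] →ₐ[F] Matrix (Fin n) (Fin n) ℍ[F,a,b] :=
    { toRingHom := φ.comp (Matrix.scalar (Fin n))
      commutes' := fun c => by
        change φ (Matrix.scalar (Fin n) (algebraMap F _ c)) = _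
        have : Matrix.scalar (Fin n) (algebraMap F ℍ[F,a,b] c) = c • 1 := by
          rw [Algebra.algebraMap_eq_smul_one]
          ext1 i j
          by_cases hij : i = j
          · simp [hij]
          · simp [hij]
        rw [this, hφc, map_one, Algebra.algebraMap_eq_smul_one] }
  have hfd : ∀ d, f d = φ (Matrix.scalar (Fin n) d) := fun d => rfl
  obtain ⟨v, hv, hvd, hv0⟩ := exists_intertwiner h2 ha hb f
    (p := φ (Matrix.single i₀ i₀ 1)) (fun d => by
      rw [hfd, ← map_mul, ← map_mul]
      congr 1
      ext1 i j
      simp [Matrix.single_apply])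
    (by rw [← map_mul]; simp) (fun hc => by
      have h1 := starAut_injective hσ.1 (hc.trans (map_zero φ).symm)
      have := congrFun (congrFun h1 i₀) i₀
      simp at this)
  obtain ⟨P, hPu, hP⟩ := exists_isUnit_mul_eq_mul (F := F) φ i₀ hv
    (fun d => hvd d) (fun d hd => hv0 d (funext hd))
  obtain ⟨G, hGu, hG⟩ := exists_isUnit_mul_sigma hσ.1 hPu hP
  obtain ⟨l, hl, hGl⟩ := exists_conjTranspose_eq hn hσ.1 hGu hG
  rw [hD.center_eq_bot h2 (by rw [QuaternionAlgebra.finrank_eq_four]; norm_num)] at hl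
  obtain ⟨c, rfl⟩ := Algebra.mem_bot.1 hl
  have hGc : Gᴴ = c • G := by
    rw [hGl]
    ext1 i j
    rw [Matrix.scalar_apply, Matrix.mul_diagonal, Matrix.smul_apply, Algebra.smul_def,
      Algebra.commutes]
  have hcc : (c - 1) * (c + 1) = 0 := by
    have h1 := congrArg Matrix.conjTranspose hGc
    rw [Matrix.conjTranspose_conjTranspose, conjTranspose_smul_of_isStandardInvolution hD, hGc,
      smul_smul] at h1
    have h3 : (c * c - 1) • G = 0 := by rw [sub_smul, one_smul, ← h1, sub_self]
    have h4 := (smul_eq_zero.1 h3).resolve_right hGu.ne_zero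
    linear_combination h4
  rcases mul_eq_zero.1 hcc with h | h
  · rw [sub_eq_zero.1 h, one_smul] at hGc
    exact ⟨_, isUnderlyingForm_ofMatrix hσ.1 hGu hGc hG⟩
  · exfalso
    rw [eq_neg_of_add_eq_zero_left h, neg_smul, one_smul] at hGc
    refine (hσ.finrank_lt h2).not_gt ?_
    obtain ⟨g, rfl⟩ := hGu
    have hgσ : ∀ x, g.1 * σ x = -(g.1 * x)ᴴ := fun x => by
      rw [hG, Matrix.conjTranspose_mul, hGc, mul_neg, neg_neg]
    let ψ := LinearMap.mulLeft F g.1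
    let ψ' := LinearMap.mulLeft F g⁻¹.1
    have hψ : ∀ x, ψ x = g.1 * x := fun x => rfl
    have hψψ' : ∀ y, ψ (ψ' y) = y := fun y => g.mul_inv_cancel_left y
    have hψ'ψ : ∀ y, ψ' (ψ y) = y := fun y => g.inv_mul_cancel_left y
    have hψinj : Function.Injective ψ := Function.LeftInverse.injective (g := ψ') hψ'ψ
    have hψ'inj : Function.Injective ψ' := Function.LeftInverse.injective (g := ψ) hψψ'
    have hσψ : ∀ y, σ (ψ' y) = ψ' (-yᴴ) := fun y => by
      rw [← hψ'ψ (σ (ψ' y)), hψ, hgσ, ← hψ, hψψ']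
    refine finrank_lt_finrank_of_injective
      (f := ψ' ∘ₗ lowerTwist n (⟨0, 1, 0, 0⟩ : ℍ[F,a,b]) ∘ₗ ψ)
      (w := ψ' (Matrix.scalar (Fin n) ⟨0, 0, 1, 0⟩)) ?_ ?_ ?_ ?_
    · refine hψ'inj.comp
        ((lowerTwist_injective (F := F) (t := (⟨0, 1, 0, 0⟩ : ℍ[F,a,b])) fun x hx => ?_).comp hψinj)
      rw [QuaternionAlgebra.ext_iff] at hx ⊢
      simpa [ha, and_comm, and_assoc, and_left_comm] using hx
    · intro x hx
      have hx : σ x + x = 0 := hx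
      have hx' : (ψ x)ᴴ = ψ x := by
        have := hgσ x
        rw [eq_neg_of_add_eq_zero_left hx, mul_neg, neg_inj] at this
        exact this.symm
      change σ (ψ' _) - ψ' _ = 0
      rw [hσψ, ← map_sub, LinearMap.comp_apply, sub_eq_zero.2, map_zero]
      ext1 i j
      have h6 : ∀ i j, star (ψ x j i) = ψ x i j := fun i j => congrFun (congrFun hx' i) j
      rw [Matrix.neg_apply, Matrix.conjTranspose_apply, lowerTwist_apply, lowerTwist_apply]
      rcases lt_trichotomy i j with h | rfl | h
      · simp [h, h.not_gt, h6 i j]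
      · obtain ⟨e, he⟩ := hD.exists_of_star_eq h2 (h6 i i)
        simp only [lt_irrefl, if_false, he, star_mul, hD.star_algebraMap]
        ext <;> simp
      · simp [h, h.not_gt, h6 i j]
    · change σ (ψ' _) - ψ' _ = 0
      rw [hσψ, ← map_sub, sub_eq_zero.2, map_zero]
      ext1 i j
      rw [Matrix.neg_apply, Matrix.conjTranspose_apply]
      by_cases hij : i = j
      · subst hij
        simp only [Matrix.scalar_apply, Matrix.diagonal_apply_eq]
        ext <;> simp
      · simp [Matrix.diagonal_apply_ne _ hij, Matrix.diagonal_apply_ne _ (Ne.symm hij)]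
    · intro x hx heq
      have hx : σ x + x = 0 := hx
      have hx' : (ψ x)ᴴ = ψ x := by
        have := hgσ x
        rw [eq_neg_of_add_eq_zero_left hx, mul_neg, neg_inj] at this
        exact this.symm
      have h6 := congrFun (congrFun (hψ'inj heq) i₀) i₀
      have h7 : star (ψ x i₀ i₀) = ψ x i₀ i₀ := congrFun (congrFun hx' _) _
      obtain ⟨e, he⟩ := hD.exists_of_star_eq h2 h7
      rw [LinearMap.comp_apply, lowerTwist_apply, he] at h6
      have := congrArg QuaternionAlgebra.imJ h6
      simp at this

end SymplecticExistence

/-! ### Centralizers of semilinear maps -/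

section SemilinearCentralizer

open Module

theorem hasBrauerClass_of_algEquiv_matrix {F : Type u} [Field F] {A : Type u} [Ring A] [Algebra F A]
    (B : CSA.{u, u} F) {ι : Type*} [Fintype ι] [DecidableEq ι] [Nonempty ι]
    (e : A ≃ₐ[F] Matrix ι ι B) : HasBrauerClass F A (Quotient.mk (Brauer.CSA_Setoid F) B) := by
  let k := Fintype.card ι
  have hk : k ≠ 0 := Fintype.card_ne_zero
  have : Nonempty (Fin k) := Fin.pos_iff_nonempty.1 (Nat.pos_of_ne_zero hk)
  let C : CSA.{u, u} F := { AlgCat.of F (Matrix (Fin k) (Fin k) B) with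
    isCentral := inferInstanceAs (Algebra.IsCentral F (Matrix (Fin k) (Fin k) B))
    isSimple := inferInstanceAs (IsSimpleRing (Matrix (Fin k) (Fin k) B))
    fin_dim := inferInstanceAs (FiniteDimensional F (Matrix (Fin k) (Fin k) B)) }
  refine ⟨C, ⟨e.trans (Matrix.reindexAlgEquiv F B (Fintype.equivFin ι))⟩, Quotient.sound ?_⟩
  exact ⟨1, k, one_ne_zero, hk,
    ⟨(Matrix.compAlgEquiv (Fin 1) (Fin k) B F).trans
      (Matrix.reindexAlgEquiv F B (Equiv.uniqueProd (Fin k) (Fin 1)))⟩⟩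

theorem nonempty_subalgebra_algEquiv {F A A' : Type*} [Field F] [Semiring A] [Algebra F A]
    [Semiring A'] [Algebra F A'] (e : A ≃ₐ[F] A') {S : Subalgebra F A} {S' : Subalgebra F A'}
    (h : ∀ x, e x ∈ S' ↔ x ∈ S) : Nonempty (S ≃ₐ[F] S') := by
  refine ⟨(e.subalgebraMap S).trans (Subalgebra.equivOfEq _ _ ?_)⟩
  ext y
  constructor
  · rintro ⟨x, hx, rfl⟩
    exact (h x).2 hx
  · intro hy
    exact ⟨e.symm y, (h _).1 (by rwa [e.apply_symm_apply]), e.apply_symm_apply y⟩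

variable (F : Type u) {K : Type u} [Field F] [CommRing K] [StarRing K] [Algebra F K]

/-- Entrywise conjugation of matrices. -/
def conj {κ : Type*} [Fintype κ] [DecidableEq κ] : Matrix κ κ K →+* Matrix κ κ K :=
  (starRingEnd K).mapMatrix

theorem conj_apply {κ : Type*} [Fintype κ] [DecidableEq κ] (X : Matrix κ κ K) (i j : κ) :
    conj X i j = star (X i j) := rfl

theorem conj_fromBlocks {ι : Type*} [Fintype ι] [DecidableEq ι] (A B C D : Matrix ι ι K) :
    conj (Matrix.fromBlocks A B C D) = Matrix.fromBlocks (conj A) (conj B) (conj C) (conj D) :=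
  Matrix.fromBlocks_map ..

theorem conj_conj {κ : Type*} [Fintype κ] [DecidableEq κ] (X : Matrix κ κ K) :
    conj (conj X) = X := by
  ext i j
  exact star_star _

variable [IsQuadraticEtale F K]

theorem conj_smul {F} [Field F] [Algebra F K] [IsQuadraticEtale F K] {κ : Type*} [Fintype κ]
    [DecidableEq κ] (c : F) (X : Matrix κ κ K) :
    conj (c • X) = c • conj X := by
  ext i j
  rw [conj_apply, Matrix.smul_apply, Matrix.smul_apply, conj_apply, Algebra.smul_def, star_mul',
    IsQuadraticEtale.star_algebraMap, Algebra.smul_def]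

theorem conj_algebraMap {κ : Type*} [Fintype κ] [DecidableEq κ] (c : F) :
    conj (algebraMap F (Matrix κ κ K) c) = algebraMap F (Matrix κ κ K) c := by
  rw [Algebra.algebraMap_eq_smul_one, conj_smul, map_one]

/-- The matrices that commute with the semilinear map `v ↦ J (star v)`. -/
def semilinearCentralizer {κ : Type*} [Fintype κ] [DecidableEq κ] (J : Matrix κ κ K) :
    Subalgebra F (Matrix κ κ K) where
  carrier := {X | X * J = J * conj X}
  mul_mem' {X Y} hX hY := by
    have hX : X * J = J * conj X := hX
    have hY : Y * J = J * conj Y := hY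
    change X * Y * J = J * conj (X * Y)
    rw [mul_assoc, hY, ← mul_assoc, hX, mul_assoc, map_mul]
  add_mem' {X Y} hX hY := by
    have hX : X * J = J * conj X := hX
    have hY : Y * J = J * conj Y := hY
    change (X + Y) * J = J * conj (X + Y)
    rw [add_mul, hX, hY, map_add, mul_add]
  algebraMap_mem' c := by
    change _ * J = J * conj _
    rw [conj_algebraMap]
    exact Algebra.commutes c J

theorem mem_semilinearCentralizer {κ : Type*} [Fintype κ] [DecidableEq κ] {J X : Matrix κ κ K} :
    X ∈ semilinearCentralizer F J ↔ X * J = J * conj X := Iff.rfl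

variable {F}

/-- A change of basis by `Q` transforms the matrix of a semilinear map into `Q⁻¹ J (star Q)`. -/
theorem semilinearCentralizer_conj {κ : Type*} [Fintype κ] [DecidableEq κ] {J J' Q : Matrix κ κ K}
    (hQ : IsUnit Q) (h : J * conj Q = Q * J') :
    Nonempty (semilinearCentralizer F J ≃ₐ[F] semilinearCentralizer F J') := by
  obtain ⟨u, rfl⟩ := hQ
  let e : Matrix κ κ K ≃ₐ[F] Matrix κ κ K :=
    { toFun := fun X => u⁻¹.1 * X * u.1
      invFun := fun X => u.1 * X * u⁻¹.1
      left_inv := fun X => by simp [mul_assoc]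
      right_inv := fun X => by simp [mul_assoc]
      map_mul' := fun X Y => by simp [mul_assoc]
      map_add' := fun X Y => by rw [mul_add, add_mul]
      commutes' := fun c => by
        rw [← Algebra.commutes, mul_assoc, u.inv_mul, mul_one] }
  refine nonempty_subalgebra_algEquiv e fun X => ?_
  have h1 : u.1 * (u⁻¹.1 * X * u.1 * J') = X * J * conj u.1 := by
    rw [mul_assoc, ← h]
    simp [mul_assoc]
  have h2 : u.1 * (J' * conj (u⁻¹.1 * X * u.1)) = J * conj X * conj u.1 := by
    rw [← mul_assoc, ← h, map_mul, map_mul, mul_assoc J, ← mul_assoc (conj u.1),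
      ← mul_assoc (conj u.1), ← map_mul, u.mul_inv, map_one, one_mul, mul_assoc]
  change u⁻¹.1 * X * u.1 * J' = J' * conj (u⁻¹.1 * X * u.1) ↔ X * J = J * conj X
  rw [← Units.mul_right_inj u, h1, h2]
  exact Units.mul_left_inj (Units.map (conj : Matrix κ κ K →+* _).toMonoidHom u)

theorem semilinearCentralizer_reindex {κ κ' : Type*} [Fintype κ] [DecidableEq κ] [Fintype κ']
    [DecidableEq κ'] (e : κ ≃ κ') (J : Matrix κ κ K) :
    Nonempty (semilinearCentralizer F J ≃ₐ[F]
      semilinearCentralizer F (Matrix.reindex e e J)) := by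
  refine nonempty_subalgebra_algEquiv (Matrix.reindexAlgEquiv F K e) fun X => ?_
  have h1 : conj (Matrix.reindexAlgEquiv F K e X) = Matrix.reindexAlgEquiv F K e (conj X) := rfl
  have h2 : Matrix.reindex e e J = Matrix.reindexAlgEquiv F K e J := rfl
  rw [mem_semilinearCentralizer, mem_semilinearCentralizer, h1, h2, ← map_mul, ← map_mul,
    EquivLike.apply_eq_iff_eq]

variable (F K) in
/-- The quaternion algebra `K ⊕ K z` with `z² = d` and `z α = (star α) z`, as the algebra of the
matrices with rows `(α, d * star β)` and `(β, star α)`. -/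
def crossedProduct (d : F) : Subalgebra F (Matrix (Fin 2) (Fin 2) K) :=
  semilinearCentralizer F !![0, algebraMap F K d; 1, 0]

theorem mem_crossedProduct {d : F} {x : Matrix (Fin 2) (Fin 2) K} :
    x ∈ crossedProduct F K d ↔ x 0 1 = d • star (x 1 0) ∧ x 1 1 = star (x 0 0) := by
  rw [crossedProduct, mem_semilinearCentralizer, ← Matrix.ext_iff]
  simp only [Fin.forall_fin_two, Matrix.mul_apply, Fin.sum_univ_two, conj_apply, Matrix.of_apply,
    Matrix.cons_val_zero, Matrix.cons_val_one, mul_zero, mul_one, zero_mul,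
    one_mul, zero_add, add_zero, Matrix.cons_val']
  constructor
  · rintro ⟨⟨h1, -⟩, h3, -⟩
    exact ⟨by rw [h1, Algebra.smul_def], h3⟩
  · rintro ⟨h1, h3⟩
    rw [h1, h3, Algebra.smul_def]
    simp [IsQuadraticEtale.star_algebraMap, mul_comm]

variable (K) in
/-- The element of the crossed product with first column `(α, β)`. -/
def crossedProduct.mk (d : F) (α β : K) : crossedProduct F K d :=
  ⟨!![α, d • star β; β, star α], mem_crossedProduct.2 ⟨rfl, rfl⟩⟩

theorem crossedProduct.exists_eq_mk {d : F} (x : crossedProduct F K d) :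
    ∃ α β, x = crossedProduct.mk K d α β := by
  obtain ⟨x, hx⟩ := x
  obtain ⟨h1, h3⟩ := mem_crossedProduct.1 hx
  refine ⟨x 0 0, x 1 0, Subtype.ext ?_⟩
  change x = !![x 0 0, d • star (x 1 0); x 1 0, star (x 0 0)]
  rw [← h1, ← h3]
  exact Matrix.eta_fin_two x

theorem crossedProduct.mk_inj {d : F} {α β γ ε : K} :
    mk K d α β = mk K d γ ε ↔ α = γ ∧ β = ε := by
  constructor
  · intro h
    have h' : (!![α, d • star β; β, star α] : Matrix (Fin 2) (Fin 2) K) =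
      !![γ, d • star ε; ε, star γ] := congrArg Subtype.val h
    exact ⟨congrFun (congrFun h' 0) 0, congrFun (congrFun h' 1) 0⟩
  · rintro ⟨rfl, rfl⟩
    rfl

theorem crossedProduct.mk_mul {d : F} (α β γ ε : K) :
    mk K d α β * mk K d γ ε = mk K d (α * γ + d • (star β * ε)) (β * γ + star α * ε) := by
  apply Subtype.ext
  change (!![α, d • star β; β, star α] : Matrix (Fin 2) (Fin 2) K) * !![γ, d • star ε; ε, star γ] =
    !![_, _; _, _]
  ext i j
  fin_cases i <;> fin_cases j <;>
    simp [Algebra.smul_def, IsQuadraticEtale.star_algebraMap, Matrix.mul_apply] <;> ring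

theorem crossedProduct.mk_add {d : F} (α β γ ε : K) :
    mk K d α β + mk K d γ ε = mk K d (α + γ) (β + ε) := by
  apply Subtype.ext
  change (!![α, d • star β; β, star α] : Matrix (Fin 2) (Fin 2) K) + !![γ, d • star ε; ε, star γ] =
    !![_, _; _, _]
  simp [star_add, smul_add]

theorem crossedProduct.smul_mk {d : F} (c : F) (α β : K) :
    c • mk K d α β = mk K d (c • α) (c • β) := by
  apply Subtype.ext
  change c • (!![α, d • star β; β, star α] : Matrix (Fin 2) (Fin 2) K) = !![_, _; _, _]
  ext i j
  fin_cases i <;> fin_cases j <;>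
    simp [Algebra.smul_def, IsQuadraticEtale.star_algebraMap, mul_left_comm]

theorem crossedProduct.algebraMap_eq {d : F} (c : F) :
    algebraMap F (crossedProduct F K d) c = mk K d (algebraMap F K c) 0 := by
  apply Subtype.ext
  change algebraMap F (Matrix (Fin 2) (Fin 2) K) c = !![_, _; _, _]
  rw [Matrix.algebraMap_eq_diagonal]
  ext i j
  fin_cases i <;> fin_cases j <;> simp [IsQuadraticEtale.star_algebraMap]

theorem crossedProduct.isCentral (h2 : (2 : F) ≠ 0) (d : F) :
    Algebra.IsCentral F (crossedProduct F K d) := by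
  have hK := IsQuadraticEtale.isStandardInvolution F K h2
  obtain ⟨b, δ, hδ, -, hb1, hb2⟩ := IsQuadraticEtale.exists_basis F K h2
  refine ⟨fun x hx => ?_⟩
  rw [Subalgebra.mem_center_iff] at hx
  obtain ⟨α, β, rfl⟩ := exists_eq_mk x
  have h1 := hx (mk K d (b 1) 0)
  have h3 := hx (mk K d 0 1)
  rw [mk_mul, mk_mul, mk_inj] at h1 h3
  simp only [star_zero, zero_mul, smul_zero, add_zero, mul_zero, zero_add, star_one, one_mul,
    mul_one, hb1] at h1 h3
  have h4 : star α = α := h3.2.symm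
  have h5 : β = 0 := by
    have h6 : (2 * δ) • β = 0 := by
      rw [Algebra.smul_def, map_mul, map_ofNat, ← hb2]
      linear_combination (-b 1) * h1.2
    exact (smul_eq_zero.1 h6).resolve_left (mul_ne_zero h2 hδ)
  obtain ⟨c, rfl⟩ := hK.exists_of_star_eq h2 h4
  rw [h5, ← algebraMap_eq]
  exact Algebra.mem_bot.2 ⟨c, rfl⟩

/-- A nonzero two-sided ideal contains a nonzero element of the form `(γ, 0)`, by subtracting
conjugates under `j`; then it contains a nonzero scalar `d (γ c + star (γ c))`. -/
theorem crossedProduct.isSimpleRing (h2 : (2 : F) ≠ 0) {d : F} (hd : d ≠ 0) :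
    IsSimpleRing (crossedProduct F K d) := by
  have hK := IsQuadraticEtale.isStandardInvolution F K h2
  have := hK.nontrivial
  obtain ⟨b, δ, hδ, -, hb1, hb2⟩ := IsQuadraticEtale.exists_basis F K h2
  rw [isSimpleRing_iff_isTwoSided_imp]
  refine ⟨inferInstance, fun I hI => or_iff_not_imp_left.2 fun hI0 => ?_⟩
  obtain ⟨x, hx, hx0⟩ := Submodule.exists_mem_ne_zero_of_ne_bot hI0
  have hl : ∀ (y) {x}, x ∈ I → y * x ∈ I := fun y x hx => I.mul_mem_left y hx
  have hr : ∀ {x} (y), x ∈ I → x * y ∈ I := fun y hx => I.mul_mem_right y hx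
  have hs : ∀ (c : F) {x}, x ∈ I → c • x ∈ I := fun c x hx => by
    rw [Algebra.smul_def]
    exact hl _ hx
  have hone : (1 : crossedProduct F K d) = mk K d 1 0 := by
    rw [← map_one (algebraMap F _), algebraMap_eq, map_one]
  obtain ⟨γ, hγ, hγI⟩ : ∃ γ, γ ≠ 0 ∧ mk K d γ 0 ∈ I := by
    obtain ⟨α, β, rfl⟩ := exists_eq_mk x
    have h1 := hr (mk K d (b 1) 0) (hl (mk K d (b 1) 0) hx)
    have h3 := hs δ hx
    by_cases hα : α = 0
    · refine ⟨d • β, fun h => ?_, ?_⟩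
      · rw [(smul_eq_zero.1 h).resolve_left hd, hα] at hx0
        refine hx0 ?_
        rw [← map_zero (algebraMap F (crossedProduct F K d)), algebraMap_eq, map_zero]
      · have h4 := hl (mk K d 0 1) hx
        rw [mk_mul, hα] at h4
        simpa using h4
    · refine ⟨(2 * δ) • α, fun h => hα ((smul_eq_zero.1 h).resolve_left (mul_ne_zero h2 hδ)), ?_⟩
      have h4 := add_mem h1 h3
      rw [mk_mul, mk_mul, smul_mk, mk_add] at h4
      convert h4 using 2
      · simp only [Algebra.smul_def, map_mul, map_ofNat, ← hb2, star_zero]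
        ring
      · simp only [Algebra.smul_def, ← hb2, hb1]
        ring
  obtain ⟨c, hc⟩ : ∃ c, γ * c + star (γ * c) ≠ 0 := by
    by_contra hcon
    push Not at hcon
    exact hγ (hK.nondegenerate γ hcon)
  obtain ⟨t, ht⟩ := hK.exists_add_star (γ * c)
  have ht0 : d * t ≠ 0 := by
    refine mul_ne_zero hd ?_
    rintro rfl
    exact hc (by rw [ht, map_zero])
  have h1 : mk K d (γ * c) 0 ∈ I := by
    have := hr (mk K d c 0) hγI
    rw [mk_mul] at this
    simpa using this
  have h3 := add_mem (hs d h1) (hr (mk K d 0 1) (hl (mk K d 0 1) h1))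
  rw [mk_mul, mk_mul, smul_mk, mk_add] at h3
  rw [Ideal.eq_top_iff_one, hone]
  have h4 := hs (d * t)⁻¹ h3
  rw [smul_mk] at h4
  convert h4 using 2
  · simp only [star_zero, star_one, zero_mul, mul_zero, smul_zero, add_zero, zero_add, one_mul,
      mul_one]
    rw [← smul_add, ht, Algebra.smul_def, Algebra.smul_def, ← map_mul, ← map_mul,
      inv_mul_cancel₀ ht0, map_one]
  · simp

variable (K) in
/-- The crossed product as a central simple algebra. -/
def crossedProductCSA (h2 : (2 : F) ≠ 0) {d : F} (hd : d ≠ 0) : CSA.{u, u} F :=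
  have := (IsQuadraticEtale.isStandardInvolution F K h2).finite
  { AlgCat.of F (crossedProduct F K d) with
    isCentral := crossedProduct.isCentral h2 d
    isSimple := crossedProduct.isSimpleRing h2 hd
    fin_dim := inferInstanceAs
      (FiniteDimensional F (Subalgebra.toSubmodule (crossedProduct F K d))) }

theorem mem_semilinearCentralizer_fromBlocks {ι : Type*} [Fintype ι] [DecidableEq ι] {d : F}
    {X : Matrix (ι ⊕ ι) (ι ⊕ ι) K} :
    X ∈ semilinearCentralizer F (Matrix.fromBlocks 0 (d • 1) 1 0) ↔ ∀ i j,
      X (Sum.inl i) (Sum.inr j) = d • star (X (Sum.inr i) (Sum.inl j)) ∧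
        X (Sum.inr i) (Sum.inr j) = star (X (Sum.inl i) (Sum.inl j)) := by
  obtain ⟨P, Q, R, S, rfl⟩ : ∃ P Q R S, X = Matrix.fromBlocks P Q R S :=
    ⟨_, _, _, _, (Matrix.fromBlocks_toBlocks X).symm⟩
  rw [mem_semilinearCentralizer, conj_fromBlocks, Matrix.fromBlocks_multiply,
    Matrix.fromBlocks_multiply, Matrix.fromBlocks_inj]
  simp only [mul_zero, mul_one, zero_mul, one_mul, zero_add, add_zero, mul_smul_comm,
    smul_mul_assoc, Matrix.fromBlocks_apply₁₁, Matrix.fromBlocks_apply₁₂,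
    Matrix.fromBlocks_apply₂₁, Matrix.fromBlocks_apply₂₂]
  constructor
  · rintro ⟨h1, -, h3, -⟩ i j
    rw [h1, h3]
    exact ⟨rfl, rfl⟩
  · intro h
    have h1 : Q = d • conj R := by
      ext i j
      exact (h i j).1
    have h3 : S = conj P := by
      ext i j
      exact (h i j).2
    rw [h1, h3, conj_conj, conj_smul, conj_conj]
    exact ⟨rfl, rfl, rfl, rfl⟩

/-- If `J² = d` and `J` maps the first half of a basis to the second half, the centralizer of `J`
is a matrix algebra over the crossed product. -/
theorem semilinearCentralizer_fromBlocks_equiv {ι : Type*} [Fintype ι] [DecidableEq ι] (d : F) :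
    Nonempty (semilinearCentralizer F (Matrix.fromBlocks 0 (d • 1) 1 0 : Matrix (ι ⊕ ι) (ι ⊕ ι) K)
      ≃ₐ[F] Matrix ι ι (crossedProduct F K d)) := by
  let e : ι × Fin 2 ≃ ι ⊕ ι :=
    ((Equiv.prodComm _ _).trans (finTwoEquiv.prodCongr (Equiv.refl ι))).trans
      (Equiv.boolProdEquivSum ι)
  let f : Matrix ι ι (crossedProduct F K d) →ₐ[F] Matrix (ι ⊕ ι) (ι ⊕ ι) K :=
    (((Matrix.compAlgEquiv ι (Fin 2) K F).trans (Matrix.reindexAlgEquiv F K e)).toAlgHom).comp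
      (crossedProduct F K d).val.mapMatrix
  have h11 : ∀ y i j, f y (Sum.inl i) (Sum.inl j) = (y i j).1 0 0 := fun y i j => rfl
  have h12 : ∀ y i j, f y (Sum.inl i) (Sum.inr j) = (y i j).1 0 1 := fun y i j => rfl
  have h21 : ∀ y i j, f y (Sum.inr i) (Sum.inl j) = (y i j).1 1 0 := fun y i j => rfl
  have h22 : ∀ y i j, f y (Sum.inr i) (Sum.inr j) = (y i j).1 1 1 := fun y i j => rfl
  have hf : Function.Injective f := by
    intro x y hxy
    ext i j k l
    have hk : ∀ k l, f x k l = f y k l := fun k l => by rw [hxy]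
    fin_cases k <;> fin_cases l
    · exact hk (Sum.inl i) (Sum.inl j)
    · exact hk (Sum.inl i) (Sum.inr j)
    · exact hk (Sum.inr i) (Sum.inl j)
    · exact hk (Sum.inr i) (Sum.inr j)
  refine ⟨((AlgEquiv.ofInjective f hf).trans (Subalgebra.equivOfEq _ _ ?_)).symm⟩
  ext X
  rw [mem_semilinearCentralizer_fromBlocks]
  constructor
  · rintro ⟨y, rfl⟩ i j
    exact mem_crossedProduct.1 (y i j).2
  · intro h
    refine ⟨fun i j =>
      crossedProduct.mk K d (X (Sum.inl i) (Sum.inl j)) (X (Sum.inr i) (Sum.inl j)), ?_⟩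
    ext (i | i) (j | j)
    · rfl
    · exact (h i j).1.symm
    · rfl
    · exact (h i j).2.symm

/-- The centralizer of a semilinear map with square `d` is Brauer equivalent to the crossed product.
The block form of the matrix says that the map exchanges two complementary coordinate subspaces, so
that the vectors `eᵢ` of the first half and their images form a basis. -/
theorem semilinearCentralizer_hasBrauerClass (h2 : (2 : F) ≠ 0) {A : Type u} [Ring A] [Algebra F A]
    {ι : Type*} [Fintype ι] [DecidableEq ι] [Nonempty ι] {d : F} (hd : d ≠ 0) {B C : Matrix ι ι K}
    (hC : IsUnit C) (hBC : B * conj C = d • 1)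
    (e : A ≃ₐ[F] semilinearCentralizer F (Matrix.fromBlocks 0 B C 0)) :
    HasBrauerClass F A (Quotient.mk (Brauer.CSA_Setoid F) (crossedProductCSA K h2 hd)) := by
  obtain ⟨u, rfl⟩ := hC
  obtain ⟨e₁⟩ := semilinearCentralizer_conj (F := F) (J := Matrix.fromBlocks 0 B u.1 0)
    (J' := Matrix.fromBlocks 0 (d • 1) 1 0) (Q := Matrix.fromBlocks 1 0 0 u.1) (by
      refine ⟨⟨Matrix.fromBlocks 1 0 0 u.1, Matrix.fromBlocks 1 0 0 u⁻¹.1, ?_, ?_⟩, rfl⟩ <;>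
        rw [Matrix.fromBlocks_multiply] <;> simp) (by
      rw [conj_fromBlocks, Matrix.fromBlocks_multiply, Matrix.fromBlocks_multiply]
      simp [hBC])
  obtain ⟨e₂⟩ := semilinearCentralizer_fromBlocks_equiv (K := K) (ι := ι) d
  exact hasBrauerClass_of_algEquiv_matrix (crossedProductCSA K h2 hd) ((e.trans e₁).trans e₂)

end SemilinearCentralizer

/-! ### Clifford algebras -/

section Clifford

open Module

theorem finrank_cliffordAlgebra {F V : Type*} [Field F] [AddCommGroup V] [Module F V]
    (h2 : (2 : F) ≠ 0) (q : QuadraticForm F V) {N : ℕ} (b : Basis (Fin N) F V) :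
    FiniteDimensional F (CliffordAlgebra q) ∧ finrank F (CliffordAlgebra q) = 2 ^ N := by
  have : Invertible (2 : F) := invertibleOfNonzero h2
  let B := b.ExteriorAlgebra.map (CliffordAlgebra.equivExterior q).symm
  exact ⟨Module.Finite.of_basis B, by rw [finrank_eq_card_basis B]; simp⟩

variable {F K : Type u} [Field F] [CommRing K] [StarRing K] [Algebra F K] [IsQuadraticEtale F K]

theorem isUnit_of_mul_self_eq {F K : Type*} [Field F] [CommRing K] [Algebra F K] {j : K} {δ : F}
    (hδ : δ ≠ 0) (hj : j * j = algebraMap F K δ) : IsUnit j :=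
  IsUnit.of_mul_eq_one (algebraMap F K δ⁻¹ * j) (by
    rw [mul_left_comm, hj, ← map_mul, inv_mul_cancel₀ hδ, map_one])

/-- A representation of a Clifford algebra by matrices over `K` that commute with a semilinear map
identifies the Clifford algebra with the centralizer of this map, if it is irreducible over `K` and
its dimension is right. -/
theorem cliffordAlgebra_equiv (h2 : (2 : F) ≠ 0) {V : Type*} [AddCommGroup V] [Module F V]
    {q : QuadraticForm F V} {ι : Type*} [Fintype ι] [DecidableEq ι] {ρ : V →ₗ[F] Matrix ι ι K}
    (hρ : ∀ v, ρ v * ρ v = algebraMap F _ (q v)) {J : Matrix ι ι K} (hJ : IsUnit J)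
    (hρJ : ∀ v, ρ v * J = J * conj (ρ v)) (hspan : Algebra.adjoin K (Set.range ρ) = ⊤) {N : ℕ}
    (b : Basis (Fin N) F V) (hN : 2 ^ N ≤ Fintype.card ι * Fintype.card ι) :
    Nonempty (CliffordAlgebra q ≃ₐ[F] semilinearCentralizer F J) := by
  have hK := IsQuadraticEtale.isStandardInvolution F K h2
  have := hK.finite
  have := hK.nontrivial
  obtain ⟨bK, δ, hδ, hb0, hj, hjj⟩ := IsQuadraticEtale.exists_basis F K h2
  set j := bK 1
  obtain ⟨hfin, hdim⟩ := finrank_cliffordAlgebra h2 q b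
  let φ : CliffordAlgebra q →ₐ[F] Matrix ι ι K := CliffordAlgebra.lift q ⟨ρ, hρ⟩
  have hφρ : ∀ v, φ (CliffordAlgebra.ι q v) = ρ v := fun v => CliffordAlgebra.lift_ι_apply ρ hρ v
  have hφZ : ∀ x, φ x ∈ semilinearCentralizer F J := fun x => by
    induction x using CliffordAlgebra.induction with
    | algebraMap r => rw [AlgHom.commutes]; exact Subalgebra.algebraMap_mem _ r
    | ι v => rw [hφρ]; exact hρJ v
    | mul x y hx hy => rw [map_mul]; exact mul_mem hx hy
    | add x y hx hy => rw [map_add]; exact add_mem hx hy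
  have hsum : ∀ X, ∃ r r', X = φ r + j • φ r' := fun X => by
    have hX : X ∈ Algebra.adjoin K (Set.range ρ) := hspan ▸ Algebra.mem_top
    induction hX using Algebra.adjoin_induction with
    | mem X hX =>
      obtain ⟨v, rfl⟩ := hX
      exact ⟨CliffordAlgebra.ι q v, 0, by rw [hφρ, map_zero, smul_zero, add_zero]⟩
    | algebraMap k =>
      refine ⟨algebraMap F _ (bK.repr k 0), algebraMap F _ (bK.repr k 1), ?_⟩
      have h1 := bK.sum_repr k
      rw [Fin.sum_univ_two, hb0] at h1
      rw [AlgHom.commutes, AlgHom.commutes, Algebra.algebraMap_eq_smul_one,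
        Algebra.algebraMap_eq_smul_one, Algebra.algebraMap_eq_smul_one]
      conv_lhs => rw [← h1]
      rw [add_smul, smul_assoc, smul_assoc, one_smul, smul_comm j]
    | add X Y _ _ hX hY =>
      obtain ⟨r, r', rfl⟩ := hX
      obtain ⟨s, s', rfl⟩ := hY
      refine ⟨r + s, r' + s', ?_⟩
      rw [map_add, map_add, smul_add]
      abel
    | mul X Y _ _ hX hY =>
      obtain ⟨r, r', rfl⟩ := hX
      obtain ⟨s, s', rfl⟩ := hY
      refine ⟨r * s + δ • (r' * s'), r * s' + r' * s, ?_⟩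
      have h3 : (j • φ r') * (j • φ s') = δ • (φ r' * φ s') := by
        rw [smul_mul_smul_comm, hjj, algebraMap_smul]
      rw [add_mul, mul_add, mul_add, h3, map_add, map_add, map_smul, map_mul, map_mul, map_mul,
        map_mul, smul_add, smul_mul_assoc, mul_smul_comm]
      abel
  -- the centralizer `Z` of `J` satisfies `j Z ∩ Z = 0`
  have hjZ : ∀ r, j • φ r ∈ semilinearCentralizer F J → φ r = 0 := fun r hr => by
    have h1 : j • (J * conj (φ r)) = -(j • (J * conj (φ r))) := by
      have h3 : (j • φ r) * J = J * conj (j • φ r) := hr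
      have h4 : conj (j • φ r) = -(j • conj (φ r)) := by
        ext i k
        rw [conj_apply, Matrix.smul_apply, smul_eq_mul, star_mul', hj, neg_mul]
        rfl
      have h5 : φ r * J = J * conj (φ r) := hφZ r
      rwa [smul_mul_assoc, h5, h4, mul_neg, mul_smul_comm] at h3
    have h3 : (2 : F) • (j • (J * conj (φ r))) = 0 := by
      rw [two_smul]
      nth_rw 1 [h1]
      rw [neg_add_cancel]
    have h4 := (smul_eq_zero.1 h3).resolve_left h2
    obtain ⟨u, hu⟩ := isUnit_of_mul_self_eq hδ hjj
    obtain ⟨w, rfl⟩ := hJ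
    have h5 : u⁻¹.1 • (w⁻¹.1 * (j • (w.1 * conj (φ r)))) = 0 := by
      rw [h4, mul_zero, smul_zero]
    rw [← hu, mul_smul_comm, smul_smul, u.inv_mul, one_smul, w.inv_mul_cancel_left] at h5
    rw [← conj_conj (φ r), h5, map_zero]
  have hrange : φ.range = semilinearCentralizer F J := by
    apply le_antisymm
    · rintro _ ⟨x, rfl⟩
      exact hφZ x
    · intro z hz
      obtain ⟨r, r', rfl⟩ := hsum z
      have h1 : j • φ r' ∈ semilinearCentralizer F J := by
        have := sub_mem hz (hφZ r)
        rwa [add_sub_cancel_left] at this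
      rw [hjZ r' h1, smul_zero, add_zero]
      exact ⟨r, rfl⟩
  -- `K`-multiples of the image span all matrices, so the image has at least half their dimension
  have hinj : Function.Injective φ := by
    let R := LinearMap.range φ.toLinearMap
    let f : R × R →ₗ[F] Matrix ι ι K :=
      R.subtype.coprod ((Algebra.lsmul F F (Matrix ι ι K) j).comp R.subtype)
    have hf : Function.Surjective f := fun X => by
      obtain ⟨r, r', rfl⟩ := hsum X
      exact ⟨(⟨φ r, r, rfl⟩, ⟨φ r', r', rfl⟩), rfl⟩
    have h1 := LinearMap.finrank_le_finrank_of_surjective hf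
    rw [finrank_prod, finrank_matrix, IsQuadraticEtale.finrank_eq_two (F := F) (K := K)] at h1
    have h3 := LinearMap.finrank_range_add_finrank_ker φ.toLinearMap
    have h4 : finrank F (LinearMap.ker φ.toLinearMap) = 0 := by
      change _ ≤ finrank F R + finrank F R at h1
      change finrank F R + _ = _ at h3
      omega
    exact LinearMap.ker_eq_bot.1 (Submodule.finrank_eq_zero.1 h4)
  exact ⟨(AlgEquiv.ofInjective φ hinj).trans (Subalgebra.equivOfEq _ _ hrange)⟩

/-- The matrices `ρ x` represent the Clifford algebra of the trace form `∑ aᵢ (star xᵢ) xᵢ`, and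
commute up to the sign `(-1) ^ n` with the semilinear map given by `J`. -/
structure IsCliffordRep {n : ℕ} (a : Fin n → F) {ι : Type*} [Fintype ι] [DecidableEq ι]
    (ρ : (Fin n → K) →ₗ[F] Matrix ι ι K) (J : Matrix ι ι K) : Prop where
  card_eq : Fintype.card ι = 2 ^ n
  sq : ∀ x, ρ x * ρ x = (∑ i, a i • (star (x i) * x i)) • 1
  isUnit : IsUnit J
  mul_conj : J * conj J = ((-1) ^ (n * (n + 1) / 2) * ∏ i, a i) • 1
  mul_eq : ∀ x, ρ x * J = ((-1) ^ n : F) • (J * conj (ρ x))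
  adjoin_eq_top : Algebra.adjoin K (Set.range ρ) = ⊤

/-- The extension of a Clifford representation by one more variable `c`, with coefficient `a`: the
matrices with blocks `ρ x`, `a (star c)`, `c`, `-ρ x`. -/
def cliffordStep {n : ℕ} (a : F) {ι : Type*} [Fintype ι] [DecidableEq ι]
    (ρ : (Fin n → K) →ₗ[F] Matrix ι ι K) : (Fin (n + 1) → K) →ₗ[F] Matrix (ι ⊕ ι) (ι ⊕ ι) K where
  toFun x := Matrix.fromBlocks (ρ (Fin.init x)) (a • star (x (Fin.last n)) • 1)
    (x (Fin.last n) • 1) (-ρ (Fin.init x))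
  map_add' x y := by
    have : Fin.init (x + y) = (Fin.init x + Fin.init y : Fin n → K) := rfl
    rw [Matrix.fromBlocks_add, this, map_add, neg_add, Pi.add_apply, star_add, add_smul, add_smul,
      smul_add]
  map_smul' c x := by
    have h1 : Fin.init (c • x) = (c • Fin.init x : Fin n → K) := rfl
    have h3 : star (c • x (Fin.last n)) = c • star (x (Fin.last n)) := by
      rw [Algebra.smul_def, star_mul', IsQuadraticEtale.star_algebraMap, Algebra.smul_def]
    rw [RingHom.id_apply, Matrix.fromBlocks_smul, h1, map_smul, smul_neg, Pi.smul_apply, h3,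
      smul_assoc, smul_assoc, smul_comm a c]

/-- One more variable of the trace form doubles the dimension of the representation, and
multiplies the square of the semilinear map by `(-1) ^ (n + 1) * a n`. -/
theorem IsCliffordRep.step (h2 : (2 : F) ≠ 0) {n : ℕ} {a : Fin (n + 1) → F}
    (ha : a (Fin.last n) ≠ 0) {ι : Type*} [Fintype ι] [DecidableEq ι]
    {ρ : (Fin n → K) →ₗ[F] Matrix ι ι K} {J : Matrix ι ι K}
    (h : IsCliffordRep (fun i => a i.castSucc) ρ J) :
    IsCliffordRep a (cliffordStep (a (Fin.last n)) ρ)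
      (Matrix.fromBlocks 0 (((-1) ^ (n + 1) * a (Fin.last n)) • J) J 0) := by
  have hK := IsQuadraticEtale.isStandardInvolution F K h2
  set α := a (Fin.last n) with hα
  have hs : ∀ x, cliffordStep α ρ x = Matrix.fromBlocks (ρ (Fin.init x))
    (α • star (x (Fin.last n)) • 1) (x (Fin.last n) • 1) (-ρ (Fin.init x)) := fun x => rfl
  have hconj : ∀ c : K, conj (c • (1 : Matrix ι ι K)) = star c • 1 := fun c => by
    ext i j
    rw [conj_apply, Matrix.smul_apply, Matrix.smul_apply, Matrix.one_apply]
    split_ifs <;> simp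
  refine ⟨?_, fun x => ?_, ?_, ?_, fun x => ?_, ?_⟩
  · rw [Fintype.card_sum, h.card_eq, pow_succ, mul_two]
  · rw [hs, Matrix.fromBlocks_multiply, Fin.sum_univ_castSucc, ← Matrix.fromBlocks_one,
      Matrix.fromBlocks_smul, neg_mul_neg, h.sq]
    congr 1
    · rw [add_smul, smul_mul_assoc, smul_mul_smul_comm, one_mul, smul_assoc]
      rfl
    · simp
    · simp
    · rw [add_smul, mul_smul_comm, smul_mul_smul_comm, one_mul, smul_assoc, add_comm,
        mul_comm (star _)]
      rfl
  · obtain ⟨u, rfl⟩ := h.isUnit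
    have hβ : ((-1) ^ (n + 1) * α) ≠ 0 := mul_ne_zero (pow_ne_zero _ (neg_ne_zero.2 one_ne_zero)) ha
    refine ⟨⟨Matrix.fromBlocks 0 (((-1) ^ (n + 1) * α) • u.1) u.1 0,
      Matrix.fromBlocks 0 u⁻¹.1 (((-1) ^ (n + 1) * α)⁻¹ • u⁻¹.1) 0, ?_, ?_⟩, rfl⟩
    · rw [Matrix.fromBlocks_multiply, smul_mul_smul_comm, mul_inv_cancel₀ hβ]
      simp
    · rw [Matrix.fromBlocks_multiply, smul_mul_smul_comm, inv_mul_cancel₀ hβ]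
      simp
  · have hexp : (n + 1) * (n + 1 + 1) / 2 = n * (n + 1) / 2 + (n + 1) := by
      rw [show (n + 1) * (n + 1 + 1) = n * (n + 1) + (n + 1) * 2 by ring,
        Nat.add_mul_div_right _ _ two_pos]
    have h1 : (-1) ^ (n + 1) * α * ((-1) ^ (n * (n + 1) / 2) * ∏ i : Fin n, a i.castSucc) =
        (-1) ^ (n * (n + 1) / 2 + (n + 1)) * ((∏ i : Fin n, a i.castSucc) * α) := by
      rw [pow_add]
      ring
    rw [conj_fromBlocks, Matrix.fromBlocks_multiply, ← Matrix.fromBlocks_one,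
      Matrix.fromBlocks_smul, hexp, Fin.prod_univ_castSucc, conj_smul, ← hα, ← h1, map_zero,
      mul_smul_comm, smul_mul_assoc]
    simp [h.mul_conj, smul_smul]
  · rw [hs, conj_fromBlocks, Matrix.fromBlocks_multiply, Matrix.fromBlocks_multiply,
      Matrix.fromBlocks_smul, conj_smul, hconj, hconj, star_star, map_neg]
    congr 1
    · simp only [mul_zero, zero_add, smul_mul_assoc, mul_smul_comm, one_mul, mul_one, zero_mul]
      rw [smul_comm (star (x (Fin.last n))) ((-1) ^ (n + 1) * α), smul_smul, ← mul_assoc, ← mul_pow,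
        neg_mul_neg, one_mul, one_pow, one_mul]
    · simp only [mul_zero, add_zero, smul_mul_assoc, mul_smul_comm, mul_neg, zero_mul,
        h.mul_eq, smul_smul]
      rw [pow_succ]
      module
    · simp only [mul_zero, add_zero, zero_add, neg_mul, zero_mul, h.mul_eq]
      rw [pow_succ]
      module
    · simp only [mul_zero, add_zero, smul_mul_assoc, mul_smul_comm, one_mul, mul_one,
        zero_mul, smul_smul]
  · obtain ⟨bK, δ, hδ, -, hj, hjj⟩ := IsQuadraticEtale.exists_basis F K h2
    obtain ⟨j, hju⟩ := isUnit_of_mul_self_eq hδ hjj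
    set S := Algebra.adjoin K (Set.range (cliffordStep α ρ))
    have hmem : ∀ x, cliffordStep α ρ x ∈ S := fun x => Algebra.subset_adjoin ⟨x, rfl⟩
    have hmem' : ∀ c : K, Matrix.fromBlocks 0 (α • star c • (1 : Matrix ι ι K)) (c • 1) 0 ∈ S :=
      fun c => by
        have := hmem (Fin.snoc 0 c)
        rw [hs, Fin.init_snoc, Fin.snoc_last, map_zero, neg_zero] at this
        exact this
    have hF : ∀ (c : F) {X}, X ∈ S → c • X ∈ S := fun c X hX => by
      rw [← algebraMap_smul K]
      exact S.smul_mem hX _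
    -- combine the values at `1` and `j`, where `star j = -j`
    have h21 : (Matrix.fromBlocks 0 0 1 0 : Matrix (ι ⊕ ι) (ι ⊕ ι) K) ∈ S := by
      have h1 := add_mem (hmem' j.1) (S.smul_mem (hmem' 1) j.1)
      have h3 := S.smul_mem (hF 2⁻¹ h1) j⁻¹.1
      rw [Matrix.fromBlocks_smul, Matrix.fromBlocks_add, Matrix.fromBlocks_smul,
        Matrix.fromBlocks_smul, hju, hj, star_one] at h3
      convert h3 using 1
      congr 1
      · simp
      · rw [neg_smul, smul_neg, one_smul, smul_comm (bK 1) α, neg_add_cancel, smul_zero, smul_zero]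
      · rw [one_smul, ← two_smul F, smul_smul, inv_mul_cancel₀ h2, one_smul, ← hju, smul_smul,
          j.inv_mul, one_smul]
      · simp
    have h12 : (Matrix.fromBlocks 0 1 0 0 : Matrix (ι ⊕ ι) (ι ⊕ ι) K) ∈ S := by
      have h1 := hF α⁻¹ (sub_mem (hmem' 1) h21)
      rw [sub_eq_add_neg, Matrix.fromBlocks_neg, Matrix.fromBlocks_add, Matrix.fromBlocks_smul,
        star_one, one_smul, neg_zero, add_zero] at h1
      simpa [smul_smul, ha] using h1
    have h11 : (Matrix.fromBlocks 1 0 0 0 : Matrix (ι ⊕ ι) (ι ⊕ ι) K) ∈ S := by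
      have := mul_mem h12 h21
      rw [Matrix.fromBlocks_multiply] at this
      simpa using this
    have hX : ∀ X : Matrix ι ι K, Matrix.fromBlocks X 0 0 0 ∈ S := fun X => by
      have hX : X ∈ Algebra.adjoin K (Set.range ρ) := h.adjoin_eq_top ▸ Algebra.mem_top
      induction hX using Algebra.adjoin_induction with
      | mem X hX =>
        obtain ⟨x, rfl⟩ := hX
        have := mul_mem (mul_mem h11 (hmem (Fin.snoc x 0))) h11
        rw [hs, Fin.init_snoc, Matrix.fromBlocks_multiply, Matrix.fromBlocks_multiply] at this
        simpa using this
      | algebraMap k =>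
        have := S.smul_mem h11 k
        rw [Matrix.fromBlocks_smul] at this
        simpa [Algebra.algebraMap_eq_smul_one] using this
      | add X Y _ _ hX hY =>
        have := add_mem hX hY
        rw [Matrix.fromBlocks_add] at this
        simpa using this
      | mul X Y _ _ hX hY =>
        have := mul_mem hX hY
        rw [Matrix.fromBlocks_multiply] at this
        simpa using this
    rw [eq_top_iff]
    rintro X -
    obtain ⟨A, B, C, D, rfl⟩ : ∃ A B C D, X = Matrix.fromBlocks A B C D :=
      ⟨_, _, _, _, (Matrix.fromBlocks_toBlocks X).symm⟩
    have := add_mem (add_mem (hX A) (mul_mem (hX B) h12))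
      (add_mem (mul_mem h21 (hX C)) (mul_mem (mul_mem h21 (hX D)) h12))
    simp only [Matrix.fromBlocks_multiply, Matrix.fromBlocks_add] at this
    simpa using this

theorem exists_isCliffordRep (h2 : (2 : F) ≠ 0) {n : ℕ} {a : Fin n → F} (ha : ∀ i, a i ≠ 0) :
    ∃ (ι : Type) (_ : Fintype ι) (_ : DecidableEq ι) (ρ : (Fin n → K) →ₗ[F] Matrix ι ι K)
      (J : Matrix ι ι K), IsCliffordRep a ρ J := by
  induction n with
  | zero =>
    refine ⟨Unit, inferInstance, inferInstance, 0, 1, by simp, by simp, isUnit_one, ?_, by simp, ?_⟩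
    · simp [map_one]
    · rw [eq_top_iff]
      rintro X -
      have : X = algebraMap K _ (X () ()) := by
        ext
        simp [Matrix.algebraMap_matrix_apply]
      rw [this]
      exact Subalgebra.algebraMap_mem _ _
  | succ n ih =>
    obtain ⟨ι, _, _, ρ, J, h⟩ := ih (a := fun i => a i.castSucc) fun i => ha _
    exact ⟨ι ⊕ ι, inferInstance, inferInstance, _, _, h.step h2 (ha _)⟩

end Clifford

/-! ### Discriminant algebras -/

section Discriminant

open Module Set

section Wedge

variable {R M : Type*} [CommRing R] [AddCommGroup M] [Module R M]

theorem ι_mul_ιMulti (x : M) {k : ℕ} (v : Fin k → M) :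
    ExteriorAlgebra.ι R x * ExteriorAlgebra.ιMulti R k v =
      (-1 : R) ^ k • (ExteriorAlgebra.ιMulti R k v * ExteriorAlgebra.ι R x) := by
  induction k with
  | zero => simp
  | succ k ih =>
    rw [ExteriorAlgebra.ιMulti_succ_apply, ← mul_assoc,
      eq_neg_of_add_eq_zero_left (ExteriorAlgebra.ι_add_mul_swap x (v 0)), neg_mul, mul_assoc, ih,
      mul_smul_comm, pow_succ, mul_neg_one, neg_smul, mul_assoc]

theorem ιMulti_mul_comm {k l : ℕ} (v : Fin k → M) (w : Fin l → M) :
    ExteriorAlgebra.ιMulti R k v * ExteriorAlgebra.ιMulti R l w =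
      (-1 : R) ^ (k * l) • (ExteriorAlgebra.ιMulti R l w * ExteriorAlgebra.ιMulti R k v) := by
  induction k with
  | zero => simp
  | succ k ih =>
    rw [ExteriorAlgebra.ιMulti_succ_apply, mul_assoc, ih, mul_smul_comm, ← mul_assoc,
      ι_mul_ιMulti, smul_mul_assoc, smul_smul, ← pow_add, mul_assoc]
    congr 2
    ring

end Wedge

variable {m n : ℕ}

/-- The complement of a subset with half of the elements. -/
def halfCompl (hn : m + m = Fintype.card (Fin n)) :
    powersetCard (Fin n) m ≃ powersetCard (Fin n) m :=
  powersetCard.compl hn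

theorem halfCompl_halfCompl (hn : m + m = Fintype.card (Fin n)) (S : powersetCard (Fin n) m) :
    halfCompl hn (halfCompl hn S) = S :=
  Subtype.ext (compl_compl (S : Finset (Fin n)))

theorem disjoint_halfCompl (hn : m + m = Fintype.card (Fin n)) (S : powersetCard (Fin n) m) :
    Disjoint S.val (halfCompl hn S).val :=
  disjoint_compl_right (a := (S : Finset (Fin n)))

/-- The sign `ε` with `e_S ∧ e_T = ε vol`, for `T` the complement of `S`. -/
def complSign (hn : m + m = Fintype.card (Fin n)) (S : powersetCard (Fin n) m) : ℤˣ :=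
  (powersetCard.permOfDisjoint (disjoint_halfCompl hn S)).sign

section Basis

variable {R M : Type*} [CommRing R] [AddCommGroup M] [Module R M] (b : Basis (Fin n) R M)

/-- The matrix of the pairing `⋀ᵐ × ⋀ᵐ → ⋀²ᵐ` in a basis. -/
def wedgeMatrix (R : Type*) [CommRing R] (hn : m + m = Fintype.card (Fin n)) :
    Matrix (powersetCard (Fin n) m) (powersetCard (Fin n) m) R :=
  Matrix.of fun S T => if T = halfCompl hn S then ((complSign hn S : ℤ) : R) else 0

theorem exteriorPower_basis_mul (hn : m + m = Fintype.card (Fin n)) (S T : powersetCard (Fin n) m) :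
    (b.exteriorPower m S : ExteriorAlgebra R M) * (b.exteriorPower m T : ExteriorAlgebra R M) =
      wedgeMatrix R hn S T • b.ExteriorAlgebra Finset.univ := by
  rw [← ExteriorAlgebra.basis_eq_coe_basis, ← ExteriorAlgebra.basis_eq_coe_basis, wedgeMatrix,
    Matrix.of_apply]
  split_ifs with h
  · subst h
    rw [ExteriorAlgebra.basis_mul_of_disjoint b _ _ (disjoint_halfCompl hn S)]
    have : ((powersetCard.disjUnion (disjoint_halfCompl hn S) : powersetCard (Fin n) (m + m)) :
        Finset (Fin n)) = Finset.univ := by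
      rw [← Finset.card_eq_iff_eq_univ, ← hn]
      exact (powersetCard.disjUnion (disjoint_halfCompl hn S)).2
    rw [this, Units.smul_def, complSign, Int.cast_smul_eq_zsmul]
  · rw [ExteriorAlgebra.basis_mul_of_not_disjoint, zero_smul]
    intro hd
    refine h (Subtype.ext ?_)
    refine Finset.eq_of_subset_of_card_le
      (fun i hi => Finset.mem_compl.2 fun hi' => Finset.disjoint_left.1 hd hi' hi) ?_
    rw [(halfCompl hn S).2, T.2]

/-- `e_S ∧ e_T = (-1) ^ (m * m) e_T ∧ e_S` for complementary subsets `S` and `T`. -/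
theorem complSign_mul_complSign (hn : m + m = Fintype.card (Fin n))
    (S : powersetCard (Fin n) m) :
    ((complSign hn S : ℤ) : R) * ((complSign hn (halfCompl hn S) : ℤ) : R) = (-1) ^ m := by
  nontriviality R
  let b := Pi.basisFun R (Fin n)
  have h1 := exteriorPower_basis_mul b hn S (halfCompl hn S)
  have h2 := exteriorPower_basis_mul b hn (halfCompl hn S) (halfCompl hn (halfCompl hn S))
  rw [wedgeMatrix, Matrix.of_apply, if_pos rfl] at h1 h2
  rw [halfCompl_halfCompl, exteriorPower.basis_apply, exteriorPower.basis_apply,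
    exteriorPower.ιMulti_family_apply_coe, exteriorPower.ιMulti_family_apply_coe,
    ιMulti_mul_comm] at h2
  rw [exteriorPower.basis_apply, exteriorPower.basis_apply,
    exteriorPower.ιMulti_family_apply_coe, exteriorPower.ιMulti_family_apply_coe] at h1
  rw [h1, smul_smul] at h2
  have h3 : (-1 : R) ^ (m * m) * ((complSign hn S : ℤ) : R) =
      ((complSign hn (halfCompl hn S) : ℤ) : R) := by
    have := congrArg (fun x => b.ExteriorAlgebra.repr x Finset.univ) h2
    simpa using this
  have h4 : ((complSign hn S : ℤ) : R) * ((complSign hn S : ℤ) : R) = 1 := by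
    rw [← Int.cast_mul, ← Units.val_mul, Int.units_mul_self]
    simp
  have h5 : (-1 : R) ^ (m * m) = (-1) ^ m := by
    rcases Nat.even_or_odd m with h | h
    · rw [h.neg_one_pow, (h.mul_left m).neg_one_pow]
    · rw [h.neg_one_pow, (h.mul h).neg_one_pow]
  rw [← h3, mul_left_comm, h4, mul_one, h5]

/-- The adjoint with respect to the pairing `(x, y) ↦ x ∧ y`, in terms of matrices. -/
theorem isCanonicalAdjoint_iff {K : Type u} [CommRing K] [StarRing K]
    (b : Basis (Fin n) K (Fin n → K)) (hn : m + m = Fintype.card (Fin n))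
    (f g : Module.End K (⋀[K]^m (Fin n → K))) :
    IsCanonicalAdjoint f g ↔
      (LinearMap.toMatrix (b.exteriorPower m) (b.exteriorPower m) g)ᵀ * wedgeMatrix K hn =
        wedgeMatrix K hn * LinearMap.toMatrix (b.exteriorPower m) (b.exteriorPower m) f := by
  set B := b.exteriorPower m
  let v : ⋀[K]^m (Fin n → K) →ₗ[K] ExteriorAlgebra K (Fin n → K) := Submodule.subtype _
  have hsum : ∀ (f : Module.End K (⋀[K]^m (Fin n → K))) S,
      v (f (B S)) = ∑ U, LinearMap.toMatrix B B f U S • v (B U) := fun f S => by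
    conv_lhs => rw [← B.sum_repr (f (B S))]
    simp only [map_sum, map_smul, LinearMap.toMatrix_apply]
  have h1 : ∀ S T, v (g (B S)) * v (B T) =
      ((LinearMap.toMatrix B B g)ᵀ * wedgeMatrix K hn) S T • b.ExteriorAlgebra Finset.univ :=
    fun S T => by
      rw [hsum, Finset.sum_mul, Matrix.mul_apply, Finset.sum_smul]
      refine Finset.sum_congr rfl fun U _ => ?_
      rw [smul_mul_assoc, Matrix.transpose_apply, mul_smul]
      congr 1
      exact exteriorPower_basis_mul b hn U T
  have h2 : ∀ S T, v (B S) * v (f (B T)) =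
      (wedgeMatrix K hn * LinearMap.toMatrix B B f) S T • b.ExteriorAlgebra Finset.univ :=
    fun S T => by
      rw [hsum, Finset.mul_sum, Matrix.mul_apply, Finset.sum_smul]
      refine Finset.sum_congr rfl fun U _ => ?_
      rw [mul_smul_comm, mul_comm (wedgeMatrix K hn S U), mul_smul]
      congr 1
      exact exteriorPower_basis_mul b hn S U
  constructor
  · intro h
    ext S T
    have h3 : v (g (B S)) * v (B T) = v (B S) * v (f (B T)) := h (B S) (B T)
    rw [h1, h2] at h3
    have := congrArg (fun x => b.ExteriorAlgebra.repr x Finset.univ) h3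
    simpa using this
  · intro h
    have h3 : (LinearMap.mul K (ExteriorAlgebra K (Fin n → K))).compl₁₂ (v ∘ₗ g) v =
        (LinearMap.mul K (ExteriorAlgebra K (Fin n → K))).compl₁₂ v (v ∘ₗ f) :=
      LinearMap.ext_basis B B fun S T => by
        change v (g (B S)) * v (B T) = v (B S) * v (f (B T))
        rw [h1, h2, h]
    exact fun x y => LinearMap.congr_fun (LinearMap.congr_fun h3 x) y

end Basis

variable {F K : Type u} [Field F] [CommRing K] [StarRing K] [Algebra F K]

section Orthogonal

variable {b : Basis (Fin n) K (Fin n → K)} {a : Fin n → F} {h : HermitianForm K n}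

variable (m) in
/-- The Gram matrix of `h^{∧m}` in an orthogonal basis; it is diagonal with the entries
`∏ i ∈ S, a i` for the subsets `S` with `m` elements. -/
def wedgeGram (K : Type u) [CommRing K] [Algebra F K] (a : Fin n → F) :
    Matrix (powersetCard (Fin n) m) (powersetCard (Fin n) m) K :=
  Matrix.diagonal fun S => algebraMap F K (∏ i ∈ S.val, a i)

theorem wedge_basis (hb : ∀ i j, h.toFun (b i) (b j) = if i = j then algebraMap F K (a i) else 0)
    (S T : powersetCard (Fin n) m) :
    h.wedge (b ∘ powersetCard.ofFinEmbEquiv.symm S) (b.exteriorPower m T) =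
      wedgeGram m K a S T := by
  rw [exteriorPower.basis_apply, exteriorPower.ιMulti_family, HermitianForm.wedge_ιMulti, wedgeGram]
  simp only [Function.comp_apply, hb]
  by_cases hST : S = T
  · subst hST
    rw [Matrix.diagonal_apply_eq]
    have h1 : (Matrix.of fun i j : Fin m => if powersetCard.ofFinEmbEquiv.symm S i =
        powersetCard.ofFinEmbEquiv.symm S j then
          algebraMap F K (a (powersetCard.ofFinEmbEquiv.symm S i)) else 0) =
        Matrix.diagonal fun i => algebraMap F K (a (powersetCard.ofFinEmbEquiv.symm S i)) := by
      ext i j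
      rw [Matrix.of_apply, Matrix.diagonal_apply]
      simp
    rw [h1, Matrix.det_diagonal, ← map_prod]
    congr 1
    conv_rhs => rw [← Finset.map_orderEmbOfFin_univ S.val S.2]
    rw [Finset.prod_map]
    rfl
  · rw [Matrix.diagonal_apply_ne _ hST]
    obtain ⟨i, hiS, hiT⟩ := (powersetCard.exists_mem_notMem_iff_ne S T).1 hST
    obtain ⟨k, rfl⟩ := (powersetCard.mem_range_ofFinEmbEquiv_symm_iff_mem S i).2 hiS
    refine Matrix.det_eq_zero_of_row_eq_zero k fun l => ?_
    rw [Matrix.of_apply, if_neg]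
    intro hkl
    rw [hkl] at hiT
    exact hiT ((powersetCard.mem_range_ofFinEmbEquiv_symm_iff_mem T _).1 ⟨l, rfl⟩)

theorem wedge_eq (hs : ∀ c : F, star (algebraMap F K c) = algebraMap F K c)
    (hb : ∀ i j, h.toFun (b i) (b j) = if i = j then algebraMap F K (a i) else 0)
    (x : Fin m → Fin n → K) (ω : ⋀[K]^m (Fin n → K)) :
    h.wedge x ω = star ((b.exteriorPower m).repr (exteriorPower.ιMulti K m x) : _ → K) ⬝ᵥ
      (wedgeGram m K a *ᵥ (b.exteriorPower m).repr ω) := by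
  set B := b.exteriorPower m with hB
  -- `h.wedge x` is linear, and known on the basis by hermitian symmetry
  have key : ∀ T, h.wedge x (B T) = star (B.repr (exteriorPower.ιMulti K m x) T) *
      algebraMap F K (∏ i ∈ T.val, a i) := fun T => by
    have h1 : B T = exteriorPower.ιMulti K m (b ∘ powersetCard.ofFinEmbEquiv.symm T) :=
      exteriorPower.basis_apply ..
    rw [h1, ← h.star_wedge_ιMulti]
    conv_lhs => rw [← B.sum_repr (exteriorPower.ιMulti K m x)]
    rw [map_sum, star_sum, Finset.sum_eq_single T]
    · rw [map_smul, wedge_basis hb, wedgeGram, Matrix.diagonal_apply_eq, smul_eq_mul, star_mul', hs]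
    · intro S _ hST
      rw [map_smul, wedge_basis hb, wedgeGram, Matrix.diagonal_apply_ne _ hST.symm, smul_zero,
        star_zero]
    · simp
  conv_lhs => rw [← B.sum_repr ω]
  simp only [map_sum, map_smul, key, dotProduct, wedgeGram, Matrix.mulVec_diagonal, smul_eq_mul,
    Pi.star_apply]
  exact Finset.sum_congr rfl fun S _ => by ring

/-- The adjoint with respect to `h^{∧m}`, in terms of matrices. -/
theorem isWedgeAdjoint_iff (hs : ∀ c : F, star (algebraMap F K c) = algebraMap F K c)
    (hb : ∀ i j, h.toFun (b i) (b j) = if i = j then algebraMap F K (a i) else 0)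
    (f g : Module.End K (⋀[K]^m (Fin n → K))) :
    IsWedgeAdjoint h f g ↔
      (wedgeGram m K a * LinearMap.toMatrix (b.exteriorPower m) (b.exteriorPower m) g)ᴴ =
        wedgeGram m K a * LinearMap.toMatrix (b.exteriorPower m) (b.exteriorPower m) f := by
  set B := b.exteriorPower m with hB
  have h1 : ∀ x y : Fin m → Fin n → K, star (h.wedge y (g (exteriorPower.ιMulti K m x))) =
      star (B.repr (exteriorPower.ιMulti K m x) : _ → K) ⬝ᵥ
        ((wedgeGram m K a * LinearMap.toMatrix B B g)ᴴ *ᵥ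
          B.repr (exteriorPower.ιMulti K m y)) := fun x y => by
    rw [wedge_eq hs hb, ← LinearMap.toMatrix_mulVec_repr B B, Matrix.mulVec_mulVec,
      ← Matrix.star_dotProduct_star, star_star, Matrix.star_mulVec, ← Matrix.dotProduct_mulVec]
  have h2 : ∀ x y : Fin m → Fin n → K, h.wedge x (f (exteriorPower.ιMulti K m y)) =
      star (B.repr (exteriorPower.ιMulti K m x) : _ → K) ⬝ᵥ
        ((wedgeGram m K a * LinearMap.toMatrix B B f) *ᵥ
          B.repr (exteriorPower.ιMulti K m y)) := fun x y => by
    rw [wedge_eq hs hb, ← LinearMap.toMatrix_mulVec_repr B B, Matrix.mulVec_mulVec]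
  constructor
  · intro H
    ext S T
    have h3 := H (b ∘ powersetCard.ofFinEmbEquiv.symm S) (b ∘ powersetCard.ofFinEmbEquiv.symm T)
    have h4 : ∀ S, B.repr (exteriorPower.ιMulti K m (b ∘ powersetCard.ofFinEmbEquiv.symm S)) =
        Finsupp.single S 1 := fun S => by
      rw [← B.repr_self S, hB, exteriorPower.basis_apply]
      rfl
    rw [h1, h2, h4, h4, Finsupp.single_eq_pi_single, Finsupp.single_eq_pi_single] at h3
    simpa [← Pi.single_star, Matrix.conjTranspose_apply, -Matrix.conjTranspose_mul] using h3
  · intro H x y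
    rw [h1, h2, H]

variable [IsQuadraticEtale F K]

/-- The matrix of the semilinear map that corresponds to `σ^{∧m} ∘ γ`. -/
def discriminantMatrix (hn : m + m = Fintype.card (Fin n)) (K : Type u) [CommRing K] [Algebra F K]
    (a : Fin n → F) : Matrix (powersetCard (Fin n) m) (powersetCard (Fin n) m) K :=
  (wedgeMatrix K hn)ᵀ * wedgeGram m K a

theorem wedgeMatrix_mul_transpose {R : Type*} [CommRing R] (hn : m + m = Fintype.card (Fin n)) :
    wedgeMatrix R hn * (wedgeMatrix R hn)ᵀ = 1 := by
  ext S T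
  rw [Matrix.mul_apply, Finset.sum_eq_single (halfCompl hn S)]
  · rw [Matrix.transpose_apply, wedgeMatrix, Matrix.of_apply, Matrix.of_apply, if_pos rfl,
      Matrix.one_apply]
    by_cases h : S = T
    · subst h
      rw [if_pos rfl, if_pos rfl, ← Int.cast_mul, ← Units.val_mul, Int.units_mul_self]
      simp
    · rw [if_neg h, if_neg (fun h' => h ((halfCompl hn).injective h')), mul_zero]
  · intro U _ hU
    rw [wedgeMatrix, Matrix.of_apply, if_neg hU, zero_mul]
  · simp

theorem conj_wedgeGram (a : Fin n → F) : conj (wedgeGram m K a) = wedgeGram m K a := by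
  ext S T
  rw [conj_apply, wedgeGram, Matrix.diagonal_apply]
  split_ifs
  · exact IsQuadraticEtale.star_algebraMap _
  · exact star_zero _

/-- `f` is fixed by `σ^{∧m} ∘ γ` if and only if its matrix commutes with a semilinear map. -/
theorem exists_adjoint_iff (hn : m + m = Fintype.card (Fin n)) (ha : ∀ i, a i ≠ 0)
    (hb : ∀ i j, h.toFun (b i) (b j) = if i = j then algebraMap F K (a i) else 0)
    (f : Module.End K (⋀[K]^m (Fin n → K))) :
    (∃ g, IsCanonicalAdjoint f g ∧ IsWedgeAdjoint h f g) ↔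
      LinearMap.toMatrix (b.exteriorPower m) (b.exteriorPower m) f ∈
        semilinearCentralizer F (discriminantMatrix hn K a) := by
  set B := b.exteriorPower m
  set X := LinearMap.toMatrix B B f
  set E := wedgeMatrix K hn with hE
  set A := wedgeGram m K a with hA
  have hEE : E * Eᵀ = 1 := wedgeMatrix_mul_transpose hn
  have hEE' : Eᵀ * E = 1 := mul_eq_one_comm.1 hEE
  have hAA : A * wedgeGram m K (fun i => (a i)⁻¹) = 1 := by
    rw [hA, wedgeGram, wedgeGram, Matrix.diagonal_mul_diagonal, ← Matrix.diagonal_one]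
    congr 1
    ext S
    rw [← map_mul, ← Finset.prod_mul_distrib, Finset.prod_eq_one, map_one]
    intro i _
    exact mul_inv_cancel₀ (ha i)
  set A' := wedgeGram m K (fun i => (a i)⁻¹)
  have hAA' : A' * A = 1 := mul_eq_one_comm.1 hAA
  have hconjT : ∀ Y : Matrix (powersetCard (Fin n) m) (powersetCard (Fin n) m) K,
      Yᴴ = (conj Y)ᵀ := fun Y => rfl
  have hAT : Aᵀ = A := Matrix.diagonal_transpose _
  have hconjA : conj A = A := conj_wedgeGram a
  -- the two conditions on the matrix `Y` of `g`
  have h1 : (∃ g, IsCanonicalAdjoint f g ∧ IsWedgeAdjoint h f g) ↔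
      ∃ Y : Matrix (powersetCard (Fin n) m) (powersetCard (Fin n) m) K,
        Yᵀ * E = E * X ∧ (A * Y)ᴴ = A * X := by
    constructor
    · rintro ⟨g, h1, h2⟩
      exact ⟨LinearMap.toMatrix B B g, (isCanonicalAdjoint_iff b hn f g).1 h1,
        (isWedgeAdjoint_iff IsQuadraticEtale.star_algebraMap hb f g).1 h2⟩
    · rintro ⟨Y, h1, h2⟩
      refine ⟨Matrix.toLin B B Y, (isCanonicalAdjoint_iff b hn f _).2 ?_,
        (isWedgeAdjoint_iff IsQuadraticEtale.star_algebraMap hb f _).2 ?_⟩ <;>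
      rwa [LinearMap.toMatrix_toLin]
  rw [h1, mem_semilinearCentralizer, discriminantMatrix, ← hE, ← hA]
  have h2 : ∀ Y : Matrix (powersetCard (Fin n) m) (powersetCard (Fin n) m) K,
      (A * Y)ᴴ = A * X ↔ Yᵀ * A = A * conj X := fun Y => by
    rw [hconjT, map_mul, hconjA, Matrix.transpose_mul, hAT]
    constructor
    · intro H
      have := congrArg conj H
      rw [map_mul, map_mul, hconjA] at this
      rw [← this]
      congr 1
      ext S T
      rw [conj_apply, Matrix.transpose_apply, Matrix.transpose_apply, conj_apply, star_star]
    · intro H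
      have := congrArg conj H
      rw [map_mul, map_mul, hconjA, conj_conj] at this
      rw [← this]
      rfl
  constructor
  · rintro ⟨Y, h3, h4⟩
    rw [h2] at h4
    calc X * (Eᵀ * A) = Eᵀ * (E * X) * (Eᵀ * A) := by rw [← mul_assoc Eᵀ, hEE', one_mul]
      _ = Eᵀ * (Yᵀ * (E * Eᵀ) * A) := by rw [← h3]; simp only [mul_assoc]
      _ = Eᵀ * A * conj X := by rw [hEE, mul_one, h4, mul_assoc]
  · intro H
    refine ⟨(E * X * Eᵀ)ᵀ, ?_, (h2 _).2 ?_⟩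
    · rw [Matrix.transpose_transpose, mul_assoc, hEE', mul_one]
    · rw [Matrix.transpose_transpose, mul_assoc, mul_assoc, H, ← mul_assoc, ← mul_assoc, hEE,
        one_mul]

end Orthogonal

variable [IsQuadraticEtale F K]

theorem semilinearCentralizer_smul {κ : Type*} [Fintype κ] [DecidableEq κ] {c : F} (hc : c ≠ 0)
    (J : Matrix κ κ K) : semilinearCentralizer F (c • J) = semilinearCentralizer F J := by
  ext X
  rw [mem_semilinearCentralizer, mem_semilinearCentralizer, mul_smul_comm, smul_mul_assoc]
  exact (smul_right_injective _ hc).eq_iff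

theorem discriminantMatrix_smul {F K : Type u} [Field F] [CommRing K] [Algebra F K]
    (hn : m + m = Fintype.card (Fin n)) (a : Fin n → F) (c : F) :
    discriminantMatrix hn K (fun i => c * a i) = c ^ m • discriminantMatrix hn K a := by
  rw [discriminantMatrix, discriminantMatrix, ← mul_smul_comm]
  congr 1
  rw [wedgeGram, wedgeGram, ← Matrix.diagonal_smul]
  congr 1
  ext S
  rw [Finset.prod_mul_distrib, Finset.prod_const, S.2, Pi.smul_apply, map_mul, Algebra.smul_def]

/-- The discriminant algebra consists of the elements that commute with a semilinear map. Scaling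
the hermitian form scales this map, so the choice of the form does not matter. -/
theorem discriminantAlgebra_equiv (h2 : (2 : F) ≠ 0) (hn0 : 0 < n)
    (hn : m + m = Fintype.card (Fin n))
    {σ : Matrix (Fin n) (Fin n) K →ₗ[F] Matrix (Fin n) (Fin n) K} {h : HermitianForm K n}
    (hσ : IsUnderlyingForm F σ h) {b : Basis (Fin n) K (Fin n → K)} {a : Fin n → F}
    (ha : ∀ i, a i ≠ 0)
    (hb : ∀ i j, h.toFun (b i) (b j) = if i = j then algebraMap F K (a i) else 0) :
    Nonempty (discriminantAlgebra σ m ≃ₐ[F]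
      semilinearCentralizer F (discriminantMatrix hn K a)) := by
  have hK := IsQuadraticEtale.isStandardInvolution F K h2
  refine nonempty_subalgebra_algEquiv
    ((LinearMap.toMatrixAlgEquiv (b.exteriorPower m)).restrictScalars F) fun f => ?_
  have h1 : ((LinearMap.toMatrixAlgEquiv (b.exteriorPower m)).restrictScalars F) f =
    LinearMap.toMatrix (b.exteriorPower m) (b.exteriorPower m) f := rfl
  rw [h1]
  constructor
  · intro H h' hh'
    obtain ⟨c, hc, hg⟩ := hσ.exists_gram_eq_smul hK h2 hn0 hh'
    refine (exists_adjoint_iff (a := fun i => c * a i) (b := b) hn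
      (fun i => mul_ne_zero hc (ha i)) (fun i j => ?_) f).2 ?_
    · rw [h'.toFun_eq, hg, Matrix.smul_mulVec, dotProduct_smul, ← h.toFun_eq, hb]
      split_ifs
      · rw [map_mul, Algebra.smul_def]
      · exact smul_zero c
    · rwa [discriminantMatrix_smul, semilinearCentralizer_smul (pow_ne_zero m hc)]
  · intro H
    exact (exists_adjoint_iff hn ha hb f).1 (H h hσ)

/-- The subsets with half of the elements, split according to whether they contain `i₀`. -/
def halfEquiv (hn : m + m = Fintype.card (Fin n)) (i₀ : Fin n) :
    powersetCard (Fin n) m ≃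
      {S : powersetCard (Fin n) m // i₀ ∈ S.val} ⊕ {S : powersetCard (Fin n) m // i₀ ∈ S.val} where
  toFun S := if hS : i₀ ∈ S.val then Sum.inl ⟨S, hS⟩
    else Sum.inr ⟨halfCompl hn S, Finset.mem_compl.2 hS⟩
  invFun := Sum.elim (fun S => S.1) fun S => halfCompl hn S.1
  left_inv S := by
    beta_reduce
    by_cases hS : i₀ ∈ S.val
    · rw [dif_pos hS, Sum.elim_inl]
    · rw [dif_neg hS, Sum.elim_inr, halfCompl_halfCompl]
  right_inv := by
    rintro (S | S)
    · exact dif_pos S.2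
    · exact (dif_neg fun h => Finset.mem_compl.1 h S.2).trans
        (congrArg Sum.inr (Subtype.ext (halfCompl_halfCompl hn S.1)))

theorem discriminantMatrix_apply {F K : Type u} [Field F] [CommRing K] [Algebra F K]
    (hn : m + m = Fintype.card (Fin n)) (a : Fin n → F) (S T : powersetCard (Fin n) m) :
    discriminantMatrix hn K a S T =
      if S = halfCompl hn T then
        ((complSign hn T : ℤ) : K) * algebraMap F K (∏ i ∈ T.val, a i) else 0 := by
  rw [discriminantMatrix, wedgeGram, Matrix.mul_diagonal, Matrix.transpose_apply, wedgeMatrix,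
    Matrix.of_apply, ite_mul, zero_mul]

/-- The semilinear map maps `e_S` to `ε_S a_S e_T`, for `T` the complement of `S` and `a_S` the
product of the `a i` for `i ∈ S`, so its square is `ε_S ε_T a_S a_T = (-1) ^ m ∏ a i`. -/
theorem discriminantAlgebra_hasBrauerClass (h2 : (2 : F) ≠ 0) (hn0 : 0 < n) (hn : n = 2 * m)
    {σ : Matrix (Fin n) (Fin n) K →ₗ[F] Matrix (Fin n) (Fin n) K} {h : HermitianForm K n}
    (hσ : IsUnderlyingForm F σ h) {b : Basis (Fin n) K (Fin n → K)} {a : Fin n → F}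
    (ha : ∀ i, a i ≠ 0)
    (hb : ∀ i j, h.toFun (b i) (b j) = if i = j then algebraMap F K (a i) else 0)
    {d : F} (hd : d ≠ 0) (hda : d = (-1) ^ m * ∏ i, a i) :
    HasBrauerClass F (discriminantAlgebra σ m)
      (Quotient.mk (Brauer.CSA_Setoid F) (crossedProductCSA K h2 hd)) := by
  have hn' : m + m = Fintype.card (Fin n) := by rw [Fintype.card_fin]; omega
  obtain ⟨e₁⟩ := discriminantAlgebra_equiv h2 hn0 hn' hσ ha hb
  let i₀ : Fin n := ⟨0, hn0⟩
  let ι := {S : powersetCard (Fin n) m // i₀ ∈ S.val}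
  obtain ⟨e₂⟩ := semilinearCentralizer_reindex (F := F) (halfEquiv hn' i₀)
    (discriminantMatrix hn' K a)
  have : Nonempty ι := by
    obtain ⟨S, -, hS⟩ := Finset.exists_subset_card_eq (s := (Finset.univ : Finset (Fin n))) (n := m)
      (by simp; omega)
    by_cases h0 : i₀ ∈ S
    · exact ⟨⟨⟨S, hS⟩, h0⟩⟩
    · exact ⟨⟨halfCompl hn' ⟨S, hS⟩, Finset.mem_compl.2 h0⟩⟩
  let μ : powersetCard (Fin n) m → K := fun S =>
    ((complSign hn' S : ℤ) : K) * algebraMap F K (∏ i ∈ S.val, a i)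
  have hμ : ∀ S, μ (halfCompl hn' S) * μ S = algebraMap F K d := fun S => by
    have h1 := complSign_mul_complSign (R := K) hn' S
    have h3 : (∏ i ∈ S.val, a i) * ∏ i ∈ (halfCompl hn' S).val, a i = ∏ i, a i :=
      Finset.prod_mul_prod_compl (S : Finset (Fin n)) a
    rw [hda, map_mul, ← h3, map_mul, map_pow, map_neg, map_one, ← h1]
    ring
  have hstar : ∀ S, star (μ S) = μ S := fun S => by
    change star (((complSign hn' S : ℤ) : K) * _) = _ * _
    rw [star_mul', IsQuadraticEtale.star_algebraMap, star_intCast]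
  have hμu : ∀ S, IsUnit (μ S) := fun S => by
    refine isUnit_of_mul_isUnit_right (x := μ (halfCompl hn' S)) ?_
    rw [hμ]
    exact (isUnit_iff_ne_zero.2 hd).map _
  have hJ : Matrix.reindex (halfEquiv hn' i₀) (halfEquiv hn' i₀) (discriminantMatrix hn' K a) =
      Matrix.fromBlocks 0 (Matrix.diagonal fun S : ι => μ (halfCompl hn' S.1))
        (Matrix.diagonal fun S : ι => μ S.1) 0 := by
    have hne : ∀ S T : ι, S.1 ≠ halfCompl hn' T.1 := fun S T hST => by
      have h1 := S.2
      rw [hST] at h1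
      exact Finset.mem_compl.1 h1 T.2
    ext (S | S) (T | T)
    · exact (discriminantMatrix_apply hn' a _ _).trans (if_neg (hne S T))
    · refine (discriminantMatrix_apply hn' a S.1 (halfCompl hn' T.1)).trans ?_
      rw [halfCompl_halfCompl, Matrix.fromBlocks_apply₁₂]
      by_cases hST : S = T
      · subst hST
        rw [if_pos rfl, Matrix.diagonal_apply_eq]
      · rw [if_neg (fun h => hST (Subtype.ext h)), Matrix.diagonal_apply_ne _ hST]
    · refine (discriminantMatrix_apply hn' a (halfCompl hn' S.1) T.1).trans ?_
      rw [Matrix.fromBlocks_apply₂₁]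
      by_cases hST : S = T
      · subst hST
        rw [if_pos rfl, Matrix.diagonal_apply_eq]
      · rw [if_neg (fun h => hST (Subtype.ext ((halfCompl hn').injective h))),
          Matrix.diagonal_apply_ne _ hST]
    · refine (discriminantMatrix_apply hn' a _ _).trans (if_neg fun h => ?_)
      exact hne S T ((halfCompl hn').injective h)
  rw [hJ] at e₂
  refine semilinearCentralizer_hasBrauerClass h2 hd ?_ ?_ (e₁.trans e₂)
  · rw [Matrix.isUnit_diagonal]
    exact Pi.isUnit_iff.2 fun S => hμu S.1
  · ext S T
    have h1 : conj (Matrix.diagonal fun S : ι => μ S.1) = Matrix.diagonal fun S : ι => μ S.1 := by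
      ext S T
      rw [conj_apply, Matrix.diagonal_apply]
      split_ifs
      · exact hstar _
      · exact star_zero _
    rw [h1, Matrix.diagonal_mul_diagonal, Matrix.smul_apply, Matrix.diagonal_apply,
      Matrix.one_apply]
    split_ifs
    · rw [hμ, Algebra.algebraMap_eq_smul_one]
    · rw [smul_zero]

end Discriminant

/-! ### Discriminants, Clifford algebras and signatures of trace forms -/

section Invariants

open Module QuadraticMap

variable {F K : Type u} [Field F] [CommRing K] [StarRing K] [Algebra F K] [IsQuadraticEtale F K]

/-- In an even number of variables, the Clifford representation identifies the Clifford algebra of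
the trace form with the centralizer of a semilinear map with square `(-1) ^ m ∏ a i`. -/
theorem cliffordAlgebra_hasBrauerClass (h2 : (2 : F) ≠ 0) {m n : ℕ} (hm : 0 < m) (hn : n = 2 * m)
    {h : HermitianForm K n} {q : QuadraticForm F (Fin n → K)} (hq : IsTraceForm F h q)
    {P : Matrix (Fin n) (Fin n) K} (hPu : IsUnit P) {a : Fin n → F} (ha : ∀ i, a i ≠ 0)
    (hP : Pᴴ * h.gram * P = Matrix.diagonal fun i => algebraMap F K (a i)) {d : F} (hd : d ≠ 0)
    (hda : d = (-1) ^ m * ∏ i, a i) :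
    HasBrauerClass F (CliffordAlgebra q)
      (Quotient.mk (Brauer.CSA_Setoid F) (crossedProductCSA K h2 hd)) := by
  have hK := IsQuadraticEtale.isStandardInvolution F K h2
  have := hK.finite
  have := hK.nontrivial
  obtain ⟨m, rfl⟩ : ∃ k, m = k + 1 := ⟨m - 1, by omega⟩
  obtain rfl : n = 2 * m + 1 + 1 := by omega
  obtain ⟨u, rfl⟩ := hPu
  obtain ⟨ι, _, _, ρ, J, hρ⟩ := exists_isCliffordRep (K := K) h2
    (a := fun i : Fin (2 * m + 1) => a i.castSucc) fun i => ha _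
  have hρ' := hρ.step h2 (ha _)
  let e := mulVecEquiv F u
  let ρ' := cliffordStep (a (Fin.last _)) ρ ∘ₗ e.symm.toLinearMap
  have : Nonempty ι := by
    rw [← Fintype.card_pos_iff, hρ.card_eq]
    positivity
  let b := finBasis F (Fin (2 * m + 1 + 1) → K)
  have hdim : finrank F (Fin (2 * m + 1 + 1) → K) = (2 * m + 1 + 1) + (2 * m + 1 + 1) := by
    rw [finrank_pi_fintype, Finset.sum_const, IsQuadraticEtale.finrank_eq_two (F := F) (K := K),
      Finset.card_univ, Fintype.card_fin, smul_eq_mul, mul_two]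
  have hs1 : (-1 : F) ^ (2 * m + 1 + 1) = 1 := by
    rw [pow_succ, pow_succ, pow_mul]
    simp
  obtain ⟨e₁⟩ := cliffordAlgebra_equiv (q := q) (ρ := ρ') h2 (fun v => by
      obtain ⟨x, rfl⟩ := e.surjective v
      change cliffordStep _ ρ (e.symm (e x)) * cliffordStep _ ρ (e.symm (e x)) =
        algebraMap F _ (q (u.1 *ᵥ x))
      rw [e.symm_apply_apply, hρ'.sq, ← hq.apply_mulVec hP, algebraMap_smul,
        Algebra.algebraMap_eq_smul_one])
    hρ'.isUnit (fun v =>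
      (hρ'.mul_eq (e.symm v)).trans ((congrArg (· • _) hs1).trans (one_smul F _)))
    (by
      rw [← hρ'.adjoin_eq_top]
      congr 1
      change Set.range (cliffordStep _ ρ ∘ e.symm) = _
      exact e.symm.surjective.range_comp _) b
    (by rw [hρ'.card_eq, hdim, pow_add])
  refine semilinearCentralizer_hasBrauerClass h2 hd hρ.isUnit ?_ e₁
  have hs2 : (-1 : F) ^ ((2 * m + 1) * (2 * m + 1 + 1) / 2) = (-1) ^ (m + 1) := by
    rw [show (2 * m + 1) * (2 * m + 1 + 1) = 2 * ((2 * m + 1) * (m + 1)) by ring,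
      Nat.mul_div_cancel_left _ two_pos, pow_mul,
      Odd.neg_one_pow ⟨m, rfl⟩]
  have hs3 := Fin.prod_univ_castSucc a
  rw [smul_mul_assoc, hρ.mul_conj, smul_smul, hs1, hs2, hda, hs3]
  congr 1
  ring

/-- The columns of `P` are a basis, orthogonal for `h` if `P* G P` is diagonal. -/
theorem exists_orthogonal_basis {F K : Type u} [Field F] [CommRing K] [StarRing K] [Algebra F K]
    {n : ℕ} {h : HermitianForm K n}
    {P : Matrix (Fin n) (Fin n) K} (hPu : IsUnit P) {a : Fin n → F}
    (hP : Pᴴ * h.gram * P = Matrix.diagonal fun i => algebraMap F K (a i)) :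
    ∃ b : Basis (Fin n) K (Fin n → K),
      ∀ i j, h.toFun (b i) (b j) = if i = j then algebraMap F K (a i) else 0 := by
  obtain ⟨u, rfl⟩ := hPu
  let e : (Fin n → K) ≃ₗ[K] (Fin n → K) := LinearEquiv.ofLinearMap (Matrix.mulVecLin u.1)
    (Matrix.mulVecLin u⁻¹.1) (by rw [← Matrix.mulVecLin_mul, u.mul_inv, Matrix.mulVecLin_one])
    (by rw [← Matrix.mulVecLin_mul, u.inv_mul, Matrix.mulVecLin_one])
  refine ⟨(Pi.basisFun K (Fin n)).map e, fun i j => ?_⟩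
  have h1 : ∀ i, (Pi.basisFun K (Fin n)).map e i = u.1 *ᵥ Pi.single i 1 := fun i => by
    rw [Basis.map_apply, Pi.basisFun_apply]
    rfl
  rw [h1, h1, h.toFun_eq, Matrix.star_mulVec, ← Matrix.dotProduct_mulVec, Matrix.mulVec_mulVec,
    Matrix.mulVec_mulVec, hP, ← Pi.single_star, star_one, single_one_dotProduct,
    Matrix.mulVec_single_one, Matrix.col_apply, Matrix.diagonal_apply]

/-- The determinant of a Gram matrix in any basis differs from that in an orthogonal basis by a
square. -/
theorem hasSignedDiscriminant_of_equivalent {V : Type u} [AddCommGroup V] [Module F V]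
    {q : QuadraticForm F V} (h2 : (2 : F) ≠ 0) {κ : Type*} [Fintype κ] [DecidableEq κ] {w : κ → F}
    (hq : Equivalent q (weightedSumSquares F w)) {c : F} (hc : c ≠ 0)
    (hw : (-1) ^ (Fintype.card κ * (Fintype.card κ - 1) / 2) * ∏ k, w k = c ^ 2) :
    HasSignedDiscriminant q 1 := by
  obtain ⟨f⟩ := hq
  have hdim : finrank F V = Fintype.card κ := by
    rw [f.toLinearEquiv.finrank_eq, finrank_fintype_fun_eq_card]
  intro b
  let b₀ : Basis κ F V := (Pi.basisFun F κ).map f.toLinearEquiv.symm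
  let B : LinearMap.BilinForm F V := (2⁻¹ : F) • polarBilin q
  have hB : ∀ x y, B x y = polar q x y / 2 := fun x y => by
    rw [div_eq_inv_mul]
    rfl
  have hb : (Matrix.of fun i j => polar q (b i) (b j) / 2) = LinearMap.BilinForm.toMatrix b B := by
    ext i j
    rw [LinearMap.BilinForm.toMatrix_apply, hB, Matrix.of_apply]
  have hb₀ : LinearMap.BilinForm.toMatrix b₀ B = Matrix.diagonal w := by
    ext i j
    have hqf : ∀ x, q (f.toLinearEquiv.symm x) = weightedSumSquares F w x := fun x => by
      rw [← f.map_app]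
      exact congrArg _ (f.toLinearEquiv.apply_symm_apply x)
    have h1 : ∀ i, b₀ i = f.toLinearEquiv.symm (Pi.single i 1) := fun i => by
      rw [Basis.map_apply, Pi.basisFun_apply]
    rw [LinearMap.BilinForm.toMatrix_apply, hB, h1, h1, polar, ← map_add, hqf, hqf, hqf,
      weightedSumSquares_apply, weightedSumSquares_apply, weightedSumSquares_apply,
      ← Finset.sum_sub_distrib, ← Finset.sum_sub_distrib, Matrix.diagonal_apply, Finset.sum_div,
      Finset.sum_eq_single i]
    · simp only [Pi.add_apply, Pi.single_eq_same, smul_eq_mul]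
      by_cases hij : i = j
      · subst hij
        rw [if_pos rfl, Pi.single_eq_same]
        field_simp
        ring
      · rw [if_neg hij, Pi.single_eq_of_ne hij]
        ring
    · intro k _ hk
      simp only [Pi.add_apply, Pi.single_eq_of_ne hk, smul_eq_mul]
      ring
    · simp
  let e : κ ≃ Fin (finrank F V) := Fintype.equivFinOfCardEq hdim.symm
  let M := (b₀.reindex e).toMatrix b
  have hM : M.det ≠ 0 := by
    have h1 := congrArg Matrix.det (Basis.toMatrix_mul_toMatrix_flip (b₀.reindex e) b)
    rw [Matrix.det_mul, Matrix.det_one] at h1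
    exact left_ne_zero_of_mul_eq_one h1
  have hG : (LinearMap.BilinForm.toMatrix b B).det = M.det ^ 2 * ∏ k, w k := by
    rw [← LinearMap.BilinForm.toMatrix_mul_basis_toMatrix (b₀.reindex e) b, Matrix.det_mul,
      Matrix.det_mul, Matrix.det_transpose]
    have h1 : LinearMap.BilinForm.toMatrix (b₀.reindex e) B =
        Matrix.reindex e e (LinearMap.BilinForm.toMatrix b₀ B) := by
      ext i j
      simp [LinearMap.BilinForm.toMatrix_apply]
    rw [h1, Matrix.det_reindex_self, hb₀, Matrix.det_diagonal]
    ring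
  refine ⟨Units.mk0 (M.det * c) (mul_ne_zero hM hc), ?_⟩
  have hw' : (-1) ^ (finrank F V * (finrank F V - 1) / 2) * ∏ k, w k = c ^ 2 := by
    rw [hdim]
    exact hw
  rw [hb, hG, mul_left_comm, hw', Units.val_one, one_mul, Units.val_mk0]
  ring

theorem IsQuadraticEtale.exists_isNormBasis (F K : Type u) [Field F] [CommRing K] [StarRing K]
    [Algebra F K] [IsQuadraticEtale F K] (h2 : (2 : F) ≠ 0) :
    ∃ (b : Basis (Fin 2) F K) (δ : F), δ ≠ 0 ∧ IsNormBasis b ![1, -δ] := by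
  have hK := IsQuadraticEtale.isStandardInvolution F K h2
  obtain ⟨b, δ, hδ, hb0, hb1, hb2⟩ := IsQuadraticEtale.exists_basis F K h2
  refine ⟨b, δ, hδ, fun x => ?_⟩
  simp only [Fin.sum_univ_two, star_add, hK.star_smul, hb0, star_one, hb1]
  simp only [Algebra.smul_def, Matrix.cons_val_zero, Matrix.cons_val_one, map_add, map_mul, map_neg,
    map_pow, ← hb2, map_one]
  ring

/-- The trace form has the diagonal coefficients `a i` and `-δ a i`, with product
`((-δ) ^ m ∏ a i)²`, and its dimension is divisible by four. -/
theorem hasSignedDiscriminant_one (h2 : (2 : F) ≠ 0) {m n : ℕ} (hn : n = 2 * m)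
    {h : HermitianForm K n} {q : QuadraticForm F (Fin n → K)} (hq : IsTraceForm F h q)
    (hh : ∀ x, (∀ y, h.toFun x y = 0) → x = 0) : HasSignedDiscriminant q 1 := by
  have hK := IsQuadraticEtale.isStandardInvolution F K h2
  obtain ⟨P, a, hPu, ha, hP⟩ := exists_gram_eq_diagonal hK h2 hh
  obtain ⟨b, δ, hδ, hb⟩ := IsQuadraticEtale.exists_isNormBasis F K h2
  refine hasSignedDiscriminant_of_equivalent h2
    (hq.equivalent_weightedSumSquares hK hPu hP hb) (c := (∏ i, a i) * (-δ) ^ m)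
    (mul_ne_zero (Finset.prod_ne_zero_iff.2 fun i _ => ha i) (pow_ne_zero _ (neg_ne_zero.2 hδ))) ?_
  have h1 : Fintype.card (Fin n × Fin 2) * (Fintype.card (Fin n × Fin 2) - 1) / 2 =
      2 * (m * (Fintype.card (Fin n × Fin 2) - 1)) := by
    rw [Fintype.card_prod, Fintype.card_fin, Fintype.card_fin, hn]
    rw [show 2 * m * 2 * (2 * m * 2 - 1) = 2 * (2 * (m * (2 * m * 2 - 1))) by ring,
      Nat.mul_div_cancel_left _ two_pos]
  rw [h1, pow_mul, neg_one_sq, one_pow, one_mul, Fintype.prod_prod_type]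
  simp only [Fin.prod_univ_two, Matrix.cons_val_zero, Matrix.cons_val_one, mul_one]
  have h3 : (-δ) ^ n = (-δ) ^ m * (-δ) ^ m := by
    rw [hn, two_mul, pow_add]
  rw [Finset.prod_mul_distrib, Finset.prod_mul_distrib, Finset.prod_const, Finset.card_univ,
    Fintype.card_fin, h3]
  ring

/-- The norm form `(1, -δ)` of `K` has signature `2` if `δ < 0`, and `0` otherwise. -/
theorem exists_isUnitarySignature [LinearOrder F] [IsStrictOrderedRing F] {n : ℕ}
    {h : HermitianForm K n} {σ : Matrix (Fin n) (Fin n) K →ₗ[F] Matrix (Fin n) (Fin n) K}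
    (hσ : IsUnderlyingForm F σ h) {q : QuadraticForm F (Fin n → K)} (hq : IsTraceForm F h q) :
    ∃ s : ℕ, IsUnitarySignature σ s ∧ 2 * (s : ℤ) = |signature q| := by
  have hK := IsQuadraticEtale.isStandardInvolution F K two_ne_zero
  obtain ⟨b, δ, hδ, hb⟩ := IsQuadraticEtale.exists_isNormBasis F K two_ne_zero
  obtain ⟨S, hS, hT⟩ := exists_signature_eq hK hσ hq hb
  have hT := hT 2⁻¹ (by norm_num) (unitaryTraceForm F σ) fun x => by
    rw [← IsQuadraticEtale.trace_eq two_ne_zero]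
    rfl
  simp only [Fin.sum_univ_two, Matrix.cons_val_zero, Matrix.cons_val_one, sign_one] at hS hT
  rw [Left.sign_neg] at hS hT
  rcases hδ.lt_or_gt with hδ | hδ
  · rw [sign_neg hδ] at hS hT
    refine ⟨S.natAbs, ?_, ?_⟩
    · rw [IsUnitarySignature, hT, Int.natCast_natAbs, sq_abs]
      simp
      ring
    · rw [hS, abs_mul, Int.natCast_natAbs, mul_comm]
      rfl
  · rw [sign_pos hδ] at hS hT
    refine ⟨0, ?_, ?_⟩
    · rw [IsUnitarySignature, hT]
      simp
    · rw [hS]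
      simp

/-- The norm form `(1, -a, -b, a b)` of the quaternion algebra has signature `4` if `a, b < 0`,
and `0` otherwise. -/
theorem exists_isSymplecticSignature [LinearOrder F] [IsStrictOrderedRing F] {a b : F} (ha : a ≠ 0)
    (hb : b ≠ 0) {n : ℕ} {h : HermitianForm ℍ[F,a,b] n}
    {σ : Matrix (Fin n) (Fin n) ℍ[F,a,b] →ₗ[F] Matrix (Fin n) (Fin n) ℍ[F,a,b]}
    (hσ : IsUnderlyingForm F σ h) {q : QuadraticForm F (Fin n → ℍ[F,a,b])}
    (hq : IsTraceForm F h q) :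
    ∃ s : ℕ, IsSymplecticSignature σ s ∧ 2 * (s : ℤ) = |signature q| := by
  have hD := quaternion_isStandardInvolution two_ne_zero ha hb
  obtain ⟨S, hS, hT⟩ := exists_signature_eq hD hσ hq quaternion_isNormBasis
  have hT := hT 1 one_pos (symplecticTraceForm σ) fun x => by
    have h1 : ∀ y : Matrix (Fin n) (Fin n) ℍ[F,a,b],
        hD.trace y.trace = ∑ i, 2 * (y i i).re := fun y => by
      rw [Matrix.trace, map_sum]
      exact Finset.sum_congr rfl fun i _ => quaternion_trace hD _
    rw [h1, one_mul]
    rfl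
  have hsum : (∑ k, (SignType.sign ((![1, -a, -b, a * b] : Fin 4 → F) k) : ℤ)) = 0 ∨
      (∑ k, (SignType.sign ((![1, -a, -b, a * b] : Fin 4 → F) k) : ℤ)) = 4 := by
    simp only [Fin.sum_univ_four, Matrix.cons_val, sign_one, Left.sign_neg, sign_mul]
    rcases ha.lt_or_gt with ha | ha <;> rcases hb.lt_or_gt with hb | hb <;>
      simp [sign_neg, sign_pos, ha, hb]
  rcases hsum with h0 | h0 <;> rw [h0] at hS hT
  · refine ⟨0, ?_, ?_⟩
    · rw [IsSymplecticSignature, hT]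
      simp
    · rw [hS]
      simp
  · refine ⟨2 * S.natAbs, ?_, ?_⟩
    · rw [IsSymplecticSignature, hT, Nat.cast_mul, Int.natCast_natAbs, mul_pow, sq_abs]
      ring
    · rw [hS, abs_mul, Nat.cast_mul, Int.natCast_natAbs, ← mul_assoc, mul_comm]
      rfl

end Invariants

end LowIndex

end

open LowIndex in
theorem mainTheorem12 (F : Type u) [Field F] (h2 : (2 : F) ≠ 0) :
    (∀ (K : Type u) [CommRing K] [StarRing K] [Algebra F K] [IsQuadraticEtale F K]
      (n : ℕ) (_ : 0 < n) (σ : Matrix (Fin n) (Fin n) K →ₗ[F] Matrix (Fin n) (Fin n) K)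
      (_ : IsUnitary F σ),
      (∃ h : HermitianForm K n, IsUnderlyingForm F σ h) ∧
      (∀ h : HermitianForm K n, IsUnderlyingForm F σ h → ∃! q, IsTraceForm F h q) ∧
      ∀ q : QuadraticForm F (Fin n → K), IsTraceFormOf F σ q →
        (∀ q' : QuadraticForm F (Fin n → K),
          IsTraceFormOf F σ q' ↔ ∃ c : F, c ≠ 0 ∧ q' = c • q) ∧
        (wittIndex F σ = quadWittIndex q / 2 ∧ wittTwoIndex F σ = quadWittIndex q / 2) ∧
        (∀ m : ℕ, n = 2 * m →
          HasSignedDiscriminant q 1 ∧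
          ∃ β : BrauerGroup.{u, u} F,
            HasBrauerClass F (discriminantAlgebra σ m) β ∧
            HasBrauerClass F (CliffordAlgebra q) β) ∧
        ∀ (_ : LinearOrder F) (_ : IsStrictOrderedRing F),
          ∃ s : ℕ, IsUnitarySignature σ s ∧ 2 * (s : ℤ) = |signature q|) ∧
    (∀ (a b : F) (_ : a ≠ 0) (_ : b ≠ 0) (m : ℕ) (_ : 0 < m)
      (σ : Matrix (Fin m) (Fin m) ℍ[F,a,b] →ₗ[F] Matrix (Fin m) (Fin m) ℍ[F,a,b])
      (_ : IsSymplectic F σ),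
      (∃ h : HermitianForm ℍ[F,a,b] m, IsUnderlyingForm F σ h) ∧
      (∀ h : HermitianForm ℍ[F,a,b] m, IsUnderlyingForm F σ h → ∃! q, IsTraceForm F h q) ∧
      ∀ q : QuadraticForm F (Fin m → ℍ[F,a,b]), IsTraceFormOf F σ q →
        (∀ q' : QuadraticForm F (Fin m → ℍ[F,a,b]),
          IsTraceFormOf F σ q' ↔ ∃ c : F, c ≠ 0 ∧ q' = c • q) ∧
        (wittIndex F σ = quadWittIndex q / 2 ∧ wittTwoIndex F σ = quadWittIndex q / 2) ∧
        ∀ (_ : LinearOrder F) (_ : IsStrictOrderedRing F),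
          ∃ s : ℕ, IsSymplecticSignature σ s ∧ 2 * (s : ℤ) = |signature q|) := by
  constructor
  · intro K _ _ _ _ n hn σ hσ
    have hK := IsQuadraticEtale.isStandardInvolution F K h2
    have hd : Module.finrank F K = 2 ∨ Module.finrank F K = 4 :=
      Or.inl IsQuadraticEtale.finrank_eq_two
    refine ⟨hσ.exists_underlyingForm h2 hn, fun h _ => ⟨h.traceForm hK,
      h.isTraceForm_traceForm hK h2, fun q hq =>
        hq.unique hK (h.isTraceForm_traceForm hK h2)⟩, fun q hq => ?_⟩
    obtain ⟨h, hh, hq'⟩ := id hq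
    refine ⟨isTraceFormOf_iff hK h2 hn hq, ⟨wittIndex_eq hK h2 hd hn hh hq',
      wittTwoIndex_eq hK h2 hd hn hh hq'⟩,
      fun m hm => ⟨hasSignedDiscriminant_one h2 hm hq' hh.1, ?_⟩,
      fun _ _ => exists_isUnitarySignature hh hq'⟩
    obtain ⟨P, a, hPu, ha, hP⟩ := exists_gram_eq_diagonal hK h2 hh.1
    obtain ⟨b, hb⟩ := exists_orthogonal_basis hPu hP
    have hd0 : (-1) ^ m * ∏ i, a i ≠ 0 := mul_ne_zero (pow_ne_zero _ (neg_ne_zero.2 one_ne_zero))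
      (Finset.prod_ne_zero_iff.2 fun i _ => ha i)
    exact ⟨_, discriminantAlgebra_hasBrauerClass h2 hn hm hh ha hb hd0 rfl,
      cliffordAlgebra_hasBrauerClass h2 (by omega) hm hq' hPu ha hP hd0 rfl⟩
  · intro a b ha hb m hm σ hσ
    have hD := quaternion_isStandardInvolution h2 ha hb
    have hd : Module.finrank F ℍ[F,a,b] = 2 ∨ Module.finrank F ℍ[F,a,b] = 4 :=
      Or.inr (QuaternionAlgebra.finrank_eq_four a 0 b)
    refine ⟨hσ.exists_underlyingForm h2 ha hb hm, fun h _ => ⟨h.traceForm hD,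
      h.isTraceForm_traceForm hD h2, fun q hq =>
        hq.unique hD (h.isTraceForm_traceForm hD h2)⟩, fun q hq => ?_⟩
    obtain ⟨h, hh, hq'⟩ := id hq
    exact ⟨isTraceFormOf_iff hD h2 hm hq, ⟨wittIndex_eq hD h2 hd hm hh hq',
      wittTwoIndex_eq hD h2 hd hm hh hq'⟩, fun _ _ => exists_isSymplecticSignature ha hb hh hq'⟩
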